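/- Let $\Omega\subset\mathbb R^3$ be an arbitrary open set, let all function spaces be real, and let $H^1_0(\Omega)$ be the closure of the test functions on $\Omega$ in the norm $|u|_{H^1}=(|\nabla u|_{L^2}^2+|u|_{L^2}^2)^{1/2}$. For $0<\gamma<1$ a measurable $w\colon\Omega\to\mathbb R$ belongs to $\mathcal E_\gamma$ if there is $C>0$ such that for all $\varepsilon>0$ and $u\in H^1_0(\Omega)$ $$\bigl||w|^{1/2}u\bigr|_{L^2}\le C\bigl(\gamma\varepsilon|u|_{H^1}+(1-\gamma)\varepsilon^{-\gamma/(1-\gamma)}|u|_{L^2}\bigr),$$ and $w\in\mathcal E_1$ if $\bigl||w|^{1/2}u\bigr|_{L^2}\le C|u|_{H^1}$ for some $C>0$ and all $u\in H^1_0(\Omega)$. Hypothesis on the nonlinearity: $\overline C\ge 0$ and $\overline\rho\in[2,4)$ are constants, $c\colon\Omega\to[0,\infty)$ is in $L^1(\Omega)$, $a\colon\Omega\to\mathbb R$ is measurable with $a\in\mathcal E_\gamma$ for a given $\gamma\in(0,1)$, and $f\colon\Omega\times\mathbb R\to\mathbb R$ is such that $f(\cdot,s)$ is Lebesgue measurable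 for every $s\in\mathbb R$; $f(x,\cdot)$ is $C^1$ for a.e. $x$; for a.e. $x$ and all $s\in\mathbb R$, $|\partial_s f(x,s)|\le\overline C(a(x)+|s|^{\overline\rho})$, $f(x,s)s\le c(x)$ and $\int_0^s f(x,r)\,dr\le c(x)$; and $f(\cdot,0)\in L^2(\Omega)$. Let $X=L^2(\Omega)$ and let $A\colon D(A)\subset X\to X$ be a sectorial operator with $\operatorname{Re}\sigma(A)>0$. For $\alpha>0$ let $A^{-\alpha}=\Gamma(\alpha)^{-1}\int_0^\infty t^{\alpha-1}e^{-At}\,dt$, where $e^{-At}$ is the semigroup generated by $-A$, let $X^\alpha$ be the range of $A^{-\alpha}$ with norm $|A^{-\alpha}x|_{X^\alpha}=|x|_X$, and let $X^{-\alpha}$ be the dual space of $X^\alpha$; $X^0=X$. Suppose that $X^{1/2}$ is continuously included in $H^1_0(\Omega)$. Put $q=6/(\overline\rho+1)$ and $p=q/(q-1)$. If $\overline\rho>2$ or $a^2\notin\mathcal E_1$, let $\alpha\in(0,1/2)$ satisfy $$\alpha>\max\Bigl\{\frac{\gamma}{2},\ \frac12\Bigl(1-\frac{6-p}{2p}\Bigr)\Bigr\};$$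 if $\overline\rho=2$ and $a^2\in\mathcal E_1$, let $\alpha=0$. Let $F(x,s)=\int_0^s f(x,r)\,dr$ whenever $f(x,\cdot)$ is continuous and $F(x,s)=0$ otherwise, and for $g\colon\Omega\times\mathbb R\to\mathbb R$ write $\widehat g(u)(x)=g(x,u(x))$. Then the following hold. (1) $\widehat F$ maps $X^{1/2}$ into $L^1(\Omega)$, and $\widehat F\colon X^{1/2}\to L^1(\Omega)$ is Fréchet differentiable with $D\widehat F(u)h=\widehat f(u)\cdot h$ for $u,h\in X^{1/2}$. (2) Suppose $\overline\rho>2$ or $a^2\notin\mathcal E_1$. Then such $\alpha$ exist; for every such $\alpha$, $X^\alpha$ is continuously included in $L^p(\Omega)$, and $v\mapsto|a|^{1/2}v$ is a bounded linear map from $X^\alpha$ to $X$. For every $u\in X^{1/2}$ the functional $\mathbf f(u)\colon X^\alpha\to\mathbb R$, $v\mapsto\int_\Omega f(x,u(x))v(x)\,dx$, is defined (the integrand is integrable), linear and bounded, so $\mathbf f(u)\in X^{-\alpha}$. (3) Suppose $\overline\rho=2$ and $a^2\in\mathcal E_1$. Then $\mathbf f(u):=\widehat f(u)\in X=X^{-\alpha}$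 for every $u\in X^{1/2}$. (4) In both cases $\mathbf f\colon X^{1/2}\to X^{-\alpha}$ is Lipschitzian on bounded subsets of $X^{1/2}$. -/

import Mathlib

open MeasureTheory Filter Topology Set
open scoped ENNReal NNReal ContDiff

noncomputable section

/-! ### Sectorial operators, the generated semigroup, and fractional power spaces -/

section Abstract

variable {X : Type*} [NormedAddCommGroup X] [NormedSpace ℝ X]

/-- The complexification of `X` is modelled by `X × X`, the pair `(x, y)` standing for `x + i y`;
this is the norm `(‖x‖² + ‖y‖²)^{1/2}`, the usual one if `X` is a Hilbert space. -/
def complexNorm (w : X × X) : ℝ := Real.sqrt (‖w.1‖ ^ 2 + ‖w.2‖ ^ 2)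

/-- The operator `z - A` on the complexification of `X`:
`(z - A)(x + i y) = (Re z x - Im z y - A x) + i (Im z x + Re z y - A y)`. -/
def complexShift (A : X →ₗ.[ℝ] X) (z : ℂ) (w : A.domain × A.domain) : X × X :=
  (z.re • (w.1 : X) - z.im • (w.2 : X) - A w.1, z.im • (w.1 : X) + z.re • (w.2 : X) - A w.2)

/-- `z - A` is bijective on the complexification and `‖(z - A)⁻¹‖ ≤ K`. -/
def ResolventBound (A : X →ₗ.[ℝ] X) (z : ℂ) (K : ℝ) : Prop :=
  Function.Bijective (complexShift A z) ∧
    ∀ w : A.domain × A.domain,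
      complexNorm ((w.1 : X), (w.2 : X)) ≤ K * complexNorm (complexShift A z w)

/-- The resolvent set of (the complexification of) `A`. -/
def resolventSetC (A : X →ₗ.[ℝ] X) : Set ℂ := {z | ∃ K : ℝ, ResolventBound A z K}

/-- The spectrum of (the complexification of) `A`. -/
def spectrumC (A : X →ₗ.[ℝ] X) : Set ℂ := (resolventSetC A)ᶜ

/-- `A` is sectorial: it is closed, densely defined, and for some `φ ∈ (0, π/2)`, `M ≥ 1`, `b ∈ ℝ`
the sector `{z | φ ≤ |arg (z - b)| ≤ π, z ≠ b}` lies in the resolvent set of `A` and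
`‖(z - A)⁻¹‖ ≤ M / |z - b|` there. -/
def IsSectorial (A : X →ₗ.[ℝ] X) : Prop :=
  A.IsClosed ∧ Dense (A.domain : Set X) ∧
    ∃ φ M b : ℝ, 0 < φ ∧ φ < Real.pi / 2 ∧ 1 ≤ M ∧
      ∀ z : ℂ, z ≠ (b : ℂ) → φ ≤ |Complex.arg (z - (b : ℂ))| →
        ResolventBound A z (M / ‖z - (b : ℂ)‖)

/-- `S` (its values at `t ≥ 0`) is a strongly continuous semigroup of bounded linear operators
whose infinitesimal generator is `-A`. -/
structure IsSemigroupOf (A : X →ₗ.[ℝ] X) (S : ℝ → X →L[ℝ] X) : Prop where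
  zero : S 0 = ContinuousLinearMap.id ℝ X
  add : ∀ s t : ℝ, 0 ≤ s → 0 ≤ t → S (s + t) = (S s).comp (S t)
  tendsto : ∀ u : X, Tendsto (fun t => S t u) (𝓝[>] 0) (𝓝 u)
  generator : ∀ u v : X,
    (u, v) ∈ A.graph ↔ Tendsto (fun t : ℝ => t⁻¹ • (S t u - u)) (𝓝[>] 0) (𝓝 (-v))

open Classical in
/-- `semigroupOf A t = e^{-At}`, the strongly continuous semigroup generated by `-A` (a strongly
continuous semigroup is determined on `t ≥ 0` by its generator). -/
def semigroupOf (A : X →ₗ.[ℝ] X) : ℝ → X →L[ℝ] X :=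
  if h : ∃ S : ℝ → X →L[ℝ] X, IsSemigroupOf A S then h.choose else fun _ => 0

/-- `negPow A α = A^{-α}`: for `α > 0` it is `Γ(α)⁻¹ ∫_0^∞ t^{α-1} e^{-At} dt`, and `A^0 = Id`. -/
def negPow (A : X →ₗ.[ℝ] X) (α : ℝ) : X →L[ℝ] X :=
  if α = 0 then ContinuousLinearMap.id ℝ X
  else (Real.Gamma α)⁻¹ • ∫ t in Ioi (0 : ℝ), t ^ (α - 1) • semigroupOf A t

/-- The fractional power space `X^α`, the range of `A^{-α}` (as a type of its own, because its norm
is not the one of `X`). -/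
def FracSpace (A : X →ₗ.[ℝ] X) (α : ℝ) : Type _ :=
  ↥(LinearMap.range (negPow A α : X →ₗ[ℝ] X))

namespace FracSpace

variable (A : X →ₗ.[ℝ] X) (α : ℝ)

instance instAddCommGroup : AddCommGroup (FracSpace A α) :=
  inferInstanceAs (AddCommGroup ↥(LinearMap.range (negPow A α : X →ₗ[ℝ] X)))

instance instModule : Module ℝ (FracSpace A α) :=
  inferInstanceAs (Module ℝ ↥(LinearMap.range (negPow A α : X →ₗ[ℝ] X)))

/-- The inclusion `X^α ⊂ X`. -/
def incl : FracSpace A α →ₗ[ℝ] X :=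
  (LinearMap.range (negPow A α : X →ₗ[ℝ] X)).subtype

instance isClosed_ker_negPow :
    IsClosed ((LinearMap.ker (negPow A α : X →ₗ[ℝ] X) : Submodule ℝ X) : Set X) :=
  ContinuousLinearMap.isClosed_ker (negPow A α)

/-- `A^α` as a map on `X^α`: the inverse of the bijection `X ⧸ ker A^{-α} → X^α` induced by
`A^{-α}` (the kernel is trivial for the operators of interest). -/
def posPow : FracSpace A α ≃ₗ[ℝ] X ⧸ LinearMap.ker (negPow A α : X →ₗ[ℝ] X) :=
  ((negPow A α : X →ₗ[ℝ] X).quotKerEquivRange).symm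

/-- The norm `|u|_{X^α} = |A^α u|_X`, i.e. the infimum (over one point if `A^{-α}` is injective)
of `|x|_X` over all `x` with `A^{-α} x = u`. -/
instance instNormedAddCommGroup : NormedAddCommGroup (FracSpace A α) :=
  NormedAddCommGroup.induced (FracSpace A α) (X ⧸ LinearMap.ker (negPow A α : X →ₗ[ℝ] X))
    (posPow A α) (posPow A α).injective

instance instNormedSpace : NormedSpace ℝ (FracSpace A α) :=
  NormedSpace.induced ℝ (FracSpace A α) (X ⧸ LinearMap.ker (negPow A α : X →ₗ[ℝ] X))
    (posPow A α : FracSpace A α →ₗ[ℝ] X ⧸ LinearMap.ker (negPow A α : X →ₗ[ℝ] X))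

/-- If `A^{-α}` is injective, then `|A^{-α} x|_{X^α} = |x|_X`. -/
theorem norm_eq_of_injective (h : Function.Injective (negPow A α)) (u : FracSpace A α) (x : X)
    (hx : negPow A α x = incl A α u) : ‖u‖ = ‖x‖ := by
  have hker : LinearMap.ker (negPow A α : X →ₗ[ℝ] X) = ⊥ := LinearMap.ker_eq_bot.2 h
  have h1 : posPow A α u = Submodule.Quotient.mk x :=
    (LinearEquiv.symm_apply_eq _).2 (Subtype.ext hx.symm)
  change ‖posPow A α u‖ = ‖x‖
  rw [h1]
  refine le_antisymm (Submodule.Quotient.norm_mk_le _ x) ?_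
  refine le_of_forall_pos_le_add fun ε hε => ?_
  obtain ⟨m, hm, hm'⟩ := Submodule.Quotient.norm_mk_lt
    (S := LinearMap.ker (negPow A α : X →ₗ[ℝ] X)) (Submodule.Quotient.mk x) hε
  have h2 := (Submodule.Quotient.eq _).1 hm
  rw [hker, Submodule.mem_bot, sub_eq_zero] at h2
  subst h2
  exact hm'.le

end FracSpace

end Abstract

/-! ### Function spaces on an open set of `ℝ³` -/

/-- `ℝ³` with the Euclidean norm. -/
abbrev E3 : Type := EuclideanSpace ℝ (Fin 3)

/-- Lebesgue measure on `Ω`. Functions on `Ω` are represented by functions on `ℝ³`, whose values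
outside `Ω` play no role. -/
abbrev volOn (Ω : Set E3) : Measure E3 := volume.restrict Ω

/-- `L²(Ω)`, real valued. -/
abbrev L2 (Ω : Set E3) : Type := Lp ℝ 2 (volOn Ω)

/-- `L²(Ω) × L²(Ω; ℝ³)` with norm `(|u|² + |g|²)^{1/2}`. -/
abbrev L2Pair (Ω : Set E3) : Type := WithLp 2 (Lp ℝ 2 (volOn Ω) × Lp E3 2 (volOn Ω))

/-- `H¹₀(Ω)`, the closure of the test functions in the `H¹`-norm. An element is the pair `(u, ∇u)`,
and its norm in `L2Pair Ω` is `|u|_{H¹} = (|∇u|²_{L²} + |u|²_{L²})^{1/2}`. -/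
def H10 (Ω : Set E3) : Set (L2Pair Ω) :=
  closure {w | ∃ φ : E3 → ℝ, ContDiff ℝ ∞ φ ∧ HasCompactSupport φ ∧ tsupport φ ⊆ Ω ∧
    w.fst =ᵐ[volOn Ω] φ ∧ w.snd =ᵐ[volOn Ω] fun x => gradient φ x}

/-- The class `𝓔_γ` of weights on `Ω`, `γ ∈ (0, 1]`. -/
def EClass (Ω : Set E3) (γ : ℝ) (w : E3 → ℝ) : Prop :=
  AEMeasurable w (volOn Ω) ∧
    ((0 < γ ∧ γ < 1 ∧ ∃ C : ℝ, 0 < C ∧ ∀ ε : ℝ, 0 < ε → ∀ u ∈ H10 Ω,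
        eLpNorm (fun x => Real.sqrt |w x| * u.fst x) 2 (volOn Ω) ≤
          ENNReal.ofReal (C * (γ * ε * ‖u‖ + (1 - γ) * ε ^ (-γ / (1 - γ)) * ‖u.fst‖))) ∨
      (γ = 1 ∧ ∃ C : ℝ, 0 < C ∧ ∀ u ∈ H10 Ω,
        eLpNorm (fun x => Real.sqrt |w x| * u.fst x) 2 (volOn Ω) ≤ ENNReal.ofReal (C * ‖u‖)))

/-- The standing hypothesis on the nonlinearity `f` (with constants `Cbar`, `ρ`, `γ` and coefficient
functions `c`, `a`). -/
structure NonlinearityHyp (Ω : Set E3) (Cbar ρ γ : ℝ) (c a : E3 → ℝ) (f : E3 → ℝ → ℝ) :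
    Prop where
  Cbar_nonneg : 0 ≤ Cbar
  two_le_rho : 2 ≤ ρ
  rho_lt_four : ρ < 4
  c_nonneg : ∀ x ∈ Ω, 0 ≤ c x
  c_integrable : Integrable c (volOn Ω)
  gamma_pos : 0 < γ
  gamma_lt_one : γ < 1
  a_mem : EClass Ω γ a
  f_measurable : ∀ s : ℝ, AEMeasurable (fun x => f x s) (volOn Ω)
  f_contDiff : ∀ᵐ x ∂(volOn Ω), ContDiff ℝ 1 (f x)
  f_growth : ∀ᵐ x ∂(volOn Ω), ∀ s : ℝ, |deriv (f x) s| ≤ Cbar * (a x + |s| ^ ρ)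
  f_zero : MemLp (fun x => f x 0) 2 (volOn Ω)
  f_dissipative : ∀ᵐ x ∂(volOn Ω), ∀ s : ℝ, f x s * s ≤ c x ∧ ∫ r in (0 : ℝ)..s, f x r ≤ c x

open Classical in
/-- The primitive `F(x, s) = ∫_0^s f(x, r) dr` where `f(x, ·)` is continuous, and `0` elsewhere. -/
def primitiveF (f : E3 → ℝ → ℝ) (x : E3) (s : ℝ) : ℝ :=
  if Continuous (f x) then ∫ r in (0 : ℝ)..s, f x r else 0

/-- The Nemytskii operator `ĝ(u)(x) = g(x, u(x))`. -/
def nemytskii (g : E3 → ℝ → ℝ) (u : E3 → ℝ) (x : E3) : ℝ := g x (u x)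

/-- `q = 6 / (ρ + 1)`. -/
def qExp (ρ : ℝ) : ℝ := 6 / (ρ + 1)

/-- `p = q / (q - 1)`, the exponent conjugate to `q`. -/
def pExp (ρ : ℝ) : ℝ := qExp ρ / (qExp ρ - 1)

/-- The regular case `ρ = 2` and `a² ∈ 𝓔_1`. -/
def RegularCase (Ω : Set E3) (ρ : ℝ) (a : E3 → ℝ) : Prop :=
  ρ = 2 ∧ EClass Ω 1 (fun x => a x ^ 2)

/-- The admissible orders `α`: `α = 0` in the regular case, and otherwise
`α ∈ (0, 1/2)` with `α > max {γ/2, (1 - (6 - p)/(2p))/2}`. -/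
def AdmissibleOrder (Ω : Set E3) (ρ γ : ℝ) (a : E3 → ℝ) (α : ℝ) : Prop :=
  (RegularCase Ω ρ a → α = 0) ∧
    (¬ RegularCase Ω ρ a →
      0 < α ∧ α < 1 / 2 ∧ max (γ / 2) ((1 - (6 - pExp ρ) / (2 * pExp ρ)) / 2) < α)

end

/-!
The argument has an operator part and a function space part.

*Operators.* A sectorial operator `A` with spectrum in `Re z > 0` generates an exponentially
decaying semigroup. On the complexification, a compactness argument turns the two hypotheses into a
bound `‖(A - δ + λ)⁻¹‖ ≤ C / (1 + |λ|)` on a sector `|arg λ| ≤ θ` with `δ > 0` and `θ > π/2`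
(`exists_sectorialResolvent`), and `e^{-t(A - δ)}` is the contour integral
`(2πi)⁻¹ ∫ e^{λt} (A - δ + λ)⁻¹ dλ` along the boundary of this sector (`holSemigroup`). It is
bounded, satisfies the semigroup law and has the right generator. As a semigroup is determined by
its generator (`IsSemigroupWithGraph.eq_of_graph`), it commutes with complex conjugation, hence acts on
the real space, and up to the factor `e^{-δt}` it is the semigroup `semigroupOf A`
(`IsSectorial.exists_isDecayingSemigroup`).

Decay makes the integrals for `A^{-α}` converge and gives Balakrishnan's formula
`A^{-α} = (Γ(α) Γ(1 - α))⁻¹ ∫ s^{-α} (s + A)⁻¹ ds` for `0 < α < 1`. Suppose now that on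
`X^{1/2}` a second norm satisfies `|u| ≤ C |u|_X^{1-θ} |A^{1/2} u|_X^θ`. Since `(s + A)⁻¹ x` is
`O(1/s)` in `X` and `A^{1/2} (s + A)⁻¹ x` is `O(s^{-1/2})`, the integrand above is
`O(s^{-α-1+θ/2})` at infinity in that norm and `O(s^{-α-θ/2})` at `0`. Hence `X^α` is continuously
included in any Banach space over `X` with this norm on `X^{1/2}`, as soon as `θ/2 < α < 1/2`
(`IsDecayingSemigroup.exists_lift_fracPow`); here that space is the closed graph of a multiplication
operator from `L²(Ω)` to `L²(Ω)` or `L^p(Ω)` (`mulGraph`).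
No domain of a fractional power other than `X^{1/2}` has to be identified.

*Function spaces.* Sobolev's inequality gives `H¹₀(Ω) ⊂ L⁶(Ω)`, hence the interpolation inequality
for `L^p(Ω)` with `θ = 1 - (6 - p)/(2p)`; optimising `ε` in the definition of `𝓔_γ` gives the one
for `|a|^{1/2} u` in `L²(Ω)` with `θ = γ`. These are the two lower bounds on `α`. Integrating the
growth condition, `|f(x, s) - f(x, t)| ≤ C (|a(x)| + |s|^ρ + |t|^ρ) |s - t|`; tested with `v`, the
term with `a` is split as `|a|^{1/2} |a|^{1/2}` between two factors in `L²`, and the powers are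
handled by Hölder's inequality with `1/q = ρ/6 + 1/6` and `1/p + 1/q = 1`. The same estimate bounds
the Taylor remainder of the primitive by a multiple of the square of the norm of the increment.
-/

noncomputable section

/-! ### Fractional powers of the generator of a decaying semigroup -/

section Decay

variable {X : Type*} [NormedAddCommGroup X] [NormedSpace ℝ X]

/-- `S`, on `t > 0`, is an exponentially decaying semigroup. Only measurability in the operator norm
is required, and nothing at `t = 0`. -/
structure IsDecayingSemigroup (S : ℝ → X →L[ℝ] X) (M δ : ℝ) : Prop where
  aestronglyMeasurable : AEStronglyMeasurable S (volume.restrict (Ioi 0))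
  add : ∀ s t : ℝ, 0 < s → 0 < t → S (s + t) = S s * S t
  delta_pos : 0 < δ
  bound : ∀ t, 0 < t → ‖S t‖ ≤ M * Real.exp (-(δ * t))

/-- The resolvent `(s + A)⁻¹ = ∫_0^∞ e^{-st} S(t) dt` of the generator `-A` of `S`. -/
def laplaceRes (S : ℝ → X →L[ℝ] X) (s : ℝ) : X →L[ℝ] X :=
  ∫ t in Ioi (0 : ℝ), Real.exp (-(s * t)) • S t

/-- `A^{-α} = Γ(α)⁻¹ ∫_0^∞ t^{α-1} S(t) dt` for the generator `-A` of `S`, `α > 0`. -/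
def fracPow (S : ℝ → X →L[ℝ] X) (α : ℝ) : X →L[ℝ] X :=
  (Real.Gamma α)⁻¹ • ∫ t in Ioi (0 : ℝ), t ^ (α - 1) • S t

/-- `A^{1/2} (s + A)⁻¹`, written as `A^{-1/2} A (s + A)⁻¹ = A^{-1/2} (1 - s (s + A)⁻¹)`. -/
def halfRes (S : ℝ → X →L[ℝ] X) (s : ℝ) : X →L[ℝ] X :=
  fracPow S (1 / 2) * (1 - s • laplaceRes S s)

namespace IsDecayingSemigroup

variable {S : ℝ → X →L[ℝ] X} {M δ : ℝ}

theorem M_nonneg (h : IsDecayingSemigroup S M δ) : 0 ≤ M := by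
  have := (norm_nonneg _).trans (h.bound 1 one_pos)
  exact nonneg_of_mul_nonneg_left this (Real.exp_pos _)

theorem integrableOn_smul (h : IsDecayingSemigroup S M δ) {φ : ℝ → ℝ} (hφ : Measurable φ)
    (hint : IntegrableOn (fun t => φ t * Real.exp (-(δ * t))) (Ioi 0)) :
    IntegrableOn (fun t => φ t • S t) (Ioi 0) := by
  refine Integrable.mono' (hint.norm.const_mul M) (hφ.aestronglyMeasurable.smul
    h.aestronglyMeasurable) ?_
  filter_upwards [ae_restrict_mem measurableSet_Ioi] with t ht
  rw [norm_smul, norm_mul, Real.norm_of_nonneg (Real.exp_pos _).le]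
  calc ‖φ t‖ * ‖S t‖ ≤ ‖φ t‖ * (M * Real.exp (-(δ * t))) := by
        gcongr; exact h.bound t ht
    _ = _ := by ring

theorem integrableOn_exp (h : IsDecayingSemigroup S M δ) {s : ℝ} (hs : 0 ≤ s) :
    IntegrableOn (fun t => Real.exp (-(s * t)) • S t) (Ioi 0) := by
  refine h.integrableOn_smul (by fun_prop) ?_
  have := integrableOn_exp_mul_Ioi (a := -(s + δ)) (by linarith [h.delta_pos]) 0
  refine this.congr_fun (fun t _ => ?_) measurableSet_Ioi
  simp only [← Real.exp_add]; ring_nf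

theorem integrableOn_rpow (h : IsDecayingSemigroup S M δ) {α : ℝ} (hα : 0 < α) :
    IntegrableOn (fun t => t ^ (α - 1) • S t) (Ioi 0) := by
  refine h.integrableOn_smul (by fun_prop) ?_
  have := integrableOn_rpow_mul_exp_neg_mul_rpow (s := α - 1) (p := 1) (b := δ) (by linarith)
    one_pos h.delta_pos
  refine this.congr_fun (fun t _ => ?_) measurableSet_Ioi
  simp

theorem norm_laplaceRes_le (h : IsDecayingSemigroup S M δ) {s : ℝ} (hs : 0 ≤ s) :
    ‖laplaceRes S s‖ ≤ M / (s + δ) := by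
  have hδ := h.delta_pos
  have hi := integrableOn_exp_mul_Ioi (a := -(s + δ)) (by linarith) 0
  have hv : ∫ t in Ioi (0 : ℝ), Real.exp (-(s + δ) * t) = 1 / (s + δ) := by
    rw [integral_exp_mul_Ioi (by linarith)]; rw [mul_zero, Real.exp_zero, neg_div_neg_eq]
  calc ‖laplaceRes S s‖ ≤ ∫ t in Ioi (0 : ℝ), M * Real.exp (-(s + δ) * t) := by
        refine norm_integral_le_of_norm_le (hi.const_mul M) ?_
        filter_upwards [ae_restrict_mem measurableSet_Ioi] with t ht
        rw [norm_smul, Real.norm_of_nonneg (Real.exp_pos _).le]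
        calc _ ≤ Real.exp (-(s * t)) * (M * Real.exp (-(δ * t))) := by
              gcongr; exact h.bound t ht
          _ = M * (Real.exp (-(s * t)) * Real.exp (-(δ * t))) := by ring
          _ = _ := by rw [← Real.exp_add]; ring_nf
    _ = M / (s + δ) := by rw [integral_const_mul, hv]; ring

/-- The product of two integrals against `S` is the integral of the convolution against `S`. -/
theorem integral_mul_integral [CompleteSpace X] (h : IsDecayingSemigroup S M δ) {φ ψ : ℝ → ℝ}
    (hφ : IntegrableOn (fun t => φ t • S t) (Ioi 0))
    (hψ : IntegrableOn (fun t => ψ t • S t) (Ioi 0)) :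
    (∫ t in Ioi (0 : ℝ), φ t • S t) * (∫ t in Ioi (0 : ℝ), ψ t • S t) =
      ∫ x in Ioi (0 : ℝ), (∫ t in (0 : ℝ)..x, φ t * ψ (x - t)) • S x := by
  have := integral_posConvolution hφ hψ (ContinuousLinearMap.mul ℝ (X →L[ℝ] X))
  rw [ContinuousLinearMap.mul_apply'] at this
  rw [← this]
  refine setIntegral_congr_fun measurableSet_Ioi fun x hx => ?_
  rw [← intervalIntegral.integral_smul_const (fun t => φ t * ψ (x - t)) (S x),
    intervalIntegral.integral_of_le (le_of_lt hx),
    intervalIntegral.integral_of_le (le_of_lt hx), integral_Ioc_eq_integral_Ioo,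
    integral_Ioc_eq_integral_Ioo]
  refine setIntegral_congr_fun measurableSet_Ioo fun t ht => ?_
  simp only [ContinuousLinearMap.mul_apply']
  rw [smul_mul_smul_comm, ← h.add t (x - t) ht.1 (sub_pos.2 ht.2)]
  congr 2; ring

/-- The resolvent identity. -/
theorem resolvent_identity [CompleteSpace X] (h : IsDecayingSemigroup S M δ) {r s : ℝ} (hr : 0 ≤ r)
    (hs : 0 ≤ s) :
    laplaceRes S r - laplaceRes S s = (s - r) • (laplaceRes S r * laplaceRes S s) := by
  unfold laplaceRes
  rw [h.integral_mul_integral (h.integrableOn_exp hr) (h.integrableOn_exp hs),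
    ← integral_sub (h.integrableOn_exp hr) (h.integrableOn_exp hs), ← integral_smul]
  refine setIntegral_congr_fun measurableSet_Ioi fun x hx => ?_
  rw [← sub_smul, smul_smul]
  congr 1
  rcases eq_or_ne r s with rfl | hrs
  · simp
  have h1 : ∀ t : ℝ, Real.exp (-(r * t)) * Real.exp (-(s * (x - t))) =
      Real.exp (-(s * x)) * Real.exp ((s - r) * t) := by
    intro t; rw [← Real.exp_add, ← Real.exp_add]; ring_nf
  have h2 : s - r ≠ 0 := sub_ne_zero.2 hrs.symm
  simp_rw [h1]
  rw [intervalIntegral.integral_const_mul, intervalIntegral.integral_comp_mul_left (fun t => Real.exp t) h2,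
    integral_exp]
  simp only [smul_eq_mul, mul_zero, Real.exp_zero]
  field_simp
  rw [mul_sub, ← Real.exp_add]; ring_nf

theorem laplaceRes_comm [CompleteSpace X] (h : IsDecayingSemigroup S M δ) {r s : ℝ} (hr : 0 ≤ r)
    (hs : 0 ≤ s) : laplaceRes S r * laplaceRes S s = laplaceRes S s * laplaceRes S r := by
  rcases eq_or_ne r s with rfl | hrs
  · rfl
  have h1 := h.resolvent_identity hr hs
  have h2 := h.resolvent_identity hs hr
  rw [← neg_sub, h1, ← neg_sub s r, neg_smul, neg_inj] at h2
  exact smul_right_injective _ (sub_ne_zero.2 hrs.symm) h2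

theorem continuousOn_laplaceRes [CompleteSpace X] (h : IsDecayingSemigroup S M δ) :
    ContinuousOn (laplaceRes S) (Ici 0) := by
  have hδ := h.delta_pos
  have hM := h.M_nonneg
  have hb : ∀ s : ℝ, 0 ≤ s → ‖laplaceRes S s‖ ≤ M / δ := fun s hs =>
    (h.norm_laplaceRes_le hs).trans (by gcongr; linarith)
  have : LipschitzOnWith (Real.toNNReal ((M / δ) * (M / δ))) (laplaceRes S) (Ici 0) := by
    refine LipschitzOnWith.of_dist_le_mul fun r hr s hs => ?_
    rw [dist_eq_norm, h.resolvent_identity hr hs, norm_smul, Real.coe_toNNReal _ (by positivity),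
      Real.dist_eq, abs_sub_comm r s, Real.norm_eq_abs, mul_comm]
    gcongr
    exact (norm_mul_le _ _).trans (mul_le_mul (hb r hr) (hb s hs) (norm_nonneg _) (by positivity))
  exact this.continuousOn

/-- The beta integral `B(1/2, 1/2) = π`. -/
theorem integral_rpow_neg_half_conv {x : ℝ} (hx : 0 < x) :
    ∫ t in (0 : ℝ)..x, t ^ ((1 / 2 : ℝ) - 1) * (x - t) ^ ((1 / 2 : ℝ) - 1) = Real.pi := by
  have h1 := Complex.betaIntegral_scaled (1 / 2) (1 / 2) hx
  have h2 : Complex.betaIntegral (1 / 2) (1 / 2) = Real.pi := by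
    have := Complex.Gamma_mul_Gamma_eq_betaIntegral (s := 1 / 2) (t := 1 / 2) (by norm_num)
      (by norm_num)
    rw [Complex.Gamma_one_half_eq] at this
    norm_num at this
    rw [← this, ← Complex.cpow_add _ _ (by exact_mod_cast Real.pi_ne_zero)]
    norm_num
  rw [h2] at h1
  have h3 : ((∫ t in (0 : ℝ)..x, t ^ ((1 / 2 : ℝ) - 1) * (x - t) ^ ((1 / 2 : ℝ) - 1) : ℝ) : ℂ) =
      Real.pi := by
    rw [← intervalIntegral.integral_ofReal]
    have h4 : (x : ℂ) ^ ((1 / 2 : ℂ) + 1 / 2 - 1) * Real.pi = Real.pi := by norm_num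
    rw [← h4, ← h1]
    rw [intervalIntegral.integral_of_le hx.le, intervalIntegral.integral_of_le hx.le]
    refine setIntegral_congr_fun measurableSet_Ioc fun t ht => ?_
    push_cast [Complex.ofReal_cpow ht.1.le, Complex.ofReal_cpow (sub_nonneg.2 ht.2)]
    norm_num
  exact_mod_cast h3

/-- `A^{-1/2} A^{-1/2} = A⁻¹`. -/
theorem fracPow_half_mul_self [CompleteSpace X] (h : IsDecayingSemigroup S M δ) :
    fracPow S (1 / 2) * fracPow S (1 / 2) = laplaceRes S 0 := by
  unfold fracPow laplaceRes
  have hi := h.integrableOn_rpow (α := 1 / 2) (by norm_num)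
  rw [smul_mul_smul_comm, h.integral_mul_integral hi hi, ← integral_smul]
  refine setIntegral_congr_fun measurableSet_Ioi fun x hx => ?_
  rw [integral_rpow_neg_half_conv hx, smul_smul, Real.Gamma_one_half_eq]
  congr 1
  rw [← mul_inv, Real.mul_self_sqrt Real.pi_pos.le, inv_mul_cancel₀ Real.pi_ne_zero]
  simp

/-- **Balakrishnan's formula.** -/
theorem fracPow_eq_integral_laplaceRes [CompleteSpace X] (h : IsDecayingSemigroup S M δ) {α : ℝ}
    (hα : 0 < α) (hα1 : α < 1) :
    IntegrableOn (fun s => s ^ (-α) • laplaceRes S s) (Ioi 0) ∧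
    fracPow S α =
      (Real.Gamma α * Real.Gamma (1 - α))⁻¹ • ∫ s in Ioi (0 : ℝ), s ^ (-α) • laplaceRes S s := by
  set μ := volume.restrict (Ioi (0 : ℝ)) with hμ
  have hval : ∀ t : ℝ, 0 < t → ∫ s in Ioi (0 : ℝ), s ^ (-α) * Real.exp (-(s * t)) =
      Real.Gamma (1 - α) * t ^ (α - 1) := by
    intro t ht
    have := Real.integral_rpow_mul_exp_neg_mul_Ioi (a := 1 - α) (r := t) (by linarith) ht
    rw [one_div, Real.inv_rpow ht.le, ← Real.rpow_neg ht.le] at this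
    rw [mul_comm (Real.Gamma _)]
    convert! this using 3
    · ring_nf
    · ring_nf
  have hs : ∀ t : ℝ, 0 < t → Integrable (fun s => s ^ (-α) * Real.exp (-(s * t))) μ := by
    intro t ht
    have := integrableOn_rpow_mul_exp_neg_mul_rpow (s := -α) (p := 1) (b := t) (by linarith)
      one_pos ht
    refine this.congr_fun (fun s _ => ?_) measurableSet_Ioi
    simp [mul_comm]
  have hpos : 0 < Real.Gamma (1 - α) := Real.Gamma_pos_of_pos (by linarith)
  have hmeas : AEStronglyMeasurable
      (fun z : ℝ × ℝ => (z.1 ^ (-α) * Real.exp (-(z.1 * z.2))) • S z.2) (μ.prod μ) := by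
    have h1 : AEStronglyMeasurable (fun z : ℝ × ℝ => S z.2) (μ.prod μ) :=
      h.aestronglyMeasurable.comp_snd
    have h2 : Measurable (fun z : ℝ × ℝ => z.1 ^ (-α) * Real.exp (-(z.1 * z.2))) := by fun_prop
    exact h2.aestronglyMeasurable.smul h1
  have hint : Integrable
      (fun z : ℝ × ℝ => (z.1 ^ (-α) * Real.exp (-(z.1 * z.2))) • S z.2) (μ.prod μ) := by
    rw [integrable_prod_iff' hmeas]
    constructor
    · filter_upwards [ae_restrict_mem measurableSet_Ioi] with t ht
      refine Integrable.smul_const ?_ (S t)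
      exact hs t ht
    · have : ∀ t ∈ Ioi (0 : ℝ), ∫ s, ‖(s ^ (-α) * Real.exp (-(s * t))) • S t‖ ∂μ =
          ‖Real.Gamma (1 - α) • (t ^ (α - 1) • S t)‖ := by
        intro t ht
        rw [norm_smul, norm_smul, ← mul_assoc, Real.norm_of_nonneg hpos.le,
          Real.norm_of_nonneg (Real.rpow_nonneg (le_of_lt ht) _), ← hval t ht, ← integral_mul_const]
        refine setIntegral_congr_fun measurableSet_Ioi fun s hs => ?_
        have : 0 ≤ s ^ (-α) := Real.rpow_nonneg (le_of_lt hs) _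
        rw [norm_smul, Real.norm_of_nonneg (by positivity)]
      refine Integrable.congr (((h.integrableOn_rpow hα).smul (Real.Gamma (1 - α))).norm) ?_
      filter_upwards [ae_restrict_mem measurableSet_Ioi] with t ht
      exact (this t ht).symm
  have hin : ∀ s : ℝ, ∫ t, (s ^ (-α) * Real.exp (-(s * t))) • S t ∂μ =
      s ^ (-α) • laplaceRes S s := by
    intro s
    unfold laplaceRes
    rw [← integral_smul]
    simp only [smul_smul, hμ]
  constructor
  · refine (hint.integral_prod_left).congr (Eventually.of_forall fun s => ?_)
    exact hin s
  · have hsw := integral_integral_swap (f := fun s t => (s ^ (-α) * Real.exp (-(s * t))) • S t) hint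
    simp only [hin] at hsw
    rw [hsw]
    have : ∫ t, ∫ s, (s ^ (-α) * Real.exp (-(s * t))) • S t ∂μ ∂μ =
        ∫ t in Ioi (0 : ℝ), Real.Gamma (1 - α) • (t ^ (α - 1) • S t) := by
      refine setIntegral_congr_fun measurableSet_Ioi fun t ht => ?_
      rw [integral_smul_const, hval t ht, smul_smul]
    rw [this, integral_smul, smul_smul, mul_inv, mul_assoc, inv_mul_cancel₀ hpos.ne', mul_one]
    rfl

theorem fracPow_half_mul_halfRes [CompleteSpace X] (h : IsDecayingSemigroup S M δ) {s : ℝ}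
    (hs : 0 ≤ s) : fracPow S (1 / 2) * halfRes S s = laplaceRes S s := by
  have := h.resolvent_identity le_rfl hs
  rw [sub_zero] at this
  rw [halfRes, ← mul_assoc, h.fracPow_half_mul_self, mul_sub, mul_one, mul_smul_comm, ← this]
  abel

theorem continuousOn_halfRes [CompleteSpace X] (h : IsDecayingSemigroup S M δ) :
    ContinuousOn (halfRes S) (Ici 0) :=
  continuousOn_const.mul (continuousOn_const.sub (continuousOn_id.smul h.continuousOn_laplaceRes))

theorem norm_one_sub_smul_laplaceRes_le (h : IsDecayingSemigroup S M δ) {s : ℝ}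
    (hs : 0 ≤ s) : ‖1 - s • laplaceRes S s‖ ≤ 1 + M := by
  have hδ := h.delta_pos
  have hM := h.M_nonneg
  refine (norm_sub_le _ _).trans (add_le_add ContinuousLinearMap.norm_id_le ?_)
  rw [norm_smul, Real.norm_of_nonneg hs]
  calc s * ‖laplaceRes S s‖ ≤ s * (M / (s + δ)) := by gcongr; exact h.norm_laplaceRes_le hs
    _ ≤ M := by
      rw [mul_div_assoc', div_le_iff₀ (by positivity)]
      nlinarith

theorem norm_laplaceRes_le' (h : IsDecayingSemigroup S M δ) {s : ℝ} (hs : 0 < s) :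
    ‖laplaceRes S s‖ ≤ M / s := by
  have hδ := h.delta_pos
  have hM := h.M_nonneg
  exact (h.norm_laplaceRes_le hs.le).trans (by gcongr; linarith)

/-- `‖A^{1/2} (s + A)⁻¹‖ = O(s^{-1/2})`: Balakrishnan's formula for `A^{-1/2}` expresses this
operator by `∫ r^{-1/2} (r + A)⁻¹ A (s + A)⁻¹ dr`, where `A` is absorbed by the resolvent at `s` if
`r ≥ s` and by the one at `r` if `r ≤ s`. -/
theorem norm_halfRes_le [CompleteSpace X] (h : IsDecayingSemigroup S M δ) {s : ℝ} (hs : 0 < s) :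
    ‖halfRes S s‖ ≤ 4 * M * (1 + M) * s ^ (-(1 / 2) : ℝ) := by
  have hδ := h.delta_pos
  have hM := h.M_nonneg
  obtain ⟨hi, hB⟩ := h.fracPow_eq_integral_laplaceRes (α := 1 / 2) (by norm_num) (by norm_num)
  set T := 1 - s • laplaceRes S s with hT
  have hTn : ‖T‖ ≤ 1 + M := h.norm_one_sub_smul_laplaceRes_le hs.le
  have hΓ : (Real.Gamma (1 / 2) * Real.Gamma (1 - 1 / 2))⁻¹ = Real.pi⁻¹ := by
    rw [show (1 : ℝ) - 1 / 2 = 1 / 2 by norm_num, Real.Gamma_one_half_eq,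
      Real.mul_self_sqrt Real.pi_pos.le]
  have hiT : IntegrableOn (fun r => (r ^ (-(1 / 2) : ℝ) • laplaceRes S r) * T) (Ioi 0) :=
    hi.mul_const T
  have h1 : halfRes S s = Real.pi⁻¹ • ∫ r in Ioi (0 : ℝ), (r ^ (-(1 / 2) : ℝ) • laplaceRes S r) * T := by
    rw [halfRes, hB, hΓ, smul_mul_assoc]
    congr 1
    exact (integral_mul_const_of_integrable hi).symm
  have hb1 : ∀ r : ℝ, 0 < r → ‖laplaceRes S r * T‖ ≤ M * (1 + M) / r := fun r hr => by
    refine (norm_mul_le _ _).trans ?_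
    rw [mul_comm M, mul_div_assoc, mul_comm]
    exact mul_le_mul hTn (h.norm_laplaceRes_le' hr) (norm_nonneg _) (by positivity)
  have hb2 : ∀ r : ℝ, 0 < r → ‖laplaceRes S r * T‖ ≤ M * (1 + M) / s := fun r hr => by
    have : laplaceRes S r * T = laplaceRes S s * (1 - r • laplaceRes S r) := by
      have h1 := h.resolvent_identity hr.le hs.le
      rw [sub_smul, sub_eq_sub_iff_add_eq_add] at h1
      rw [hT, mul_sub, mul_sub, mul_one, mul_one, mul_smul_comm, mul_smul_comm,
        ← h.laplaceRes_comm hr.le hs.le, sub_eq_sub_iff_add_eq_add, h1]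
      abel
    rw [this]
    refine (norm_mul_le _ _).trans ?_
    rw [mul_comm M, mul_div_assoc, mul_comm]
    exact mul_le_mul (h.norm_one_sub_smul_laplaceRes_le hr.le) (h.norm_laplaceRes_le' hs)
      (norm_nonneg _) (by positivity)
  have hu : Ioc 0 s ∪ Ioi s = Ioi (0 : ℝ) := Ioc_union_Ioi_eq_Ioi hs.le
  have hpi : Real.pi⁻¹ ≤ 1 := inv_le_one_of_one_le₀ (by linarith [Real.pi_gt_three])
  have hI1 : ‖∫ r in Ioc 0 s, (r ^ (-(1 / 2) : ℝ) • laplaceRes S r) * T‖ ≤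
      2 * M * (1 + M) * s ^ (-(1 / 2) : ℝ) := by
    have hint : IntegrableOn (fun r : ℝ => r ^ (-(1 / 2) : ℝ)) (Ioc 0 s) :=
      (intervalIntegrable_iff_integrableOn_Ioc_of_le hs.le).1
        (intervalIntegral.intervalIntegrable_rpow' (by norm_num))
    have hv : ∫ r in Ioc 0 s, r ^ (-(1 / 2) : ℝ) = 2 * s ^ (1 / 2 : ℝ) := by
      rw [← intervalIntegral.integral_of_le hs.le, integral_rpow (Or.inl (by norm_num))]
      norm_num
      ring
    calc _ ≤ ∫ r in Ioc 0 s, (M * (1 + M) / s) * r ^ (-(1 / 2) : ℝ) := by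
          refine norm_integral_le_of_norm_le (hint.const_mul _) ?_
          filter_upwards [ae_restrict_mem measurableSet_Ioc] with r hr
          rw [smul_mul_assoc, norm_smul, mul_comm,
            Real.norm_of_nonneg (Real.rpow_nonneg hr.1.le _)]
          exact mul_le_mul_of_nonneg_right (hb2 r hr.1) (Real.rpow_nonneg hr.1.le _)
      _ = 2 * M * (1 + M) * (s ^ (1 / 2 : ℝ) * s⁻¹) := by
          rw [integral_const_mul, hv]; ring
      _ = _ := by
          rw [← Real.rpow_neg_one s, ← Real.rpow_add hs]; norm_num
  have hI2 : ‖∫ r in Ioi s, (r ^ (-(1 / 2) : ℝ) • laplaceRes S r) * T‖ ≤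
      2 * M * (1 + M) * s ^ (-(1 / 2) : ℝ) := by
    have hint : IntegrableOn (fun r : ℝ => r ^ (-(3 / 2) : ℝ)) (Ioi s) :=
      integrableOn_Ioi_rpow_of_lt (by norm_num) hs
    have hv : ∫ r in Ioi s, r ^ (-(3 / 2) : ℝ) = 2 * s ^ (-(1 / 2) : ℝ) := by
      rw [integral_Ioi_rpow_of_lt (by norm_num) hs]
      norm_num
      ring
    calc _ ≤ ∫ r in Ioi s, (M * (1 + M)) * r ^ (-(3 / 2) : ℝ) := by
          refine norm_integral_le_of_norm_le (hint.const_mul _) ?_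
          filter_upwards [ae_restrict_mem measurableSet_Ioi] with r hr
          have hr0 : 0 < r := hs.trans hr
          rw [smul_mul_assoc, norm_smul, mul_comm,
            Real.norm_of_nonneg (Real.rpow_nonneg hr0.le _)]
          refine (mul_le_mul_of_nonneg_right (hb1 r hr0) (Real.rpow_nonneg hr0.le _)).trans_eq ?_
          rw [div_mul_eq_mul_div, mul_div_assoc, div_eq_mul_inv, ← Real.rpow_neg_one r,
            ← Real.rpow_add hr0]
          norm_num
      _ = _ := by rw [integral_const_mul, hv]; ring
  rw [h1, norm_smul, ← hu, setIntegral_union (Ioc_disjoint_Ioi le_rfl) measurableSet_Ioi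
    (hiT.mono_set (hu ▸ subset_union_left)) (hiT.mono_set (hu ▸ subset_union_right)),
    Real.norm_of_nonneg (inv_nonneg.2 Real.pi_pos.le)]
  refine (mul_le_of_le_one_left (norm_nonneg _) hpi).trans ((norm_add_le _ _).trans ?_)
  linarith

/-- Interpolation: let `K` be a Banach space over `X` through which `A^{-1/2}` factors, with
`‖A^{-1/2} y‖_K ≤ C ‖A^{-1/2} y‖^{1-θ} ‖y‖^θ`. Then `A^{-α}` factors through `K` for
`θ / 2 < α < 1 / 2`: by Balakrishnan's formula, where `y = A^{1/2} (s + A)⁻¹ x` makes the integrand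
integrable in `K`. -/
theorem exists_lift_fracPow [CompleteSpace X] (h : IsDecayingSemigroup S M δ)
    {K : Type*} [NormedAddCommGroup K] [NormedSpace ℝ K] [CompleteSpace K]
    (J : K →L[ℝ] X) (G : X →L[ℝ] K) (hJG : J ∘L G = fracPow S (1 / 2)) {C θ α : ℝ}
    (hθ : 0 ≤ θ) (hθ1 : θ < 1)
    (hG : ∀ y, ‖G y‖ ≤ C * ‖fracPow S (1 / 2) y‖ ^ (1 - θ) * ‖y‖ ^ θ)
    (hα : θ / 2 < α) (hα1 : α < 1 / 2) :
    ∃ L : X →L[ℝ] K, J ∘L L = fracPow S α := by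
  have hδ := h.delta_pos
  have hM := h.M_nonneg
  have hα0 : 0 < α := by linarith
  obtain ⟨hi, hB⟩ := h.fracPow_eq_integral_laplaceRes (α := α) hα0 (by linarith)
  set D := 4 * M * (1 + M) with hD
  have hD0 : 0 ≤ D := by positivity
  have hbound : ∀ s : ℝ, 0 < s → ‖G ∘L halfRes S s‖ ≤
      |C| * (M / (s + δ)) ^ (1 - θ) * (D ^ θ * s ^ (-(θ / 2))) := by
    intro s hs
    have hq : 0 ≤ M / (s + δ) := by positivity
    have hs2 : 0 ≤ s ^ (-(1 / 2) : ℝ) := Real.rpow_nonneg hs.le _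
    have e : D ^ θ * s ^ (-(θ / 2)) = (D * s ^ (-(1 / 2) : ℝ)) ^ θ := by
      rw [Real.mul_rpow hD0 hs2, ← Real.rpow_mul hs.le]
      congr 2; ring
    rw [e]
    refine ContinuousLinearMap.opNorm_le_bound _ (by positivity) fun y => ?_
    rw [ContinuousLinearMap.comp_apply]
    refine (hG _).trans ?_
    have h1 : fracPow S (1 / 2) (halfRes S s y) = laplaceRes S s y := by
      rw [← h.fracPow_half_mul_halfRes hs.le]; rfl
    rw [h1]
    have h2 : ‖laplaceRes S s y‖ ≤ M / (s + δ) * ‖y‖ :=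
      ContinuousLinearMap.le_of_opNorm_le _ (h.norm_laplaceRes_le hs.le) y
    have h3 : ‖halfRes S s y‖ ≤ D * s ^ (-(1 / 2) : ℝ) * ‖y‖ :=
      ContinuousLinearMap.le_of_opNorm_le _ (h.norm_halfRes_le hs) y
    have hy : ‖y‖ = ‖y‖ ^ (1 - θ) * ‖y‖ ^ θ := by
      rcases (norm_nonneg y).eq_or_lt with h0 | h0
      · rw [← h0, Real.zero_rpow (x := 1 - θ) (by linarith), zero_mul]
      · rw [← Real.rpow_add h0]; simp
    have h1θ : 0 ≤ 1 - θ := by linarith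
    calc C * ‖laplaceRes S s y‖ ^ (1 - θ) * ‖halfRes S s y‖ ^ θ
        ≤ |C| * (M / (s + δ) * ‖y‖) ^ (1 - θ) * (D * s ^ (-(1 / 2) : ℝ) * ‖y‖) ^ θ := by
          gcongr
          exact le_abs_self C
      _ = |C| * (M / (s + δ)) ^ (1 - θ) * (D * s ^ (-(1 / 2) : ℝ)) ^ θ *
            (‖y‖ ^ (1 - θ) * ‖y‖ ^ θ) := by
          rw [Real.mul_rpow hq (norm_nonneg _), Real.mul_rpow (by positivity) (norm_nonneg _)]
          ring
      _ = _ := by rw [← hy]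
  have hmeas : AEStronglyMeasurable (fun s => s ^ (-α) • (G ∘L halfRes S s))
      (volume.restrict (Ioi 0)) := by
    have h1 : Measurable (fun s : ℝ => s ^ (-α)) := by fun_prop
    refine h1.aestronglyMeasurable.smul ?_
    refine ContinuousOn.aestronglyMeasurable ?_ measurableSet_Ioi
    exact (continuousOn_const.clm_comp h.continuousOn_halfRes).mono Ioi_subset_Ici_self
  have hL : IntegrableOn (fun s => s ^ (-α) • (G ∘L halfRes S s)) (Ioi 0) := by
    rw [← Ioc_union_Ioi_eq_Ioi (zero_le_one' ℝ)]
    refine IntegrableOn.union ?_ ?_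
    · have hint : IntegrableOn (fun r : ℝ => r ^ (-α - θ / 2)) (Ioc 0 1) :=
        (intervalIntegrable_iff_integrableOn_Ioc_of_le zero_le_one).1
          (intervalIntegral.intervalIntegrable_rpow' (by linarith))
      refine Integrable.mono' (hint.const_mul (|C| * (M / δ) ^ (1 - θ) * D ^ θ))
        (hmeas.mono_set Ioc_subset_Ioi_self) ?_
      filter_upwards [ae_restrict_mem measurableSet_Ioc] with s hs
      have hs0 := hs.1
      have hsα : 0 ≤ s ^ (-α) := Real.rpow_nonneg hs.1.le _
      have hsθ : 0 ≤ s ^ (-(θ / 2)) := Real.rpow_nonneg hs.1.le _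
      rw [norm_smul, Real.norm_of_nonneg hsα]
      calc _ ≤ s ^ (-α) * (|C| * (M / δ) ^ (1 - θ) * (D ^ θ * s ^ (-(θ / 2)))) := by
            gcongr
            refine (hbound s hs0).trans ?_
            gcongr
            linarith
        _ = |C| * (M / δ) ^ (1 - θ) * D ^ θ * (s ^ (-α) * s ^ (-(θ / 2))) := by ring
        _ = _ := by rw [← Real.rpow_add hs0]; ring_nf
    · have hint : IntegrableOn (fun r : ℝ => r ^ (-α - (1 - θ) - θ / 2)) (Ioi 1) :=
        integrableOn_Ioi_rpow_of_lt (by linarith) one_pos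
      refine Integrable.mono' (hint.const_mul (|C| * M ^ (1 - θ) * D ^ θ))
        (hmeas.mono_set (Ioi_subset_Ioi zero_le_one)) ?_
      filter_upwards [ae_restrict_mem measurableSet_Ioi] with s hs
      have hs0 : 0 < s := one_pos.trans hs
      have hsα : 0 ≤ s ^ (-α) := Real.rpow_nonneg hs0.le _
      have hsθ : 0 ≤ s ^ (-(θ / 2)) := Real.rpow_nonneg hs0.le _
      rw [norm_smul, Real.norm_of_nonneg hsα]
      calc _ ≤ s ^ (-α) * (|C| * (M / s) ^ (1 - θ) * (D ^ θ * s ^ (-(θ / 2)))) := by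
            gcongr
            refine (hbound s hs0).trans ?_
            gcongr
            linarith
        _ = |C| * M ^ (1 - θ) * D ^ θ * (s ^ (-α) * s ^ (-(1 - θ)) * s ^ (-(θ / 2))) := by
            rw [Real.div_rpow hM hs0.le, Real.rpow_neg hs0.le (1 - θ)]; ring
        _ = _ := by rw [← Real.rpow_add hs0, ← Real.rpow_add hs0]; ring_nf
  refine ⟨(Real.Gamma α * Real.Gamma (1 - α))⁻¹ • ∫ s in Ioi (0 : ℝ), s ^ (-α) • (G ∘L halfRes S s), ?_⟩
  rw [hB, ContinuousLinearMap.comp_smul]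
  congr 1
  have := (ContinuousLinearMap.compL ℝ X K X J).integral_comp_comm hL
  simp only [ContinuousLinearMap.compL_apply] at this
  rw [← this]
  refine setIntegral_congr_fun measurableSet_Ioi fun s hs => ?_
  rw [ContinuousLinearMap.comp_smul, ← ContinuousLinearMap.comp_assoc, hJG,
    ← h.fracPow_half_mul_halfRes (le_of_lt hs)]
  rfl

end IsDecayingSemigroup
end Decay

/-! ### Cauchy's theorem in a sector -/

section SectorCauchy

variable {E : Type*} [NormedAddCommGroup E] [NormedSpace ℂ E]

/-- The integrand of `∫ F dλ` along the ray `λ = r e^{iφ}`. -/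
def rayFun (F : ℂ → E) (φ r : ℝ) : E :=
  Complex.exp (φ * Complex.I) • F (r * Complex.exp (φ * Complex.I))

theorem norm_exp_ofReal_mul_I_smul (φ : ℝ) (x : E) : ‖Complex.exp (φ * Complex.I) • x‖ = ‖x‖ := by
  rw [norm_smul, Complex.norm_exp_ofReal_mul_I, one_mul]

theorem norm_rayFun (F : ℂ → E) (φ r : ℝ) :
    ‖rayFun F φ r‖ = ‖F (r * Complex.exp (φ * Complex.I))‖ :=
  norm_exp_ofReal_mul_I_smul _ _

theorem continuousOn_rayFun {F : ℂ → E} {φ : ℝ}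
    (hF : ∀ r : ℝ, 0 < r → ContinuousAt F (r * Complex.exp (φ * Complex.I))) :
    ContinuousOn (rayFun F φ) (Ioi 0) := by
  intro r hr
  have h1 : Continuous fun r : ℝ => (r : ℂ) * Complex.exp (φ * Complex.I) := by fun_prop
  have h2 : ContinuousAt (fun r : ℝ => F (r * Complex.exp (φ * Complex.I))) r :=
    ContinuousAt.comp (f := fun r : ℝ => (r : ℂ) * Complex.exp (φ * Complex.I)) (hF r hr)
      h1.continuousAt
  exact (h2.const_smul _).continuousWithinAt

/-- Cauchy's theorem for the sector of radius `ρ`. -/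
theorem rayFun_integral_sub_eq_arc [CompleteSpace E] {F : ℂ → E} {φ₁ φ₂ ρ B : ℝ} (hφ : φ₁ ≤ φ₂)
    (hρ : 0 < ρ)
    (hd : ∀ r φ : ℝ, 0 < r → φ ∈ Icc φ₁ φ₂ →
      DifferentiableAt ℂ F (r * Complex.exp (φ * Complex.I)))
    (hB : ∀ r φ : ℝ, 0 < r → r ≤ ρ → φ ∈ Icc φ₁ φ₂ →
      ‖F (r * Complex.exp (φ * Complex.I))‖ ≤ B) :
    (∫ r in (0 : ℝ)..ρ, rayFun F φ₂ r) - (∫ r in (0 : ℝ)..ρ, rayFun F φ₁ r) =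
      ∫ φ in φ₁..φ₂, (Complex.I * ρ) • rayFun F φ ρ := by
  have hm1 : φ₁ ∈ Icc φ₁ φ₂ := left_mem_Icc.2 hφ
  have hm2 : φ₂ ∈ Icc φ₁ φ₂ := right_mem_Icc.2 hφ
  have hB0 : 0 ≤ B := (norm_nonneg _).trans (hB ρ φ₁ hρ le_rfl hm1)
  have hcont : ∀ φ ∈ Icc φ₁ φ₂, ContinuousOn (rayFun F φ) (Ioi 0) := fun φ hφ =>
    continuousOn_rayFun fun r hr => (hd r φ hr hφ).continuousAt
  -- the identity for the annular sector `a ≤ |λ| ≤ ρ`, from the rectangle in the variable `log λ`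
  have hann : ∀ a : ℝ, 0 < a → a ≤ ρ →
      (∫ r in a..ρ, rayFun F φ₂ r) - (∫ r in a..ρ, rayFun F φ₁ r) =
        (∫ φ in φ₁..φ₂, (Complex.I * ρ) • rayFun F φ ρ) -
          ∫ φ in φ₁..φ₂, (Complex.I * a) • rayFun F φ a := by
    intro a ha haρ
    let f : ℂ → E := fun w => Complex.exp w • F (Complex.exp w)
    have hexp : ∀ x φ : ℝ, Complex.exp (x + φ * Complex.I) =
        (Real.exp x : ℂ) * Complex.exp (φ * Complex.I) := fun x φ => by
      rw [Complex.exp_add, Complex.ofReal_exp]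
    have hline : ∀ φ ∈ Icc φ₁ φ₂, (∫ x in Real.log a..Real.log ρ, f (x + φ * Complex.I)) =
        ∫ r in a..ρ, rayFun F φ r := by
      intro φ hφ
      have := intervalIntegral.integral_deriv_smul_comp''' (a := Real.log a) (b := Real.log ρ)
        (f := Real.exp) (f' := Real.exp) (g := rayFun F φ) Real.continuous_exp.continuousOn
        (fun x _ => (Real.hasDerivAt_exp x).hasDerivWithinAt)
        ((hcont φ hφ).mono ?_) ?_ ?_
      · rw [Real.exp_log ha, Real.exp_log hρ] at this
        rw [← this]
        refine intervalIntegral.integral_congr fun x _ => ?_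
        simp only [f, hexp, rayFun, Function.comp, mul_smul]
        rfl
      · rintro _ ⟨x, -, rfl⟩; exact Real.exp_pos x
      · refine ContinuousOn.integrableOn_compact (isCompact_uIcc.image Real.continuous_exp)
          ((hcont φ hφ).mono ?_)
        rintro _ ⟨x, -, rfl⟩; exact Real.exp_pos x
      · refine ContinuousOn.integrableOn_compact isCompact_uIcc ?_
        refine Real.continuous_exp.continuousOn.smul ((hcont φ hφ).comp
          Real.continuous_exp.continuousOn fun x _ => Real.exp_pos x)
    have harc : ∀ r : ℝ, 0 < r → Complex.I • (∫ φ in φ₁..φ₂, f (Real.log r + φ * Complex.I)) =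
        ∫ φ in φ₁..φ₂, (Complex.I * r) • rayFun F φ r := by
      intro r hr
      rw [← intervalIntegral.integral_smul]
      refine intervalIntegral.integral_congr fun φ _ => ?_
      simp only [f, hexp, rayFun, Real.exp_log hr, mul_smul]
    have hrect := Complex.integral_boundary_rect_eq_zero_of_differentiableOn f
      ⟨Real.log a, φ₁⟩ ⟨Real.log ρ, φ₂⟩ (fun w hw => by
        have hw2 : w.im ∈ Icc φ₁ φ₂ := by
          have := hw.2
          rwa [mem_preimage, uIcc_of_le hφ] at this
        have e : Complex.exp w = (Real.exp w.re : ℂ) * Complex.exp (w.im * Complex.I) := by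
          rw [← hexp, Complex.re_add_im]
        have h1 := hd _ _ (Real.exp_pos w.re) hw2
        rw [← e] at h1
        exact (Complex.differentiableAt_exp.smul
          (h1.comp w Complex.differentiableAt_exp)).differentiableWithinAt)
    simp only at hrect
    rw [hline φ₁ hm1, hline φ₂ hm2, harc ρ hρ, harc a ha] at hrect
    rw [← sub_eq_zero, ← neg_eq_zero, ← hrect]
    abel
  have hint : ∀ φ ∈ Icc φ₁ φ₂, IntervalIntegrable (rayFun F φ) volume 0 ρ := by
    intro φ hφ
    rw [intervalIntegrable_iff_integrableOn_Ioc_of_le hρ.le]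
    refine Integrable.mono' (g := fun _ => B) (integrableOn_const (by simp)) ?_ ?_
    · exact (((hcont φ hφ).mono Ioc_subset_Ioi_self)).aestronglyMeasurable measurableSet_Ioc
    · filter_upwards [ae_restrict_mem measurableSet_Ioc] with r hr
      rw [norm_rayFun]
      exact hB r φ hr.1 hr.2 hφ
  have hsmall : ∀ a : ℝ, 0 < a → a ≤ ρ →
      ‖(∫ r in (0 : ℝ)..ρ, rayFun F φ₂ r) - (∫ r in (0 : ℝ)..ρ, rayFun F φ₁ r) -
        ∫ φ in φ₁..φ₂, (Complex.I * ρ) • rayFun F φ ρ‖ ≤ B * (2 + (φ₂ - φ₁)) * a := by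
    intro a ha haρ
    have hs : ∀ φ ∈ Icc φ₁ φ₂, ‖∫ r in (0 : ℝ)..a, rayFun F φ r‖ ≤ B * a := by
      intro φ hφ
      have := intervalIntegral.norm_integral_le_of_norm_le_const (a := 0) (b := a)
        (f := rayFun F φ) (C := B) (fun r hr => by
          rw [uIoc_of_le ha.le] at hr
          rw [norm_rayFun]
          exact hB r φ hr.1 (hr.2.trans haρ) hφ)
      rwa [sub_zero, abs_of_pos ha] at this
    have harc : ‖∫ φ in φ₁..φ₂, (Complex.I * a) • rayFun F φ a‖ ≤ a * B * (φ₂ - φ₁) := by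
      have := intervalIntegral.norm_integral_le_of_norm_le_const (a := φ₁) (b := φ₂)
        (f := fun φ => (Complex.I * a) • rayFun F φ a) (C := a * B) (fun φ hφ' => by
          rw [uIoc_of_le hφ] at hφ'
          rw [norm_smul, norm_rayFun, norm_mul, Complex.norm_I, one_mul, Complex.norm_real,
            Real.norm_of_nonneg ha.le]
          exact mul_le_mul_of_nonneg_left (hB a φ ha haρ ⟨hφ'.1.le, hφ'.2⟩) ha.le)
      rwa [abs_of_nonneg (sub_nonneg.2 hφ)] at this
    have hsplit : ∀ φ ∈ Icc φ₁ φ₂, (∫ r in (0 : ℝ)..ρ, rayFun F φ r) =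
        (∫ r in (0 : ℝ)..a, rayFun F φ r) + ∫ r in a..ρ, rayFun F φ r := by
      intro φ hφ
      refine (intervalIntegral.integral_add_adjacent_intervals ((hint φ hφ).mono_set ?_)
        ((hint φ hφ).mono_set ?_)).symm
      · rw [uIcc_of_le ha.le, uIcc_of_le hρ.le]; exact Icc_subset_Icc_right haρ
      · rw [uIcc_of_le haρ, uIcc_of_le hρ.le]; exact Icc_subset_Icc_left ha.le
    have e : (∫ r in (0 : ℝ)..ρ, rayFun F φ₂ r) - (∫ r in (0 : ℝ)..ρ, rayFun F φ₁ r) -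
        (∫ φ in φ₁..φ₂, (Complex.I * ρ) • rayFun F φ ρ) =
        (∫ r in (0 : ℝ)..a, rayFun F φ₂ r) - (∫ r in (0 : ℝ)..a, rayFun F φ₁ r) -
          ∫ φ in φ₁..φ₂, (Complex.I * a) • rayFun F φ a := by
      rw [hsplit φ₁ hm1, hsplit φ₂ hm2, add_sub_add_comm, hann a ha haρ]
      abel
    rw [e]
    refine (norm_sub_le _ _).trans ((add_le_add ((norm_sub_le _ _).trans
      (add_le_add (hs φ₂ hm2) (hs φ₁ hm1))) harc).trans_eq ?_)
    ring
  rw [← sub_eq_zero, ← norm_le_zero_iff]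
  set N := ‖(∫ r in (0 : ℝ)..ρ, rayFun F φ₂ r) - (∫ r in (0 : ℝ)..ρ, rayFun F φ₁ r) -
        ∫ φ in φ₁..φ₂, (Complex.I * ρ) • rayFun F φ ρ‖
  have hlim : Tendsto (fun a : ℝ => B * (2 + (φ₂ - φ₁)) * a) (𝓝[>] 0) (𝓝 0) := by
    have : Tendsto (fun a : ℝ => B * (2 + (φ₂ - φ₁)) * a) (𝓝 0) (𝓝 (B * (2 + (φ₂ - φ₁)) * 0)) :=
      tendsto_id.const_mul _
    rw [mul_zero] at this
    exact this.mono_left nhdsWithin_le_nhds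
  refine ge_of_tendsto hlim ?_
  filter_upwards [Ioc_mem_nhdsGT hρ] with a ha
  exact hsmall a ha.1 ha.2

/-- Rays can be rotated inside a sector in which `F` is holomorphic, bounded near the vertex, and
`o(1 / |λ|)` at infinity. -/
theorem integral_rayFun_eq [CompleteSpace E] {F : ℂ → E} {φ₁ φ₂ B : ℝ} (hφ : φ₁ ≤ φ₂)
    (hd : ∀ r φ : ℝ, 0 < r → φ ∈ Icc φ₁ φ₂ →
      DifferentiableAt ℂ F (r * Complex.exp (φ * Complex.I)))
    (hB : ∀ r φ : ℝ, 0 < r → φ ∈ Icc φ₁ φ₂ → ‖F (r * Complex.exp (φ * Complex.I))‖ ≤ B)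
    {g : ℝ → ℝ} (hg : Tendsto g atTop (𝓝 0))
    (hgF : ∀ r φ : ℝ, 0 < r → φ ∈ Icc φ₁ φ₂ →
      r * ‖F (r * Complex.exp (φ * Complex.I))‖ ≤ g r)
    (h1 : IntegrableOn (rayFun F φ₁) (Ioi 0)) (h2 : IntegrableOn (rayFun F φ₂) (Ioi 0)) :
    ∫ r in Ioi (0 : ℝ), rayFun F φ₂ r = ∫ r in Ioi (0 : ℝ), rayFun F φ₁ r := by
  have hl := (intervalIntegral_tendsto_integral_Ioi 0 h2 tendsto_id).sub
    (intervalIntegral_tendsto_integral_Ioi 0 h1 tendsto_id)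
  have h0 : Tendsto (fun ρ : ℝ => (∫ r in (0 : ℝ)..ρ, rayFun F φ₂ r) -
      (∫ r in (0 : ℝ)..ρ, rayFun F φ₁ r)) atTop (𝓝 0) := by
    have hg' : Tendsto (fun ρ => g ρ * (φ₂ - φ₁)) atTop (𝓝 0) := by
      simpa using hg.mul_const (φ₂ - φ₁)
    refine squeeze_zero_norm' ?_ hg'
    filter_upwards [eventually_gt_atTop 0] with ρ hρ
    rw [rayFun_integral_sub_eq_arc hφ hρ hd fun r φ hr _ => hB r φ hr]
    have := intervalIntegral.norm_integral_le_of_norm_le_const (a := φ₁) (b := φ₂)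
      (f := fun φ => (Complex.I * ρ) • rayFun F φ ρ) (C := g ρ) (fun φ hφ' => by
        rw [uIoc_of_le hφ] at hφ'
        rw [norm_smul, norm_rayFun, norm_mul, Complex.norm_I, one_mul, Complex.norm_real,
          Real.norm_of_nonneg hρ.le]
        exact hgF ρ φ hρ ⟨hφ'.1.le, hφ'.2⟩)
    rwa [abs_of_nonneg (sub_nonneg.2 hφ)] at this
  exact sub_eq_zero.1 (tendsto_nhds_unique hl h0)

end SectorCauchy

/-! ### Integrals along the boundary of a sector -/

section Hankel

variable {E : Type*} [NormedAddCommGroup E] [NormedSpace ℂ E]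

theorem norm_exp_ray_mul (r φ t : ℝ) :
    ‖Complex.exp (r * Complex.exp (φ * Complex.I) * t)‖ = Real.exp (r * t * Real.cos φ) := by
  rw [Complex.norm_exp]
  congr 1
  rw [Complex.re_mul_ofReal, Complex.re_ofReal_mul, Complex.exp_ofReal_mul_I_re]
  ring

/-- `∫ F dλ` along the path that runs from `∞ e^{-iθ}` to `0` and on to `∞ e^{iθ}`,
divided by `2πi`. -/
def hankel (θ : ℝ) (F : ℂ → E) : E :=
  (2 * Real.pi * Complex.I)⁻¹ •
    ((∫ r in Ioi (0 : ℝ), rayFun F θ r) - ∫ r in Ioi (0 : ℝ), rayFun F (-θ) r)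

/-- `F` is integrable along both rays of the path. -/
def HankelIntegrable (θ : ℝ) (F : ℂ → E) : Prop :=
  IntegrableOn (rayFun F θ) (Ioi 0) ∧ IntegrableOn (rayFun F (-θ)) (Ioi 0)

theorem rayFun_add (F G : ℂ → E) (φ r : ℝ) :
    rayFun (fun l => F l + G l) φ r = rayFun F φ r + rayFun G φ r := smul_add _ _ _

theorem rayFun_sub (F G : ℂ → E) (φ r : ℝ) :
    rayFun (fun l => F l - G l) φ r = rayFun F φ r - rayFun G φ r := smul_sub _ _ _

theorem hankel_add {θ : ℝ} {F G : ℂ → E} (hF : HankelIntegrable θ F)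
    (hG : HankelIntegrable θ G) : hankel θ (fun l => F l + G l) = hankel θ F + hankel θ G := by
  simp only [hankel, rayFun_add]
  rw [integral_add hF.1 hG.1, integral_add hF.2 hG.2, ← smul_add]
  congr 1; abel

theorem hankel_sub {θ : ℝ} {F G : ℂ → E} (hF : HankelIntegrable θ F)
    (hG : HankelIntegrable θ G) : hankel θ (fun l => F l - G l) = hankel θ F - hankel θ G := by
  simp only [hankel, rayFun_sub]
  rw [integral_sub hF.1 hG.1, integral_sub hF.2 hG.2, ← smul_sub]
  congr 1; abel

theorem rayFun_map {E' : Type*} [NormedAddCommGroup E'] [NormedSpace ℂ E'] (L : E →L[ℂ] E')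
    (F : ℂ → E) (φ r : ℝ) : rayFun (fun l => L (F l)) φ r = L (rayFun F φ r) := by
  simp only [rayFun, map_smul]

theorem HankelIntegrable.map {E' : Type*} [NormedAddCommGroup E'] [NormedSpace ℂ E']
    (L : E →L[ℂ] E') {θ : ℝ} {F : ℂ → E} (hF : HankelIntegrable θ F) :
    HankelIntegrable θ fun l => L (F l) :=
  ⟨(L.integrable_comp hF.1).congr (Eventually.of_forall fun _ => (rayFun_map _ _ _ _).symm),
    (L.integrable_comp hF.2).congr (Eventually.of_forall fun _ => (rayFun_map _ _ _ _).symm)⟩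

theorem hankel_map [CompleteSpace E] {E' : Type*} [NormedAddCommGroup E'] [NormedSpace ℂ E']
    [CompleteSpace E'] (L : E →L[ℂ] E') {θ : ℝ} {F : ℂ → E} (hF : HankelIntegrable θ F) :
    hankel θ (fun l => L (F l)) = L (hankel θ F) := by
  simp only [hankel, rayFun_map]
  rw [L.integral_comp_comm hF.1, L.integral_comp_comm hF.2, map_smul, map_sub]

/-- `l = r e^{±iθ}` with `r > 0`. -/
def onRays (θ : ℝ) (l : ℂ) : Prop :=
  ∃ r φ : ℝ, 0 < r ∧ (φ = θ ∨ φ = -θ) ∧ l = r * Complex.exp (φ * Complex.I)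

theorem rayFun_congr {θ φ : ℝ} {F G : ℂ → E} (hφ : φ = θ ∨ φ = -θ)
    (h : ∀ l, onRays θ l → F l = G l) : EqOn (rayFun F φ) (rayFun G φ) (Ioi 0) := fun r hr => by
  rw [rayFun, rayFun, h _ ⟨r, φ, hr, hφ, rfl⟩]

theorem hankel_congr {θ : ℝ} {F G : ℂ → E} (h : ∀ l, onRays θ l → F l = G l) :
    hankel θ F = hankel θ G := by
  rw [hankel, hankel, setIntegral_congr_fun measurableSet_Ioi (rayFun_congr (Or.inl rfl) h),
    setIntegral_congr_fun measurableSet_Ioi (rayFun_congr (Or.inr rfl) h)]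

theorem integrableOn_pow_mul_exp_neg (n : ℕ) {c : ℝ} (hc : 0 < c) :
    IntegrableOn (fun r : ℝ => r ^ n * Real.exp (-(c * r))) (Ioi 0) := by
  have := integrableOn_rpow_mul_exp_neg_mul_rpow (s := n) (p := 1) (b := c)
    (lt_of_lt_of_le (by norm_num) n.cast_nonneg) one_pos hc
  refine this.congr_fun (fun r _ => ?_) measurableSet_Ioi
  simp

theorem integrableOn_inv_one_add_sq : IntegrableOn (fun r : ℝ => ((1 + r) ^ 2)⁻¹) (Ioi 0) := by
  refine Integrable.mono' (integrable_inv_one_add_sq.integrableOn) (by fun_prop) ?_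
  filter_upwards [ae_restrict_mem measurableSet_Ioi] with r hr
  have hr0 : 0 < r := hr
  rw [Real.norm_of_nonneg (by positivity)]
  exact inv_anti₀ (by positivity) (by nlinarith)

/-- Continuity and linear growth along the ray of angle `φ`. -/
structure RayBound (φ : ℝ) (F : ℂ → E) (C : ℝ) : Prop where
  cont : ∀ r : ℝ, 0 < r → ContinuousAt F (r * Complex.exp (φ * Complex.I))
  bound : ∀ r : ℝ, 0 < r → ‖F (r * Complex.exp (φ * Complex.I))‖ ≤ C * (1 + r)

theorem rayFun_exp_smul_continuousOn {φ C : ℝ} {F : ℂ → E} (h : RayBound φ F C) (t : ℝ) :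
    ContinuousOn (rayFun (fun l => Complex.exp (l * t) • F l) φ) (Ioi 0) :=
  continuousOn_rayFun fun r hr => ContinuousAt.smul (by fun_prop) (h.cont r hr)

theorem norm_rayFun_exp_smul (φ r t : ℝ) (F : ℂ → E) :
    ‖rayFun (fun l => Complex.exp (l * t) • F l) φ r‖ =
      Real.exp (r * t * Real.cos φ) * ‖F (r * Complex.exp (φ * Complex.I))‖ := by
  rw [norm_rayFun, norm_smul, norm_exp_ray_mul]

theorem integrableOn_rayFun_exp_smul {φ C : ℝ} {F : ℂ → E} (h : RayBound φ F C)
    (hφ : Real.cos φ < 0) {t : ℝ} (ht : 0 < t) :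
    IntegrableOn (rayFun (fun l => Complex.exp (l * t) • F l) φ) (Ioi 0) := by
  have hc : 0 < -(t * Real.cos φ) := by nlinarith
  refine Integrable.mono' ((((integrableOn_pow_mul_exp_neg 0 hc).add
    (integrableOn_pow_mul_exp_neg 1 hc)).const_mul C))
    ((rayFun_exp_smul_continuousOn h t).aestronglyMeasurable measurableSet_Ioi) ?_
  filter_upwards [ae_restrict_mem measurableSet_Ioi] with r hr
  rw [norm_rayFun_exp_smul]
  refine (mul_le_mul_of_nonneg_left (h.bound r hr) (Real.exp_pos _).le).trans_eq ?_
  simp only [Pi.add_apply]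
  rw [show -(-(t * Real.cos φ) * r) = r * t * Real.cos φ by ring]
  ring

theorem hasDerivAt_integral_rayFun_exp_smul {φ C : ℝ} {F : ℂ → E} (h : RayBound φ F C)
    (hφ : Real.cos φ < 0) {t : ℝ} (ht : 0 < t) :
    IntegrableOn (rayFun (fun l => Complex.exp (l * t) • l • F l) φ) (Ioi 0) ∧
    HasDerivAt (fun t : ℝ => ∫ r in Ioi (0 : ℝ), rayFun (fun l => Complex.exp (l * t) • F l) φ r)
      (∫ r in Ioi (0 : ℝ), rayFun (fun l => Complex.exp (l * t) • l • F l) φ r) t := by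
  have hc : 0 < -(t / 2 * Real.cos φ) := by nlinarith
  have hF' : ∀ s : ℝ, ContinuousOn (rayFun (fun l => Complex.exp (l * s) • l • F l) φ) (Ioi 0) :=
    fun s => continuousOn_rayFun fun r hr => ContinuousAt.smul (by fun_prop)
      (ContinuousAt.smul (by fun_prop) (h.cont r hr))
  refine hasDerivAt_integral_of_dominated_loc_of_deriv_le
    (F := fun (t : ℝ) r => rayFun (fun l => Complex.exp (l * t) • F l) φ r)
    (F' := fun (t : ℝ) r => rayFun (fun l => Complex.exp (l * t) • l • F l) φ r)
    (s := Ioi (t / 2)) (bound := fun r => C * (r ^ 1 * Real.exp (-(-(t / 2 * Real.cos φ) * r)) +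
      r ^ 2 * Real.exp (-(-(t / 2 * Real.cos φ) * r))))
    (Ioi_mem_nhds (by linarith)) ?_ ?_ ?_ ?_ ?_ ?_
  · exact Eventually.of_forall fun s =>
      (rayFun_exp_smul_continuousOn h s).aestronglyMeasurable measurableSet_Ioi
  · exact integrableOn_rayFun_exp_smul h hφ ht
  · exact (hF' t).aestronglyMeasurable measurableSet_Ioi
  · filter_upwards [ae_restrict_mem measurableSet_Ioi] with r hr s hs
    have hr0 : 0 < r := hr
    have hs0 : t / 2 < s := hs
    rw [norm_rayFun_exp_smul (F := fun l => l • F l), norm_smul, norm_mul,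
      Complex.norm_exp_ofReal_mul_I, mul_one, Complex.norm_real, Real.norm_of_nonneg hr0.le]
    calc Real.exp (r * s * Real.cos φ) * (r * ‖F (r * Complex.exp (φ * Complex.I))‖)
        ≤ Real.exp (-(-(t / 2 * Real.cos φ) * r)) * (r * (C * (1 + r))) := by
          have h1 := h.bound r hr0
          refine mul_le_mul (Real.exp_le_exp.2 ?_) (mul_le_mul_of_nonneg_left h1 hr0.le)
            (by positivity) (by positivity)
          have : r * Real.cos φ < 0 := mul_neg_of_pos_of_neg hr0 hφ
          nlinarith
      _ = _ := by ring
  · exact ((integrableOn_pow_mul_exp_neg 1 hc).add (integrableOn_pow_mul_exp_neg 2 hc)).const_mul C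
  · filter_upwards with r s _
    have h1 : HasDerivAt (fun s : ℝ => Complex.exp (r * Complex.exp (φ * Complex.I) * s))
        (Complex.exp (r * Complex.exp (φ * Complex.I) * s) *
          (r * Complex.exp (φ * Complex.I))) s := by
      have h2 : HasDerivAt (fun s : ℝ => r * Complex.exp (φ * Complex.I) * (s : ℂ))
          (r * Complex.exp (φ * Complex.I) * 1) s := (Complex.ofRealCLM.hasDerivAt).const_mul _
      rw [mul_one] at h2
      exact h2.cexp
    have h3 := (h1.const_mul (Complex.exp (φ * Complex.I))).smul_const
      (F (r * Complex.exp (φ * Complex.I)))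
    simp only [rayFun, smul_smul] at h3 ⊢
    exact h3

/-- Continuity and linear growth along both rays. -/
def HankelBound (θ : ℝ) (F : ℂ → E) (C : ℝ) : Prop := RayBound θ F C ∧ RayBound (-θ) F C

theorem HankelBound.integrable {θ C : ℝ} {F : ℂ → E} (h : HankelBound θ F C)
    (hθ : Real.cos θ < 0) {t : ℝ} (ht : 0 < t) :
    HankelIntegrable θ fun l => Complex.exp (l * t) • F l :=
  ⟨integrableOn_rayFun_exp_smul h.1 hθ ht,
    integrableOn_rayFun_exp_smul h.2 (by rwa [Real.cos_neg]) ht⟩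

theorem HankelBound.integrable_deriv {θ C : ℝ} {F : ℂ → E} (h : HankelBound θ F C)
    (hθ : Real.cos θ < 0) {t : ℝ} (ht : 0 < t) :
    HankelIntegrable θ fun l => Complex.exp (l * t) • l • F l :=
  ⟨(hasDerivAt_integral_rayFun_exp_smul h.1 hθ ht).1,
    (hasDerivAt_integral_rayFun_exp_smul h.2 (by rwa [Real.cos_neg]) ht).1⟩

theorem HankelBound.hasDerivAt {θ C : ℝ} {F : ℂ → E} (h : HankelBound θ F C)
    (hθ : Real.cos θ < 0) {t : ℝ} (ht : 0 < t) :
    HasDerivAt (fun t : ℝ => hankel θ fun l => Complex.exp (l * t) • F l)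
      (hankel θ fun l => Complex.exp (l * t) • l • F l) t :=
  ((hasDerivAt_integral_rayFun_exp_smul h.1 hθ ht).2.sub
    (hasDerivAt_integral_rayFun_exp_smul h.2 (by rwa [Real.cos_neg]) ht).2).const_smul _

theorem HankelBound.const {E : Type*} [NormedAddCommGroup E] (θ : ℝ) (x : E) :
    HankelBound θ (fun _ => x) ‖x‖ :=
  have h : ∀ r : ℝ, 0 < r → ‖x‖ ≤ ‖x‖ * (1 + r) := fun r hr =>
    le_mul_of_one_le_right (norm_nonneg _) (by linarith)
  ⟨⟨fun _ _ => continuousAt_const, h⟩, ⟨fun _ _ => continuousAt_const, h⟩⟩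

/-- `∫ e^{λt} dλ = 0` along the path. -/
theorem hankel_exp_smul_const [CompleteSpace E] {θ t : ℝ} (hθ : Real.cos θ < 0) (ht : 0 < t)
    (x : E) : hankel θ (fun l => Complex.exp (l * t) • x) = 0 := by
  have h : ∀ φ : ℝ, Real.cos φ < 0 →
      ∫ r in Ioi (0 : ℝ), rayFun (fun l => Complex.exp (l * t) • x) φ r = (-(t : ℂ)⁻¹) • x := by
    intro φ hφ
    set e := Complex.exp (φ * Complex.I) with he
    have hre : (e * t).re < 0 := by
      rw [Complex.re_mul_ofReal, he, Complex.exp_ofReal_mul_I_re]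
      exact mul_neg_of_neg_of_pos hφ ht
    have h1 := integral_exp_mul_complex_Ioi hre 0
    have h2 : ∀ r : ℝ, rayFun (fun l => Complex.exp (l * t) • x) φ r =
        (e * Complex.exp (e * t * r)) • x := fun r => by
      rw [rayFun, smul_smul, ← he]
      congr 3; ring
    simp only [h2]
    rw [integral_smul_const, integral_const_mul, h1]
    congr 1
    have he0 : e ≠ 0 := Complex.exp_ne_zero _
    have ht0 : (t : ℂ) ≠ 0 := by exact_mod_cast ht.ne'
    simp only [Complex.ofReal_zero, mul_zero, Complex.exp_zero]
    field_simp
  rw [hankel, h θ hθ, h (-θ) (by rwa [Real.cos_neg]), sub_self, smul_zero]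

/-- Integrands that are `O(|λ|⁻²)` on a ray. -/
theorem integrableOn_rayFun_of_sq {φ K : ℝ} {F : ℂ → E}
    (hc : ∀ r : ℝ, 0 < r → ContinuousAt F (r * Complex.exp (φ * Complex.I)))
    (hK : ∀ r : ℝ, 0 < r → ‖F (r * Complex.exp (φ * Complex.I))‖ ≤ K * ((1 + r) ^ 2)⁻¹) :
    IntegrableOn (rayFun F φ) (Ioi 0) := by
  refine Integrable.mono' (integrableOn_inv_one_add_sq.const_mul K)
    ((continuousOn_rayFun hc).aestronglyMeasurable measurableSet_Ioi) ?_
  filter_upwards [ae_restrict_mem measurableSet_Ioi] with r hr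
  rw [norm_rayFun]
  exact hK r hr

/-- Rays can be rotated inside a sector in which `F` is holomorphic and `O((1 + |λ|)⁻²)`. -/
theorem integral_rayFun_eq_of_sq [CompleteSpace E] {F : ℂ → E} {φ₁ φ₂ K : ℝ} (hφ : φ₁ ≤ φ₂)
    (hd : ∀ r φ : ℝ, 0 < r → φ ∈ Icc φ₁ φ₂ →
      DifferentiableAt ℂ F (r * Complex.exp (φ * Complex.I)))
    (hK : ∀ r φ : ℝ, 0 < r → φ ∈ Icc φ₁ φ₂ →
      ‖F (r * Complex.exp (φ * Complex.I))‖ ≤ K * ((1 + r) ^ 2)⁻¹) :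
    ∫ r in Ioi (0 : ℝ), rayFun F φ₂ r = ∫ r in Ioi (0 : ℝ), rayFun F φ₁ r := by
  have hK0 : 0 ≤ K := by
    have := (norm_nonneg _).trans (hK 1 φ₁ one_pos (left_mem_Icc.2 hφ))
    exact nonneg_of_mul_nonneg_left this (by positivity)
  refine integral_rayFun_eq (B := K) (g := fun r => K * (1 + r)⁻¹) hφ hd (fun r φ hr hφ => ?_) ?_
    (fun r φ hr hφ => ?_)
    (integrableOn_rayFun_of_sq (fun r hr => (hd r _ hr (left_mem_Icc.2 hφ)).continuousAt)
      fun r hr => hK r _ hr (left_mem_Icc.2 hφ))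
    (integrableOn_rayFun_of_sq (fun r hr => (hd r _ hr (right_mem_Icc.2 hφ)).continuousAt)
      fun r hr => hK r _ hr (right_mem_Icc.2 hφ))
  · refine (hK r φ hr hφ).trans (mul_le_of_le_one_right hK0 (inv_le_one_of_one_le₀ ?_))
    nlinarith
  · have : Tendsto (fun r : ℝ => (1 + r)⁻¹) atTop (𝓝 0) :=
      tendsto_inv_atTop_zero.comp (tendsto_atTop_add_const_left _ 1 tendsto_id)
    simpa using this.const_mul K
  · refine (mul_le_mul_of_nonneg_left (hK r φ hr hφ) hr.le).trans ?_
    have h1 : 0 < 1 + r := by linarith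
    calc r * (K * ((1 + r) ^ 2)⁻¹) = K * (r * ((1 + r) ^ 2)⁻¹) := by ring
      _ ≤ K * ((1 + r) * ((1 + r) ^ 2)⁻¹) := by gcongr; linarith
      _ = K * (1 + r)⁻¹ := by field_simp

/-- Passage to the limit `t → 0` for integrands that are `O(|λ|⁻²)`. -/
theorem tendsto_hankel_exp_smul {θ K : ℝ} {F : ℂ → E} (hθ : Real.cos θ < 0)
    (hc : ∀ l, onRays θ l → ContinuousAt F l)
    (hK : ∀ r φ : ℝ, 0 < r → (φ = θ ∨ φ = -θ) →
      ‖F (r * Complex.exp (φ * Complex.I))‖ ≤ K * ((1 + r) ^ 2)⁻¹) :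
    Tendsto (fun t : ℝ => hankel θ fun l => Complex.exp (l * t) • F l) (𝓝[>] 0)
      (𝓝 (hankel θ F)) := by
  have h : ∀ φ : ℝ, (φ = θ ∨ φ = -θ) → Tendsto (fun t : ℝ => ∫ r in Ioi (0 : ℝ),
      rayFun (fun l => Complex.exp (l * t) • F l) φ r) (𝓝[>] 0)
      (𝓝 (∫ r in Ioi (0 : ℝ), rayFun F φ r)) := by
    intro φ hφ
    have hcos : Real.cos φ < 0 := by rcases hφ with rfl | rfl <;> simpa using hθ
    refine tendsto_integral_filter_of_dominated_convergence (fun r => K * ((1 + r) ^ 2)⁻¹)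
      (Eventually.of_forall fun t => ?_) ?_ (integrableOn_inv_one_add_sq.const_mul K) ?_
    · refine ContinuousOn.aestronglyMeasurable ?_ measurableSet_Ioi
      exact continuousOn_rayFun fun r hr => ContinuousAt.smul (by fun_prop)
        (hc _ ⟨r, φ, hr, hφ, rfl⟩)
    · filter_upwards [self_mem_nhdsWithin] with t ht
      filter_upwards [ae_restrict_mem measurableSet_Ioi] with r hr
      rw [norm_rayFun_exp_smul]
      refine (mul_le_of_le_one_left (norm_nonneg _) (Real.exp_le_one_iff.2 ?_)).trans (hK r φ hr hφ)
      exact mul_nonpos_of_nonneg_of_nonpos (mul_nonneg (le_of_lt hr) (le_of_lt ht)) hcos.le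
    · filter_upwards with r
      have : Continuous fun t : ℝ => rayFun (fun l => Complex.exp (l * t) • F l) φ r := by
        unfold rayFun; fun_prop
      have h0 := this.tendsto 0
      simp only [rayFun, Complex.ofReal_zero, mul_zero, Complex.exp_zero, one_smul] at h0
      exact h0.mono_left nhdsWithin_le_nhds
  exact ((h θ (Or.inl rfl)).sub (h (-θ) (Or.inr rfl))).const_smul _

end Hankel

/-! ### Two scalar contour integrals -/

section SectorGeometry

/-- The sector `|arg λ| ≤ θ`, `λ ≠ 0`. -/
def InSector (θ : ℝ) (l : ℂ) : Prop :=
  ∃ r φ : ℝ, 0 < r ∧ φ ∈ Icc (-θ) θ ∧ l = r * Complex.exp (φ * Complex.I)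

theorem norm_ray {r φ : ℝ} (hr : 0 < r) : ‖(r : ℂ) * Complex.exp (φ * Complex.I)‖ = r := by
  rw [norm_mul, Complex.norm_exp_ofReal_mul_I, mul_one, Complex.norm_real,
    Real.norm_of_nonneg hr.le]

theorem re_ray (r φ : ℝ) : ((r : ℂ) * Complex.exp (φ * Complex.I)).re = r * Real.cos φ := by
  rw [Complex.re_ofReal_mul, Complex.exp_ofReal_mul_I_re]

theorem onRays.inSector {θ : ℝ} (hθ : 0 ≤ θ) {l : ℂ} (h : onRays θ l) : InSector θ l := by
  obtain ⟨r, φ, hr, rfl | rfl, rfl⟩ := h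
  · exact ⟨r, φ, hr, ⟨by linarith, le_rfl⟩, rfl⟩
  · exact ⟨r, -θ, hr, ⟨le_rfl, by linarith⟩, rfl⟩

theorem inSector_one {θ : ℝ} (hθ : 0 ≤ θ) : InSector θ 1 :=
  ⟨1, 0, one_pos, ⟨by linarith, hθ⟩, by simp⟩

theorem InSector.cos_mul_norm_le_re {θ : ℝ} (hθ : θ ≤ Real.pi) {l : ℂ} (h : InSector θ l) :
    Real.cos θ * ‖l‖ ≤ l.re := by
  obtain ⟨r, φ, hr, hφ, rfl⟩ := h
  rw [norm_ray hr, re_ray, mul_comm]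
  refine mul_le_mul_of_nonneg_left ?_ hr.le
  rw [← Real.cos_abs φ]
  exact Real.cos_le_cos_of_nonneg_of_le_pi (abs_nonneg _) hθ (abs_le.2 hφ)

theorem onRays.re_neg {θ : ℝ} (hθ : Real.cos θ < 0) {l : ℂ} (h : onRays θ l) : l.re < 0 := by
  obtain ⟨r, φ, hr, hφ, rfl⟩ := h
  have : Real.cos φ = Real.cos θ := by rcases hφ with rfl | rfl <;> simp
  rw [re_ray, this]
  exact mul_neg_of_pos_of_neg hr hθ

theorem sq_norm_one_add (l : ℂ) : ‖1 + l‖ ^ 2 = 1 + 2 * l.re + ‖l‖ ^ 2 := by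
  rw [Complex.sq_norm, Complex.sq_norm, Complex.normSq_apply, Complex.normSq_apply]
  simp
  ring

/-- On the sector, `1 + λ` is bounded below by a multiple of `1 + |λ|`. -/
theorem exists_one_add_norm_le {θ : ℝ} (hθ0 : 0 ≤ θ) (hθ : θ < Real.pi) :
    ∃ k : ℝ, 0 < k ∧ ∀ l, InSector θ l → 1 + ‖l‖ ≤ k * ‖1 + l‖ := by
  have hc : -1 < Real.cos θ := by
    rw [← Real.cos_pi]
    exact Real.cos_lt_cos_of_nonneg_of_le_pi hθ0 le_rfl hθ
  have hc1 := Real.cos_le_one θ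
  have hk : 0 < 2 / (1 + Real.cos θ) := div_pos two_pos (by linarith)
  refine ⟨Real.sqrt (2 / (1 + Real.cos θ)), Real.sqrt_pos.2 hk, fun l hl => ?_⟩
  refine abs_le_of_sq_le_sq' ?_ (by positivity) |>.2
  rw [mul_pow, Real.sq_sqrt hk.le, div_mul_eq_mul_div, le_div_iff₀ (by linarith), sq_norm_one_add]
  have h1 := hl.cos_mul_norm_le_re hθ.le
  rcases le_or_gt 0 (Real.cos θ) with h0 | h0
  · have : 0 ≤ Real.cos θ * ‖l‖ := mul_nonneg h0 (norm_nonneg l)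
    nlinarith [sq_nonneg (1 - ‖l‖), sq_nonneg (1 + ‖l‖)]
  · nlinarith [sq_nonneg (1 - ‖l‖), sq_nonneg (1 + ‖l‖)]

theorem one_add_norm_le_of_re_nonpos {l : ℂ} (hl : l.re ≤ 0) : 1 + ‖l‖ ≤ 2 * ‖1 - l‖ := by
  refine abs_le_of_sq_le_sq' ?_ (by positivity) |>.2
  have := sq_norm_one_add (-l)
  rw [← sub_eq_add_neg, norm_neg, Complex.neg_re] at this
  rw [mul_pow, this]
  nlinarith [sq_nonneg (1 - ‖l‖), sq_nonneg (1 + ‖l‖)]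

theorem one_sub_ne_zero_of_re_nonpos {l : ℂ} (hl : l.re ≤ 0) : 1 - l ≠ 0 := fun h => by
  have := one_add_norm_le_of_re_nonpos hl
  rw [h, norm_zero, mul_zero] at this
  linarith [norm_nonneg l]

end SectorGeometry

section ScalarIntegrals

variable {θ : ℝ}

theorem cos_nonpos_of_mem_left {φ : ℝ} (hθ : θ < Real.pi) (hφ : φ ∈ Icc (Real.pi / 2) θ) :
    Real.cos φ ≤ 0 :=
  Real.cos_nonpos_of_pi_div_two_le_of_le hφ.1 (by linarith [hφ.2, Real.pi_pos])

/-- `∫ 2 (1 - λ²)⁻¹ dλ = 2πi` along the path. -/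
theorem hankel_two_div_one_sub_sq (hθ1 : Real.pi / 2 < θ) (hθ2 : θ < Real.pi) :
    hankel θ (fun l => (1 - l)⁻¹ * (1 + l)⁻¹ * 2) = 1 := by
  have hpi := Real.pi_pos
  obtain ⟨k, hk, hkl⟩ := exists_one_add_norm_le (by linarith) hθ2
  set F : ℂ → ℂ := fun l => (1 - l)⁻¹ * (1 + l)⁻¹ * 2 with hF
  have hd : ∀ l : ℂ, InSector θ l → l.re ≤ 0 → DifferentiableAt ℂ F l := fun l hl hre => by
    have h1 := one_sub_ne_zero_of_re_nonpos hre
    have h2 : 1 + l ≠ 0 := fun h => by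
      have := hkl l hl
      rw [h, norm_zero, mul_zero] at this
      linarith [norm_nonneg l]
    exact (((by fun_prop : DifferentiableAt ℂ (fun l : ℂ => 1 - l) l).inv h1).mul
      ((by fun_prop : DifferentiableAt ℂ (fun l : ℂ => 1 + l) l).inv h2)).mul_const 2
  have hb : ∀ l : ℂ, InSector θ l → l.re ≤ 0 → ‖F l‖ ≤ 4 * k * ((1 + ‖l‖) ^ 2)⁻¹ := by
    intro l hl hre
    have h0 : 0 < 1 + ‖l‖ := by positivity
    have h1 : ‖1 - l‖⁻¹ ≤ 2 * (1 + ‖l‖)⁻¹ := by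
      rw [← div_eq_mul_inv, inv_le_comm₀ (norm_pos_iff.2 (one_sub_ne_zero_of_re_nonpos hre))
        (by positivity), inv_div, div_le_iff₀ two_pos]
      linarith [one_add_norm_le_of_re_nonpos hre]
    have h2 : ‖1 + l‖⁻¹ ≤ k * (1 + ‖l‖)⁻¹ := by
      have hp : 0 < ‖1 + l‖ := pos_of_mul_pos_right (h0.trans_le (hkl l hl)) hk.le
      rw [← div_eq_mul_inv, inv_le_comm₀ hp (by positivity), inv_div, div_le_iff₀ hk]
      linarith [hkl l hl]
    rw [hF]
    simp only [norm_mul, norm_inv, Complex.norm_ofNat]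
    calc ‖1 - l‖⁻¹ * ‖1 + l‖⁻¹ * 2 ≤ (2 * (1 + ‖l‖)⁻¹) * (k * (1 + ‖l‖)⁻¹) * 2 := by gcongr
      _ = _ := by rw [sq, mul_inv]; ring
  have hr1 : ∫ r in Ioi (0 : ℝ), rayFun F θ r = ∫ r in Ioi (0 : ℝ), rayFun F (Real.pi / 2) r := by
    have hs : ∀ r φ : ℝ, 0 < r → φ ∈ Icc (Real.pi / 2) θ →
        InSector θ (r * Complex.exp (φ * Complex.I)) ∧
          ((r : ℂ) * Complex.exp (φ * Complex.I)).re ≤ 0 := fun r φ hr hφ =>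
      ⟨⟨r, φ, hr, ⟨by linarith [hφ.1], hφ.2⟩, rfl⟩, by
        rw [re_ray]; exact mul_nonpos_of_nonneg_of_nonpos hr.le (cos_nonpos_of_mem_left hθ2 hφ)⟩
    refine integral_rayFun_eq_of_sq (K := 4 * k) hθ1.le
      (fun r φ hr hφ => hd _ (hs r φ hr hφ).1 (hs r φ hr hφ).2) fun r φ hr hφ => ?_
    have := hb _ (hs r φ hr hφ).1 (hs r φ hr hφ).2
    rwa [norm_ray hr] at this
  have hr2 : ∫ r in Ioi (0 : ℝ), rayFun F (-(Real.pi / 2)) r =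
      ∫ r in Ioi (0 : ℝ), rayFun F (-θ) r := by
    have hs : ∀ r φ : ℝ, 0 < r → φ ∈ Icc (-θ) (-(Real.pi / 2)) →
        InSector θ (r * Complex.exp (φ * Complex.I)) ∧
          ((r : ℂ) * Complex.exp (φ * Complex.I)).re ≤ 0 := fun r φ hr hφ =>
      ⟨⟨r, φ, hr, ⟨hφ.1, by linarith [hφ.2]⟩, rfl⟩, by
        rw [re_ray, ← Real.cos_neg]
        exact mul_nonpos_of_nonneg_of_nonpos hr.le
          (cos_nonpos_of_mem_left hθ2 ⟨by linarith [hφ.2], by linarith [hφ.1]⟩)⟩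
    refine integral_rayFun_eq_of_sq (K := 4 * k) (by linarith)
      (fun r φ hr hφ => hd _ (hs r φ hr hφ).1 (hs r φ hr hφ).2) fun r φ hr hφ => ?_
    have := hb _ (hs r φ hr hφ).1 (hs r φ hr hφ).2
    rwa [norm_ray hr] at this
  have hI : Complex.exp ((Real.pi / 2 : ℝ) * Complex.I) = Complex.I := by
    rw [Complex.exp_mul_I, ← Complex.ofReal_cos, ← Complex.ofReal_sin, Real.cos_pi_div_two,
      Real.sin_pi_div_two]
    simp
  have hI' : Complex.exp ((-(Real.pi / 2) : ℝ) * Complex.I) = -Complex.I := by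
    rw [Complex.exp_mul_I, ← Complex.ofReal_cos, ← Complex.ofReal_sin, Real.cos_neg, Real.sin_neg,
      Real.cos_pi_div_two, Real.sin_pi_div_two]
    simp
  have hval : ∀ s : ℂ, s ^ 2 = -1 → ∫ r in Ioi (0 : ℝ), s * F (r * s) = s * Real.pi := by
    intro s hs
    have h1 : ∀ r : ℝ, s * F (r * s) = (s * 2) * (((1 + r ^ 2)⁻¹ : ℝ) : ℂ) := fun r => by
      have : (1 - (r : ℂ) * s) * (1 + r * s) = 1 + r ^ 2 := by linear_combination -(r : ℂ) ^ 2 * hs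
      simp only [hF]
      rw [← mul_inv, this]
      push_cast
      ring
    simp only [h1]
    rw [integral_const_mul, integral_complex_ofReal, integral_Ioi_inv_one_add_sq]
    simp
    ring
  have h2pi : (2 * Real.pi * Complex.I : ℂ) ≠ 0 := by
    simp [Complex.I_ne_zero, Real.pi_ne_zero]
  rw [hankel, hr1, ← hr2]
  simp only [rayFun, hI, hI', smul_eq_mul]
  rw [hval _ Complex.I_sq, hval (-Complex.I) (by rw [neg_sq, Complex.I_sq])]
  field_simp
  ring

/-- `∫ e^{λt} (1 - λ)⁻¹ dλ = 0` along the path, as the pole lies to its right. -/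
theorem hankel_exp_mul_inv_one_sub {t : ℝ} (hθ1 : Real.pi / 2 < θ) (hθ2 : θ < Real.pi)
    (ht : 0 < t) : hankel θ (fun l => Complex.exp (l * t) • (1 - l)⁻¹) = 0 := by
  have hpi := Real.pi_pos
  have hcos : Real.cos θ < 0 := Real.cos_neg_of_pi_div_two_lt_of_lt hθ1 (by linarith)
  set F : ℂ → ℂ := fun l => Complex.exp (l * t) • (1 - l)⁻¹ with hF
  have hd : ∀ l : ℂ, l.re ≤ 0 → DifferentiableAt ℂ F l := fun l hre =>
    ((by fun_prop : DifferentiableAt ℂ (fun l : ℂ => Complex.exp (l * t)) l)).smul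
      ((by fun_prop : DifferentiableAt ℂ (fun l : ℂ => 1 - l) l).inv
        (one_sub_ne_zero_of_re_nonpos hre))
  set b := -(t * Real.cos θ) with hb
  have hb0 : 0 < b := by nlinarith
  have hbound : ∀ r φ : ℝ, 0 < r → Real.cos φ ≤ Real.cos θ →
      ‖F (r * Complex.exp (φ * Complex.I))‖ ≤ (2 + 4 / b ^ 2) * ((1 + r) ^ 2)⁻¹ := by
    intro r φ hr hφ
    have hre : ((r : ℂ) * Complex.exp (φ * Complex.I)).re ≤ 0 := by
      rw [re_ray]; exact mul_nonpos_of_nonneg_of_nonpos hr.le (hφ.trans hcos.le)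
    have h1 : ‖(1 - (r : ℂ) * Complex.exp (φ * Complex.I))⁻¹‖ ≤ 1 := by
      rw [norm_inv]
      refine inv_le_one_of_one_le₀ ?_
      have := Complex.abs_re_le_norm (1 - (r : ℂ) * Complex.exp (φ * Complex.I))
      refine le_trans (le_trans ?_ (le_abs_self _)) this
      rw [Complex.sub_re, Complex.one_re]; linarith
    have h2 : 1 + b * r + (b * r) ^ 2 / 2 ≤ Real.exp (b * r) :=
      Real.quadratic_le_exp_of_nonneg (by positivity)
    have h3 : Real.exp (r * t * Real.cos φ) ≤ (Real.exp (b * r))⁻¹ := by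
      rw [← Real.exp_neg]
      refine Real.exp_le_exp.2 ?_
      have : r * t * Real.cos φ ≤ r * t * Real.cos θ := by gcongr
      rw [hb]; linarith
    have h4 : (1 + r) ^ 2 ≤ (2 + 4 / b ^ 2) * Real.exp (b * r) := by
      calc (1 + r) ^ 2 ≤ (2 + 4 / b ^ 2) * (1 + b * r + (b * r) ^ 2 / 2) := by
            have e : (2 + 4 / b ^ 2) * (1 + b * r + (b * r) ^ 2 / 2) =
                2 + 2 * r ^ 2 + (4 / b ^ 2 + 2 * (b * r) + 4 * r / b + (b * r) ^ 2) := by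
              field_simp; ring
            rw [e]
            have : 0 ≤ 4 / b ^ 2 + 2 * (b * r) + 4 * r / b + (b * r) ^ 2 := by positivity
            nlinarith [sq_nonneg (1 - r)]
        _ ≤ _ := by gcongr
    rw [hF]
    simp only [norm_smul, norm_exp_ray_mul]
    calc _ ≤ (Real.exp (b * r))⁻¹ * 1 := by gcongr
      _ ≤ _ := by
        rw [mul_one, inv_le_iff_one_le_mul₀ (Real.exp_pos _), mul_assoc, mul_comm,
          mul_assoc, ← div_eq_inv_mul, le_div_iff₀ (by positivity), one_mul, mul_comm]
        exact h4
  have hle : ∀ φ ∈ Icc θ Real.pi, Real.cos φ ≤ Real.cos θ := fun φ hφ =>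
    Real.cos_le_cos_of_nonneg_of_le_pi (by linarith) hφ.2 hφ.1
  have hle' : ∀ φ ∈ Icc (-Real.pi) (-θ), Real.cos φ ≤ Real.cos θ := fun φ hφ => by
    rw [← Real.cos_neg φ]
    exact hle _ ⟨by linarith [hφ.2], by linarith [hφ.1]⟩
  have hre : ∀ r φ : ℝ, 0 < r → Real.cos φ ≤ Real.cos θ →
      ((r : ℂ) * Complex.exp (φ * Complex.I)).re ≤ 0 := fun r φ hr hφ => by
    rw [re_ray]; exact mul_nonpos_of_nonneg_of_nonpos hr.le (hφ.trans hcos.le)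
  have h1 := integral_rayFun_eq_of_sq hθ2.le (fun r φ hr hφ => hd _ (hre r φ hr (hle φ hφ)))
    fun r φ hr hφ => hbound r φ hr (hle φ hφ)
  have h2 := integral_rayFun_eq_of_sq (neg_le_neg hθ2.le)
    (fun r φ hr hφ => hd _ (hre r φ hr (hle' φ hφ))) fun r φ hr hφ => hbound r φ hr (hle' φ hφ)
  have h3 : Complex.exp ((-Real.pi : ℝ) * Complex.I) = Complex.exp ((Real.pi : ℝ) * Complex.I) := by
    rw [Complex.exp_mul_I, Complex.exp_mul_I, ← Complex.ofReal_cos, ← Complex.ofReal_sin,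
      ← Complex.ofReal_cos, ← Complex.ofReal_sin]
    simp
  rw [hankel, ← h1, h2]
  simp only [rayFun, h3, sub_self, smul_zero]

end ScalarIntegrals

/-! ### The holomorphic semigroup of a sectorial resolvent -/

section SectorialResolvent

variable {Z : Type*} [NormedAddCommGroup Z] [NormedSpace ℂ Z]

/-- `R λ = (λ + B)⁻¹` for an operator `B` whose negative generates a bounded holomorphic semigroup:
`R` is holomorphic and `O((1 + |λ|)⁻¹)` in a sector `|arg λ| ≤ θ` with `θ > π/2`, and satisfies the
resolvent identity there. -/
structure SectorialResolvent (R : ℂ → Z →L[ℂ] Z) (θ C : ℝ) : Prop where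
  pi_div_two_lt : Real.pi / 2 < θ
  lt_pi : θ < Real.pi
  C_nonneg : 0 ≤ C
  bound : ∀ l, InSector θ l → ‖R l‖ ≤ C * (1 + ‖l‖)⁻¹
  differentiableAt : ∀ l, InSector θ l → DifferentiableAt ℂ R l
  sub_eq : ∀ l m, InSector θ l → InSector θ m → R l - R m = (m - l) • (R l * R m)

/-- The semigroup `e^{-tB} = (2πi)⁻¹ ∫ e^{λt} (λ + B)⁻¹ dλ`. -/
def holSemigroup (R : ℂ → Z →L[ℂ] Z) (θ t : ℝ) : Z →L[ℂ] Z :=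
  hankel θ fun l => Complex.exp (l * t) • R l

/-- The derivative of the semigroup, `(2πi)⁻¹ ∫ e^{λt} λ (λ + B)⁻¹ dλ`. -/
def holSemigroupDeriv (R : ℂ → Z →L[ℂ] Z) (θ t : ℝ) : Z →L[ℂ] Z :=
  hankel θ fun l => Complex.exp (l * t) • l • R l

namespace SectorialResolvent

variable {R : ℂ → Z →L[ℂ] Z} {θ C : ℝ}

theorem cos_neg (h : SectorialResolvent R θ C) : Real.cos θ < 0 :=
  Real.cos_neg_of_pi_div_two_lt_of_lt h.pi_div_two_lt (by linarith [h.lt_pi, Real.pi_pos])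

theorem theta_nonneg (h : SectorialResolvent R θ C) : 0 ≤ θ := by
  linarith [h.pi_div_two_lt, Real.pi_pos]

theorem inSector_one (h : SectorialResolvent R θ C) : InSector θ 1 := _root_.inSector_one h.theta_nonneg

theorem inSector (_h : SectorialResolvent R θ C) {r φ : ℝ} (hr : 0 < r) (hφ : φ ∈ Icc (-θ) θ) :
    InSector θ (r * Complex.exp (φ * Complex.I)) := ⟨r, φ, hr, hφ, rfl⟩

theorem mem_left (h : SectorialResolvent R θ C) : -θ ∈ Icc (-θ) θ :=
  ⟨le_rfl, by linarith [h.theta_nonneg]⟩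

theorem mem_right (h : SectorialResolvent R θ C) : θ ∈ Icc (-θ) θ :=
  ⟨by linarith [h.theta_nonneg], le_rfl⟩

theorem mem_of_eq (h : SectorialResolvent R θ C) {φ : ℝ} (hφ : φ = θ ∨ φ = -θ) :
    φ ∈ Icc (-θ) θ := by
  rcases hφ with rfl | rfl
  exacts [h.mem_right, h.mem_left]

theorem rayBound (h : SectorialResolvent R θ C) {φ : ℝ} (hφ : φ ∈ Icc (-θ) θ) : RayBound φ R C where
  cont r hr := (h.differentiableAt _ (h.inSector hr hφ)).continuousAt
  bound r hr := by
    refine (h.bound _ (h.inSector hr hφ)).trans (mul_le_mul_of_nonneg_left ?_ h.C_nonneg)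
    rw [norm_ray hr]
    exact (inv_le_one_of_one_le₀ (by linarith)).trans (by linarith)

theorem hankelBound (h : SectorialResolvent R θ C) : HankelBound θ R C :=
  ⟨h.rayBound h.mem_right, h.rayBound h.mem_left⟩

theorem commute (h : SectorialResolvent R θ C) {l m : ℂ} (hl : InSector θ l) (hm : InSector θ m) :
    R l * R m = R m * R l := by
  rcases eq_or_ne l m with rfl | hlm
  · rfl
  refine smul_right_injective _ (sub_ne_zero.2 hlm.symm) ?_
  calc (m - l) • (R l * R m) = -(R m - R l) := by rw [← h.sub_eq l m hl hm, neg_sub]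
    _ = (m - l) • (R m * R l) := by rw [h.sub_eq m l hm hl, ← neg_smul, neg_sub]

theorem hasDerivAt (h : SectorialResolvent R θ C) {t : ℝ} (ht : 0 < t) :
    HasDerivAt (holSemigroup R θ) (holSemigroupDeriv R θ t) t :=
  h.hankelBound.hasDerivAt h.cos_neg ht

variable [CompleteSpace Z]

theorem semigroup_mul (h : SectorialResolvent R θ C) {t : ℝ} (ht : 0 < t) (P : Z →L[ℂ] Z) :
    holSemigroup R θ t * P = hankel θ fun l => Complex.exp (l * t) • (R l * P) := by
  have := hankel_map ((ContinuousLinearMap.mul ℂ (Z →L[ℂ] Z)).flip P)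
    (h.hankelBound.integrable h.cos_neg ht)
  simpa [holSemigroup, holSemigroupDeriv] using this.symm

theorem mul_semigroup (h : SectorialResolvent R θ C) {t : ℝ} (ht : 0 < t) (P : Z →L[ℂ] Z) :
    P * holSemigroup R θ t = hankel θ fun l => Complex.exp (l * t) • (P * R l) := by
  have := hankel_map (ContinuousLinearMap.mul ℂ (Z →L[ℂ] Z) P)
    (h.hankelBound.integrable h.cos_neg ht)
  simpa [holSemigroup, holSemigroupDeriv] using this.symm

theorem deriv_mul (h : SectorialResolvent R θ C) {t : ℝ} (ht : 0 < t) (P : Z →L[ℂ] Z) :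
    holSemigroupDeriv R θ t * P = hankel θ fun l => Complex.exp (l * t) • l • (R l * P) := by
  have := hankel_map ((ContinuousLinearMap.mul ℂ (Z →L[ℂ] Z)).flip P)
    (h.hankelBound.integrable_deriv h.cos_neg ht)
  simpa [holSemigroup, holSemigroupDeriv] using this.symm

theorem semigroup_commute (h : SectorialResolvent R θ C) {t : ℝ} (ht : 0 < t) {m : ℂ}
    (hm : InSector θ m) : holSemigroup R θ t * R m = R m * holSemigroup R θ t := by
  rw [h.semigroup_mul ht, h.mul_semigroup ht]
  exact hankel_congr fun l hl => by rw [h.commute (hl.inSector h.theta_nonneg) hm]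

/-- `d/dt e^{-tB} (1 + B)⁻¹ = -e^{-tB} B (1 + B)⁻¹`. -/
theorem deriv_mul_res (h : SectorialResolvent R θ C) {t : ℝ} (ht : 0 < t) :
    holSemigroupDeriv R θ t * R 1 = holSemigroup R θ t * (R 1 - 1) := by
  have h1 : ∀ l, onRays θ l → Complex.exp (l * t) • l • (R l * R 1) =
      Complex.exp (l * t) • (R l * (R 1 - 1)) + Complex.exp (l * t) • R 1 := fun l hl => by
    have := h.sub_eq l 1 (hl.inSector h.theta_nonneg) h.inSector_one
    rw [sub_smul, one_smul] at this
    rw [← smul_add, mul_sub, mul_one]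
    congr 1
    calc l • (R l * R 1) = R l * R 1 - (R l * R 1 - l • (R l * R 1)) := by abel
      _ = _ := by rw [← this]; abel
  have h2 : HankelIntegrable θ fun l => Complex.exp (l * t) • (R l * (R 1 - 1)) := by
    have := (h.hankelBound.integrable h.cos_neg ht).map
      ((ContinuousLinearMap.mul ℂ (Z →L[ℂ] Z)).flip (R 1 - 1))
    simpa only [map_smul, ContinuousLinearMap.flip_apply, ContinuousLinearMap.mul_apply'] using this
  rw [h.deriv_mul ht, hankel_congr h1, hankel_add h2
    ((HankelBound.const θ (R 1)).integrable h.cos_neg ht), ← h.semigroup_mul ht,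
    hankel_exp_smul_const h.cos_neg ht, add_zero]

/-- The semigroup is bounded: the part of the path in `|λ| ≤ 1/t` is replaced by an arc. -/
theorem exists_bound (h : SectorialResolvent R θ C) :
    ∃ M : ℝ, ∀ t : ℝ, 0 < t → ‖holSemigroup R θ t‖ ≤ M := by
  have hC := h.C_nonneg
  have hcos := h.cos_neg
  refine ⟨‖(2 * Real.pi * Complex.I : ℂ)⁻¹‖ * (Real.exp 1 * C * (2 * θ) +
    2 * (C * (-Real.cos θ)⁻¹)), fun t ht => ?_⟩
  set ρ := t⁻¹ with hρdef
  have hρ : 0 < ρ := inv_pos.2 ht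
  have hρt : ρ * t = 1 := inv_mul_cancel₀ ht.ne'
  set F : ℂ → Z →L[ℂ] Z := fun l => Complex.exp (l * t) • R l with hF
  have hbd : ∀ r φ : ℝ, 0 < r → φ ∈ Icc (-θ) θ → ‖F (r * Complex.exp (φ * Complex.I))‖ ≤
      Real.exp (r * t * Real.cos φ) * (C * (1 + r)⁻¹) := fun r φ hr hφ => by
    rw [hF]
    simp only
    rw [norm_smul, norm_exp_ray_mul]
    refine mul_le_mul_of_nonneg_left ?_ (Real.exp_pos _).le
    have := h.bound _ (h.inSector hr hφ)
    rwa [norm_ray hr] at this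
  have hin : ∀ r φ : ℝ, 0 < r → r ≤ ρ → φ ∈ Icc (-θ) θ →
      ‖F (r * Complex.exp (φ * Complex.I))‖ ≤ Real.exp 1 * (C * (1 + r)⁻¹) := by
    intro r φ hr hrρ hφ
    refine (hbd r φ hr hφ).trans (mul_le_mul_of_nonneg_right (Real.exp_le_exp.2 ?_) (by positivity))
    calc r * t * Real.cos φ ≤ r * t * 1 := by gcongr; exact Real.cos_le_one φ
      _ ≤ ρ * t * 1 := by gcongr
      _ = 1 := by rw [hρt, mul_one]
  have hint : ∀ φ, φ = θ ∨ φ = -θ → IntegrableOn (rayFun F φ) (Ioi 0) := by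
    rintro φ (rfl | rfl)
    exacts [(h.hankelBound.integrable hcos ht).1, (h.hankelBound.integrable hcos ht).2]
  have hout : ∀ φ, φ = θ ∨ φ = -θ → ‖∫ r in Ioi ρ, rayFun F φ r‖ ≤ C * (-Real.cos θ)⁻¹ := by
    intro φ hφ
    have hcφ : Real.cos φ = Real.cos θ := by rcases hφ with rfl | rfl <;> simp
    have hneg : t * Real.cos θ < 0 := mul_neg_of_pos_of_neg ht hcos
    have h1 : IntegrableOn (fun r : ℝ => C * t * Real.exp (t * Real.cos θ * r)) (Ioi ρ) :=
      (integrableOn_exp_mul_Ioi hneg ρ).const_mul _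
    refine (norm_integral_le_of_norm_le h1 ?_).trans ?_
    · filter_upwards [ae_restrict_mem measurableSet_Ioi] with r hr
      have hr0 : 0 < r := hρ.trans hr
      rw [norm_rayFun]
      refine (hbd r φ hr0 (h.mem_of_eq hφ)).trans ?_
      rw [hcφ, mul_comm, show t * Real.cos θ * r = r * t * Real.cos θ by ring]
      refine mul_le_mul_of_nonneg_right (mul_le_mul_of_nonneg_left ?_ hC) (Real.exp_pos _).le
      rw [inv_le_comm₀ (by positivity) ht]
      have : ρ < r := hr
      linarith
    · rw [integral_const_mul, integral_exp_mul_Ioi hneg]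
      have : Real.exp (t * Real.cos θ * ρ) ≤ 1 :=
        Real.exp_le_one_iff.2 (mul_nonpos_of_nonpos_of_nonneg hneg.le hρ.le)
      have hc' : 0 < -Real.cos θ := by linarith
      calc C * t * (-Real.exp (t * Real.cos θ * ρ) / (t * Real.cos θ))
          = C * (-Real.cos θ)⁻¹ * Real.exp (t * Real.cos θ * ρ) := by
            have := hcos.ne
            field_simp
        _ ≤ C * (-Real.cos θ)⁻¹ * 1 := by gcongr
        _ = _ := mul_one _
  have hsplit : ∀ φ, φ = θ ∨ φ = -θ → ∫ r in Ioi (0 : ℝ), rayFun F φ r =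
      (∫ r in (0 : ℝ)..ρ, rayFun F φ r) + ∫ r in Ioi ρ, rayFun F φ r := fun φ hφ => by
    rw [intervalIntegral.integral_of_le hρ.le, ← setIntegral_union Ioc_disjoint_Ioi_same
      measurableSet_Ioi ((hint φ hφ).mono_set Ioc_subset_Ioi_self)
      ((hint φ hφ).mono_set (Ioi_subset_Ioi hρ.le)), Ioc_union_Ioi_eq_Ioi hρ.le]
  have harc := rayFun_integral_sub_eq_arc (F := F) (B := Real.exp 1 * C)
    (by linarith [h.theta_nonneg] : -θ ≤ θ) hρ (fun r φ hr hφ =>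
      ((by fun_prop : DifferentiableAt ℂ (fun l : ℂ => Complex.exp (l * t)) _)).smul
        (h.differentiableAt _ (h.inSector hr hφ))) (fun r φ hr hrρ hφ => by
      refine (hin r φ hr hrρ hφ).trans ?_
      rw [← mul_assoc]
      exact mul_le_of_le_one_right (by positivity) (inv_le_one_of_one_le₀ (by linarith)))
  have harc' : ‖∫ φ in (-θ)..θ, (Complex.I * ρ) • rayFun F φ ρ‖ ≤ Real.exp 1 * C * (2 * θ) := by
    have := intervalIntegral.norm_integral_le_of_norm_le_const (a := -θ) (b := θ)
      (f := fun φ => (Complex.I * ρ) • rayFun F φ ρ) (C := Real.exp 1 * C) (fun φ hφ => by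
        rw [uIoc_of_le (by linarith [h.theta_nonneg])] at hφ
        rw [norm_smul, norm_rayFun, norm_mul, Complex.norm_I, one_mul, Complex.norm_real,
          Real.norm_of_nonneg hρ.le]
        calc _ ≤ ρ * (Real.exp 1 * (C * (1 + ρ)⁻¹)) :=
              mul_le_mul_of_nonneg_left (hin ρ φ hρ le_rfl ⟨hφ.1.le, hφ.2⟩) hρ.le
          _ = Real.exp 1 * C * (ρ * (1 + ρ)⁻¹) := by ring
          _ ≤ _ := by
            refine mul_le_of_le_one_right (by positivity) ?_
            rw [← div_eq_mul_inv, div_le_one (by positivity)]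
            linarith)
    rwa [abs_of_nonneg (by linarith [h.theta_nonneg]), sub_neg_eq_add, ← two_mul] at this
  rw [holSemigroup, hankel, norm_smul, hsplit θ (Or.inl rfl), hsplit (-θ) (Or.inr rfl),
    add_sub_add_comm, harc]
  refine mul_le_mul_of_nonneg_left ((norm_add_le _ _).trans (add_le_add harc'
    ((norm_sub_le _ _).trans ?_))) (norm_nonneg _)
  linarith [hout θ (Or.inl rfl), hout (-θ) (Or.inr rfl)]

/-- `e^{-tB} (1 + B)⁻¹ → (1 + B)⁻¹` in norm as `t → 0`. The integrand of the left hand side may be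
replaced by `e^{λt} (1 - λ)⁻¹ (λ + B)⁻¹ = O(|λ|⁻²)`, which has a limit as `t → 0`. -/
theorem tendsto_semigroup_mul_res (h : SectorialResolvent R θ C) :
    Tendsto (fun t => holSemigroup R θ t * R 1) (𝓝[>] 0) (𝓝 (R 1)) := by
  have hC := h.C_nonneg
  have hcos := h.cos_neg
  have h1S := h.inSector_one
  obtain ⟨k, hk, hkl⟩ := exists_one_add_norm_le h.theta_nonneg h.lt_pi
  have hne : ∀ l, InSector θ l → 1 + l ≠ 0 := fun l hl h0 => by
    have := hkl l hl
    rw [h0, norm_zero, mul_zero] at this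
    linarith [norm_nonneg l]
  have hinv : ∀ l, InSector θ l → ‖(1 + l)⁻¹‖ ≤ k * (1 + ‖l‖)⁻¹ := fun l hl => by
    have hp : 0 < ‖1 + l‖ := norm_pos_iff.2 (hne l hl)
    rw [norm_inv, ← div_eq_mul_inv, inv_le_comm₀ hp (by positivity), inv_div, div_le_iff₀ hk]
    linarith [hkl l hl]
  -- Unlike `(1 - λ)⁻¹ (λ + B)⁻¹`, the function `F` has no apparent singularity at `λ = 1`, so that
  -- it is holomorphic and `O(|λ|⁻²)` in the whole sector and its integral vanishes.
  set F : ℂ → Z →L[ℂ] Z := fun l => R l * R 1 - (1 + l)⁻¹ • R 1 with hF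
  set G : ℂ → Z →L[ℂ] Z := fun l => (1 - l)⁻¹ • R l with hG
  have hFd : ∀ l, InSector θ l → DifferentiableAt ℂ F l := fun l hl =>
    ((h.differentiableAt l hl).mul_const (R 1)).sub
      (((by fun_prop : DifferentiableAt ℂ (fun l : ℂ => 1 + l) l).inv (hne l hl)).smul_const (R 1))
  have hFb : ∀ l, InSector θ l →
      ‖F l‖ ≤ (9 * (C + k) * ‖R 1‖ + (3 * C + 6 * k * ‖R 1‖)) * ((1 + ‖l‖) ^ 2)⁻¹ := by
    intro l hl
    have hR := h.bound l hl
    have hi := hinv l hl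
    set r := ‖l‖ with hr
    have hr0 : 0 ≤ r := norm_nonneg l
    rcases le_total r 2 with h2 | h2
    · have ha : (1 + r)⁻¹ ≤ 1 := inv_le_one_of_one_le₀ (by linarith)
      have hb : 1 ≤ 9 * ((1 + r) ^ 2)⁻¹ := by
        rw [← div_eq_mul_inv, le_div_iff₀ (by positivity)]
        nlinarith
      calc ‖F l‖ ≤ ‖R l‖ * ‖R 1‖ + ‖(1 + l)⁻¹‖ * ‖R 1‖ := by
            refine (norm_sub_le _ _).trans (add_le_add (norm_mul_le _ _) ?_)
            rw [norm_smul]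
        _ ≤ (C * 1) * ‖R 1‖ + (k * 1) * ‖R 1‖ := by
            gcongr
            · exact hR.trans (by gcongr)
            · exact hi.trans (by gcongr)
        _ = (C + k) * ‖R 1‖ * 1 := by ring
        _ ≤ (C + k) * ‖R 1‖ * (9 * ((1 + r) ^ 2)⁻¹) := by gcongr
        _ = 9 * (C + k) * ‖R 1‖ * ((1 + r) ^ 2)⁻¹ := by ring
        _ ≤ _ := by
            refine mul_le_mul_of_nonneg_right (le_add_of_nonneg_right (by positivity))
              (by positivity)
    · have hl1 : (1 + r) / 3 ≤ ‖l - 1‖ := by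
        have := norm_sub_norm_le l 1
        rw [norm_one] at this
        linarith
      have hp : 0 < ‖l - 1‖ := by linarith
      have hl0 : l - 1 ≠ 0 := norm_pos_iff.1 hp
      have hl2 : ‖(l - 1)⁻¹‖ ≤ 3 * (1 + r)⁻¹ := by
        rw [norm_inv, ← div_eq_mul_inv, inv_le_comm₀ hp (by positivity), inv_div]
        exact hl1
      have hid : F l = ((l - 1)⁻¹ * (1 + l)⁻¹ * 2) • R 1 - (l - 1)⁻¹ • R l := by
        have e := h.sub_eq l 1 hl h1S
        have e2 : R l * R 1 = (l - 1)⁻¹ • (R 1 - R l) := by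
          rw [← neg_sub (R l), e, ← neg_smul, neg_sub, smul_smul, inv_mul_cancel₀ hl0, one_smul]
        have e3 : (l - 1)⁻¹ - (1 + l)⁻¹ = (l - 1)⁻¹ * (1 + l)⁻¹ * 2 := by
          have := hne l hl
          field_simp
          ring
        rw [hF]
        simp only
        rw [e2, ← e3, sub_smul, smul_sub]
        abel
      rw [hid]
      calc _ ≤ ‖(l - 1)⁻¹‖ * ‖(1 + l)⁻¹‖ * 2 * ‖R 1‖ + ‖(l - 1)⁻¹‖ * ‖R l‖ := by
            refine (norm_sub_le _ _).trans_eq ?_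
            rw [norm_smul, norm_smul, norm_mul, norm_mul, Complex.norm_ofNat]
        _ ≤ (3 * (1 + r)⁻¹) * (k * (1 + r)⁻¹) * 2 * ‖R 1‖ +
            (3 * (1 + r)⁻¹) * (C * (1 + r)⁻¹) := by gcongr
        _ = (3 * C + 6 * k * ‖R 1‖) * ((1 + r) ^ 2)⁻¹ := by rw [sq, mul_inv]; ring
        _ ≤ _ := by
            refine mul_le_mul_of_nonneg_right (le_add_of_nonneg_left (by positivity))
              (by positivity)
  set K := 9 * (C + k) * ‖R 1‖ + (3 * C + 6 * k * ‖R 1‖)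
  have hFb' : ∀ r φ : ℝ, 0 < r → φ ∈ Icc (-θ) θ →
      ‖F (r * Complex.exp (φ * Complex.I))‖ ≤ K * ((1 + r) ^ 2)⁻¹ := fun r φ hr hφ => by
    have := hFb _ (h.inSector hr hφ)
    rwa [norm_ray hr] at this
  have hF0 : hankel θ F = 0 := by
    rw [hankel, integral_rayFun_eq_of_sq (by linarith [h.theta_nonneg] : -θ ≤ θ)
      (fun r φ hr hφ => hFd _ (h.inSector hr hφ)) hFb', sub_self, smul_zero]
  have hFi : HankelIntegrable θ F :=
    ⟨integrableOn_rayFun_of_sq (fun r hr => (hFd _ (h.inSector hr h.mem_right)).continuousAt)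
        fun r hr => hFb' r θ hr h.mem_right,
      integrableOn_rayFun_of_sq (fun r hr => (hFd _ (h.inSector hr h.mem_left)).continuousAt)
        fun r hr => hFb' r (-θ) hr h.mem_left⟩
  have hGc : ∀ l, onRays θ l → ContinuousAt (fun l : ℂ => (1 - l)⁻¹) l := fun l hl =>
    ContinuousAt.inv₀ (by fun_prop) (one_sub_ne_zero_of_re_nonpos (hl.re_neg hcos).le)
  have hGb : ∀ l, onRays θ l → ‖(1 - l)⁻¹‖ ≤ 2 * (1 + ‖l‖)⁻¹ := fun l hl => by
    have hre := (hl.re_neg hcos).le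
    rw [norm_inv, ← div_eq_mul_inv, inv_le_comm₀
      (norm_pos_iff.2 (one_sub_ne_zero_of_re_nonpos hre)) (by positivity), inv_div,
      div_le_iff₀ two_pos]
    linarith [one_add_norm_le_of_re_nonpos hre]
  have hGc' : ∀ l, onRays θ l → ContinuousAt G l := fun l hl =>
    (hGc l hl).smul (h.differentiableAt l (hl.inSector h.theta_nonneg)).continuousAt
  have hGb' : ∀ r φ : ℝ, 0 < r → (φ = θ ∨ φ = -θ) →
      ‖G (r * Complex.exp (φ * Complex.I))‖ ≤ 2 * C * ((1 + r) ^ 2)⁻¹ := fun r φ hr hφ => by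
    have h1 := hGb _ ⟨r, φ, hr, hφ, rfl⟩
    have h2 := h.bound _ (h.inSector hr (h.mem_of_eq hφ))
    rw [norm_ray hr] at h1 h2
    rw [hG]
    simp only
    rw [norm_smul]
    calc _ ≤ (2 * (1 + r)⁻¹) * (C * (1 + r)⁻¹) := by gcongr
      _ = _ := by rw [sq, mul_inv]; ring
  have hGi : HankelIntegrable θ G :=
    ⟨integrableOn_rayFun_of_sq (fun r hr => hGc' _ ⟨r, θ, hr, Or.inl rfl, rfl⟩)
        fun r hr => hGb' r θ hr (Or.inl rfl),
      integrableOn_rayFun_of_sq (fun r hr => hGc' _ ⟨r, -θ, hr, Or.inr rfl, rfl⟩)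
        fun r hr => hGb' r (-θ) hr (Or.inr rfl)⟩
  -- `G - F` is a scalar multiple of `R 1`
  have hGF : ∀ l, onRays θ l → G l - F l = ((1 - l)⁻¹ * (1 + l)⁻¹ * 2) • R 1 := fun l hl => by
    have hlS := hl.inSector h.theta_nonneg
    have h0 := one_sub_ne_zero_of_re_nonpos (hl.re_neg hcos).le
    have e2 : R l * R 1 = (1 - l)⁻¹ • (R l - R 1) := by
      rw [h.sub_eq l 1 hlS h1S, smul_smul, inv_mul_cancel₀ h0, one_smul]
    have e3 : (1 - l)⁻¹ + (1 + l)⁻¹ = (1 - l)⁻¹ * (1 + l)⁻¹ * 2 := by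
      have := hne l hlS
      field_simp
      ring
    simp only [hF, hG]
    rw [e2, ← e3, add_smul, smul_sub]
    abel
  have hGval : hankel θ G = R 1 := by
    have h1 := hankel_sub hGi hFi
    rw [hF0, sub_zero, hankel_congr hGF] at h1
    rw [← h1]
    have hsc : HankelIntegrable θ fun l : ℂ => (1 - l)⁻¹ * (1 + l)⁻¹ * 2 := by
      have hc : ∀ l, onRays θ l →
          ContinuousAt (fun l : ℂ => (1 - l)⁻¹ * (1 + l)⁻¹ * 2) l := fun l hl =>
        ((hGc l hl).mul (ContinuousAt.inv₀ (by fun_prop)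
          (hne l (hl.inSector h.theta_nonneg)))).mul continuousAt_const
      have hb : ∀ r φ : ℝ, 0 < r → (φ = θ ∨ φ = -θ) →
          ‖(1 - (r * Complex.exp (φ * Complex.I)))⁻¹ *
            (1 + (r * Complex.exp (φ * Complex.I)))⁻¹ * 2‖ ≤ 4 * k * ((1 + r) ^ 2)⁻¹ := by
        intro r φ hr hφ
        have h1 := hGb _ ⟨r, φ, hr, hφ, rfl⟩
        have h2 := hinv _ (h.inSector hr (h.mem_of_eq hφ))
        rw [norm_ray hr] at h1 h2
        rw [norm_mul, norm_mul, Complex.norm_ofNat]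
        calc _ ≤ (2 * (1 + r)⁻¹) * (k * (1 + r)⁻¹) * 2 := by gcongr
          _ = _ := by rw [sq, mul_inv]; ring
      exact ⟨integrableOn_rayFun_of_sq (fun r hr => hc _ ⟨r, θ, hr, Or.inl rfl, rfl⟩)
          fun r hr => hb r θ hr (Or.inl rfl),
        integrableOn_rayFun_of_sq (fun r hr => hc _ ⟨r, -θ, hr, Or.inr rfl, rfl⟩)
          fun r hr => hb r (-θ) hr (Or.inr rfl)⟩
    have := hankel_map ((ContinuousLinearMap.id ℂ ℂ).smulRight (R 1)) hsc
    simp only [ContinuousLinearMap.smulRight_apply, ContinuousLinearMap.id_apply] at this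
    rw [this, hankel_two_div_one_sub_sq h.pi_div_two_lt h.lt_pi, one_smul]
  have hlim := tendsto_hankel_exp_smul hcos hGc' hGb'
  rw [hGval] at hlim
  refine hlim.congr' ?_
  filter_upwards [self_mem_nhdsWithin] with t ht
  have ht : 0 < t := ht
  have hIb : HankelBound θ (fun l : ℂ => (1 - l)⁻¹) 2 := by
    have hb : ∀ φ, (φ = θ ∨ φ = -θ) → RayBound φ (fun l : ℂ => (1 - l)⁻¹) 2 := fun φ hφ =>
      ⟨fun r hr => hGc _ ⟨r, φ, hr, hφ, rfl⟩, fun r hr => by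
        refine (hGb _ ⟨r, φ, hr, hφ, rfl⟩).trans ?_
        rw [norm_ray hr]
        have : (1 + r)⁻¹ ≤ 1 := inv_le_one_of_one_le₀ (by linarith)
        linarith⟩
    exact ⟨hb θ (Or.inl rfl), hb (-θ) (Or.inr rfl)⟩
  have hIi := hIb.integrable hcos ht
  have hm := hankel_map ((ContinuousLinearMap.id ℂ ℂ).smulRight (R 1)) hIi
  have hmi := hIi.map ((ContinuousLinearMap.id ℂ ℂ).smulRight (R 1))
  simp only [ContinuousLinearMap.smulRight_apply, ContinuousLinearMap.id_apply] at hm hmi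
  rw [hankel_exp_mul_inv_one_sub h.pi_div_two_lt h.lt_pi ht, zero_smul] at hm
  have hRi : HankelIntegrable θ fun l => Complex.exp (l * t) • (R l * R 1) := by
    have := (h.hankelBound.integrable hcos ht).map
      ((ContinuousLinearMap.mul ℂ (Z →L[ℂ] Z)).flip (R 1))
    simpa using this
  have hadd := hankel_add hRi hmi
  rw [hm, add_zero, ← h.semigroup_mul ht] at hadd
  rw [← hadd]
  refine hankel_congr fun l hl => ?_
  have hlS := hl.inSector h.theta_nonneg
  have h0 := one_sub_ne_zero_of_re_nonpos (hl.re_neg hcos).le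
  have e2 : R l * R 1 = (1 - l)⁻¹ • (R l - R 1) := by
    rw [h.sub_eq l 1 hlS h1S, smul_smul, inv_mul_cancel₀ h0, one_smul]
  rw [e2, hG, smul_assoc, ← smul_add, smul_sub, sub_add_cancel]

end SectorialResolvent

end SectorialResolvent

/-! ### Semigroup law and generator -/

section HolSemigroup

variable {Z : Type*} [NormedAddCommGroup Z] [NormedSpace ℂ Z] [CompleteSpace Z]

namespace SectorialResolvent

variable {R : ℂ → Z →L[ℂ] Z} {θ C : ℝ}

/-- The semigroup law, from `d/dσ e^{-(τ-σ)B} e^{-σB} (1 + B)⁻¹ = 0`. -/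
theorem semigroup_add (h : SectorialResolvent R θ C) (hd : DenseRange (R 1)) {s t : ℝ}
    (hs : 0 < s) (ht : 0 < t) :
    holSemigroup R θ (s + t) = holSemigroup R θ s * holSemigroup R θ t := by
  set T := holSemigroup R θ with hT
  set τ := s + t with hτ
  have hτ0 : 0 < τ := add_pos hs ht
  have hder : ∀ σ ∈ Ioo 0 τ, HasDerivAt (fun σ => T (τ - σ) * T σ * R 1) 0 σ := by
    intro σ hσ
    have h1 : HasDerivAt (fun σ => T (τ - σ)) (-holSemigroupDeriv R θ (τ - σ)) σ := by
      have := (h.hasDerivAt (sub_pos.2 hσ.2)).scomp σ ((hasDerivAt_id σ).const_sub τ)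
      rw [neg_one_smul] at this
      exact this
    have h2 := (h1.mul (h.hasDerivAt hσ.1)).mul_const (R 1)
    refine HasDerivAt.congr_deriv (f := fun σ => T (τ - σ) * T σ * R 1) h2 (Eq.symm ?_)
    have e1 : holSemigroupDeriv R θ (τ - σ) * T σ * R 1 = T (τ - σ) * (R 1 - 1) * T σ := by
      rw [mul_assoc, h.semigroup_commute hσ.1 h.inSector_one, ← mul_assoc,
        h.deriv_mul_res (sub_pos.2 hσ.2)]
    have e2 : T (τ - σ) * holSemigroupDeriv R θ σ * R 1 = T (τ - σ) * (T σ * (R 1 - 1)) := by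
      rw [mul_assoc, h.deriv_mul_res hσ.1]
    rw [add_mul, neg_mul, neg_mul, e1, e2, mul_sub (T σ), h.semigroup_commute hσ.1 h.inSector_one]
    simp only [mul_sub, sub_mul, mul_one, mul_assoc]
    abel
  have hconst : ∀ σ ∈ Ioo 0 τ, T (τ - σ) * T σ * R 1 = T (τ - t) * T t * R 1 := fun σ hσ =>
    (isOpen_Ioo).is_const_of_deriv_eq_zero isPreconnected_Ioo
      (fun x hx => (hder x hx).differentiableAt.differentiableWithinAt)
      (fun x hx => (hder x hx).deriv) hσ ⟨ht, by linarith⟩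
  have hlim : Tendsto (fun σ => T (τ - σ) * (T σ * R 1)) (𝓝[>] 0) (𝓝 (T τ * R 1)) := by
    refine Tendsto.mul ?_ h.tendsto_semigroup_mul_res
    have h1 : Tendsto (fun σ : ℝ => τ - σ) (𝓝[>] 0) (𝓝 τ) := by
      have : Tendsto (fun σ : ℝ => τ - σ) (𝓝 0) (𝓝 (τ - 0)) := tendsto_const_nhds.sub tendsto_id
      rw [sub_zero] at this
      exact this.mono_left nhdsWithin_le_nhds
    exact (h.hasDerivAt hτ0).continuousAt.tendsto.comp h1
  have heq : T τ * R 1 = T (τ - t) * T t * R 1 := by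
    refine tendsto_nhds_unique hlim (tendsto_const_nhds.congr' ?_)
    filter_upwards [Ioo_mem_nhdsGT hτ0] with σ hσ
    rw [← mul_assoc, hconst σ hσ]
  rw [hτ, add_sub_cancel_right] at heq
  refine DFunLike.coe_injective (hd.equalizer (T _).continuous (T s * T t).continuous ?_)
  exact congrArg DFunLike.coe heq

theorem tendsto_semigroup (h : SectorialResolvent R θ C) (hd : DenseRange (R 1)) (u : Z) :
    Tendsto (fun t => holSemigroup R θ t u) (𝓝[>] 0) (𝓝 u) := by
  obtain ⟨M, hM⟩ := h.exists_bound
  have hM0 : 0 ≤ M := (norm_nonneg _).trans (hM 1 one_pos)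
  rw [Metric.tendsto_nhds]
  intro ε hε
  obtain ⟨w, hw⟩ := hd.exists_dist_lt u (show 0 < ε / (2 * (M + 1)) by positivity)
  have h1 : Tendsto (fun t => holSemigroup R θ t (R 1 w)) (𝓝[>] 0) (𝓝 (R 1 w)) :=
    ((ContinuousLinearMap.apply ℂ Z w).continuous.tendsto _).comp h.tendsto_semigroup_mul_res
  rw [Metric.tendsto_nhds] at h1
  filter_upwards [h1 (ε / 2) (by positivity), self_mem_nhdsWithin] with t ht ht0
  have e : holSemigroup R θ t u - u = holSemigroup R θ t (u - R 1 w) +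
      (holSemigroup R θ t (R 1 w) - R 1 w) + (R 1 w - u) := by
    rw [map_sub]; abel
  rw [dist_eq_norm] at hw ht ⊢
  rw [e]
  calc _ ≤ M * ‖u - R 1 w‖ + ‖holSemigroup R θ t (R 1 w) - R 1 w‖ + ‖u - R 1 w‖ := by
        refine (norm_add₃_le).trans ?_
        rw [norm_sub_rev (R 1 w) u]
        gcongr
        exact (holSemigroup R θ t).le_of_opNorm_le (hM t ht0) _
    _ < M * (ε / (2 * (M + 1))) + ε / 2 + ε / (2 * (M + 1)) :=
        add_lt_add (add_lt_add_of_le_of_lt (mul_le_mul_of_nonneg_left hw.le hM0) ht) hw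
    _ = ε := by field_simp; ring

/-- The generator: `t⁻¹ (e^{-tB} u - u) → -v` exactly if `v = B u`. -/
theorem tendsto_diff_quotient_iff (h : SectorialResolvent R θ C) (hd : DenseRange (R 1))
    (u v : Z) : R 1 (v + u) = u ↔
      Tendsto (fun t : ℝ => t⁻¹ • (holSemigroup R θ t u - u)) (𝓝[>] 0) (𝓝 (-v)) := by
  have key : ∀ w : Z, Tendsto (fun t : ℝ => t⁻¹ • (holSemigroup R θ t (R 1 w) - R 1 w)) (𝓝[>] 0)
      (𝓝 (R 1 w - w)) := by
    intro w
    let g : ℝ → Z := fun t => if t ≤ 0 then R 1 w else holSemigroup R θ t (R 1 w)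
    have hg : ∀ t, 0 < t → g t = holSemigroup R θ t (R 1 w) := fun t ht => if_neg ht.not_ge
    have hgd : ∀ t, 0 < t → HasDerivAt g (holSemigroup R θ t (R 1 w - w)) t := fun t ht => by
      have h1 := ((ContinuousLinearMap.apply ℂ Z (R 1 w)).restrictScalars ℝ).hasFDerivAt.comp_hasDerivAt t
        (h.hasDerivAt ht)
      have h2 : (holSemigroupDeriv R θ t) (R 1 w) = holSemigroup R θ t (R 1 w - w) := by
        have := congrArg (fun P => P w) (h.deriv_mul_res ht)
        simpa using this
      have h3 : HasDerivAt (fun t => holSemigroup R θ t (R 1 w)) (holSemigroup R θ t (R 1 w - w)) t := by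
        rw [← h2]; exact h1
      refine h3.congr_of_eventuallyEq ?_
      filter_upwards [lt_mem_nhds ht] with s hs using hg s hs
    have h0 := hasDerivWithinAt_Ici_of_tendsto_deriv (a := (0 : ℝ)) (s := Ioi 0) (f := g)
      (e := R 1 w - w) (fun t ht => (hgd t ht).differentiableAt.differentiableWithinAt)
      (by
        have : Tendsto g (𝓝[>] 0) (𝓝 (g 0)) := by
          have e0 : g 0 = R 1 w := if_pos le_rfl
          rw [e0]
          refine (h.tendsto_semigroup hd (R 1 w)).congr' ?_
          filter_upwards [self_mem_nhdsWithin] with t ht using (hg t ht).symm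
        exact this)
      self_mem_nhdsWithin
      (by
        refine (h.tendsto_semigroup hd (R 1 w - w)).congr' ?_
        filter_upwards [self_mem_nhdsWithin] with t ht using (hgd t ht).deriv.symm)
    have h1 := (hasDerivWithinAt_iff_tendsto_slope' self_notMem_Ioi).1 h0.Ioi_of_Ici
    refine h1.congr' ?_
    filter_upwards [self_mem_nhdsWithin] with t ht
    rw [slope_def_module, hg t ht, sub_zero, show g 0 = R 1 w from if_pos le_rfl]
  constructor
  · intro hu
    have := key (v + u)
    rwa [hu, show u - (v + u) = -v by abel] at this
  · intro hlim
    have h1 : Tendsto (fun t : ℝ => R 1 (t⁻¹ • (holSemigroup R θ t u - u))) (𝓝[>] 0)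
        (𝓝 (R 1 (-v))) := ((R 1).continuous.tendsto _).comp hlim
    have h2 := tendsto_nhds_unique h1 ((key u).congr' (by
      filter_upwards [self_mem_nhdsWithin] with t ht
      have := congrArg (fun P => P u) (h.semigroup_commute (show 0 < t from ht) h.inSector_one)
      simp only [mul_apply_eq_comp] at this
      rw [this, ← map_sub]
      exact ((R 1).map_smul_of_tower t⁻¹ _).symm))
    rw [map_neg] at h2
    rw [map_add, ← neg_neg (R 1 v), h2]
    abel

end SectorialResolvent

end HolSemigroup

/-! ### A semigroup is determined by its generator -/

section Uniqueness

variable {X : Type*} [NormedAddCommGroup X] [NormedSpace ℝ X]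

/-- `S` is, on `t ≥ 0`, a strongly continuous semigroup, and `G` is the graph of the negative of its
generator. -/
structure IsSemigroupWithGraph (G : Set (X × X)) (S : ℝ → X →L[ℝ] X) : Prop where
  zero : S 0 = 1
  add : ∀ s t : ℝ, 0 ≤ s → 0 ≤ t → S (s + t) = S s * S t
  tendsto : ∀ u : X, Tendsto (fun t => S t u) (𝓝[>] 0) (𝓝 u)
  generator : ∀ u v : X, (u, v) ∈ G ↔
    Tendsto (fun t : ℝ => t⁻¹ • (S t u - u)) (𝓝[>] 0) (𝓝 (-v))

theorem IsSemigroupOf.isSemigroupWithGraph {A : X →ₗ.[ℝ] X} {S : ℝ → X →L[ℝ] X}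
    (h : IsSemigroupOf A S) : IsSemigroupWithGraph (A.graph : Set (X × X)) S :=
  ⟨h.zero, h.add, h.tendsto, h.generator⟩

namespace IsSemigroupWithGraph

variable {G : Set (X × X)} {S S' : ℝ → X →L[ℝ] X}

theorem add_apply (h : IsSemigroupWithGraph G S) {s t : ℝ} (hs : 0 ≤ s) (ht : 0 ≤ t) (u : X) :
    S (s + t) u = S s (S t u) := by
  rw [h.add s t hs ht]; rfl

theorem tendsto_Ici (h : IsSemigroupWithGraph G S) (u : X) :
    Tendsto (fun t => S t u) (𝓝[≥] 0) (𝓝 u) := by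
  rw [← Ioi_union_left, nhdsWithin_union, nhdsWithin_singleton]
  refine (h.tendsto u).sup ?_
  rw [tendsto_pure_left]
  intro s hs
  rw [h.zero]
  exact mem_of_mem_nhds hs

/-- If `(u, v)` is in the graph, so is `(S(σ) u, S(σ) v)`. -/
theorem apply_mem (h : IsSemigroupWithGraph G S) {u v : X} (huv : (u, v) ∈ G) {σ : ℝ}
    (hσ : 0 ≤ σ) : (S σ u, S σ v) ∈ G := by
  rw [h.generator] at huv ⊢
  have h1 := ((S σ).continuous.tendsto _).comp huv
  rw [map_neg] at h1
  refine h1.congr' ?_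
  filter_upwards [self_mem_nhdsWithin] with t ht
  have ht0 : 0 ≤ t := le_of_lt ht
  simp only [Function.comp, map_smul, map_sub]
  rw [← h.add_apply ht0 hσ, add_comm t, h.add_apply hσ ht0]

theorem map_natCast_mul (h : IsSemigroupWithGraph G S) {t : ℝ} (ht : 0 ≤ t) (n : ℕ) :
    S (n * t) = S t ^ n := by
  induction n with
  | zero => simp [h.zero]
  | succ n ih =>
    rw [Nat.cast_add_one, add_mul, one_mul, h.add _ _ (by positivity) ht, ih, pow_succ]

variable [CompleteSpace X]

theorem exists_bound_near_zero (h : IsSemigroupWithGraph G S) :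
    ∃ M δ : ℝ, 0 < δ ∧ ∀ t, 0 ≤ t → t ≤ δ → ‖S t‖ ≤ M := by
  by_contra! hcon
  choose t ht0 ht1 ht using fun n : ℕ => hcon n (1 / (n + 1)) (by positivity)
  have htl : Tendsto t atTop (𝓝[≥] 0) := by
    refine tendsto_nhdsWithin_iff.2 ⟨squeeze_zero ht0 ht1 tendsto_one_div_add_atTop_nhds_zero_nat,
      Eventually.of_forall ht0⟩
  obtain ⟨C, hC⟩ := banach_steinhaus (g := fun n => S (t n)) fun u => by
    obtain ⟨C, hC⟩ := ((h.tendsto_Ici u).comp htl).norm.bddAbove_range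
    exact ⟨C, fun n => hC ⟨n, rfl⟩⟩
  obtain ⟨n, hn⟩ := exists_nat_gt C
  exact absurd (hC n) (not_le.2 (hn.trans (ht n)))

theorem exists_bound (h : IsSemigroupWithGraph G S) (τ : ℝ) :
    ∃ M : ℝ, ∀ t, 0 ≤ t → t ≤ τ → ‖S t‖ ≤ M := by
  obtain ⟨M, δ, hδ, hM⟩ := h.exists_bound_near_zero
  obtain ⟨n, hn⟩ := exists_nat_gt (τ / δ)
  refine ⟨max 1 M ^ (n + 1), fun t ht0 ht => ?_⟩
  have hn1 : (0 : ℝ) < (n + 1 : ℕ) := by positivity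
  have e : t = (n + 1 : ℕ) * (t / (n + 1 : ℕ)) := by field_simp
  have h1 : t / (n + 1 : ℕ) ≤ δ := by
    rw [div_le_iff₀ hn1]
    rw [div_lt_iff₀ hδ] at hn
    push_cast
    nlinarith
  rw [e, h.map_natCast_mul (by positivity)]
  refine (norm_pow_le' _ n.succ_pos).trans (pow_le_pow_left₀ (norm_nonneg _) ?_ _)
  exact (hM _ (by positivity) h1).trans (le_max_right _ _)

theorem continuousOn (h : IsSemigroupWithGraph G S) (u : X) :
    ContinuousOn (fun t => S t u) (Ici 0) := by
  intro a ha
  have ha : 0 ≤ a := ha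
  obtain ⟨M, hM⟩ := h.exists_bound (a + 1)
  have hM0 : 0 ≤ M := (norm_nonneg _).trans (hM 0 le_rfl (by linarith))
  have habs : Tendsto (fun b : ℝ => |b - a|) (𝓝[Ici 0] a) (𝓝[≥] 0) := by
    refine tendsto_nhdsWithin_iff.2 ⟨?_, Eventually.of_forall fun b => mem_Ici.2 (abs_nonneg _)⟩
    have : Continuous fun b : ℝ => |b - a| := by fun_prop
    have h2 := this.tendsto a
    simp only [sub_self, abs_zero] at h2
    exact h2.mono_left nhdsWithin_le_nhds
  have h1 : Tendsto (fun b : ℝ => M * ‖S |b - a| u - u‖) (𝓝[Ici 0] a) (𝓝 0) := by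
    have := (((h.tendsto_Ici u).comp habs).sub_const u).norm.const_mul M
    simpa using this
  rw [ContinuousWithinAt, tendsto_iff_norm_sub_tendsto_zero]
  refine squeeze_zero' (Eventually.of_forall fun _ => norm_nonneg _) ?_ h1
  filter_upwards [self_mem_nhdsWithin, nhdsWithin_le_nhds (ge_mem_nhds (lt_add_one a))] with b hb hb1
  have hb : 0 ≤ b := hb
  rcases le_total a b with hab | hab
  · have e : S b u - S a u = S a (S |b - a| u - u) := by
      rw [abs_of_nonneg (sub_nonneg.2 hab), map_sub, ← h.add_apply ha (sub_nonneg.2 hab),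
        add_sub_cancel]
    rw [e]
    exact (S a).le_of_opNorm_le (hM a ha (by linarith)) _
  · have e : S b u - S a u = -S b (S |b - a| u - u) := by
      rw [abs_of_nonpos (sub_nonpos.2 hab), neg_sub, map_sub, ← h.add_apply hb (sub_nonneg.2 hab),
        add_sub_cancel, neg_sub]
    rw [e, norm_neg]
    exact (S b).le_of_opNorm_le (hM b hb hb1) _

/-- A semigroup is determined by its generator: `σ ↦ S'(t - σ) S(σ) u` has right derivative zero
for `u` in the domain of the generator. -/
theorem eq_of_graph (h : IsSemigroupWithGraph G S) (h' : IsSemigroupWithGraph G S')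
    (hd : Dense {u | ∃ v, (u, v) ∈ G}) {t : ℝ} (ht : 0 ≤ t) : S t = S' t := by
  obtain ⟨M, hM⟩ := h'.exists_bound t
  have hM0 : 0 ≤ M := (norm_nonneg _).trans (hM 0 le_rfl ht)
  refine ContinuousLinearMap.ext_on (s := {u | ∃ v, (u, v) ∈ G}) (by
    exact hd.mono Submodule.subset_span) ?_
  rintro u ⟨v, huv⟩
  have hcont : ContinuousOn (fun σ => S' (t - σ) (S σ u)) (Icc 0 t) := by
    intro a ha
    have h1 : Tendsto (fun σ => S σ u) (𝓝[Icc 0 t] a) (𝓝 (S a u)) :=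
      ((h.continuousOn u).mono Icc_subset_Ici_self) a ha
    have h2 : Tendsto (fun σ => S' (t - σ) (S a u)) (𝓝[Icc 0 t] a) (𝓝 (S' (t - a) (S a u))) := by
      have := h'.continuousOn (S a u) (t - a) (sub_nonneg.2 ha.2)
      refine this.tendsto.comp (tendsto_nhdsWithin_iff.2 ⟨?_, ?_⟩)
      · exact (tendsto_const_nhds.sub tendsto_id).mono_left nhdsWithin_le_nhds
      · filter_upwards [self_mem_nhdsWithin] with σ hσ using sub_nonneg.2 hσ.2
    have h3 : Tendsto (fun σ => S' (t - σ) (S σ u - S a u)) (𝓝[Icc 0 t] a) (𝓝 0) := by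
      have h4 : Tendsto (fun σ => M * ‖S σ u - S a u‖) (𝓝[Icc 0 t] a) (𝓝 0) := by
        have := (h1.sub_const (S a u)).norm.const_mul M
        simpa using this
      refine squeeze_zero_norm' ?_ h4
      filter_upwards [self_mem_nhdsWithin] with σ hσ
      exact (S' (t - σ)).le_of_opNorm_le (hM _ (sub_nonneg.2 hσ.2) (by linarith [hσ.1])) _
    have h5 := h3.add h2
    rw [zero_add] at h5
    refine h5.congr fun σ => ?_
    rw [← map_add, sub_add_cancel]
  have hder : ∀ σ ∈ Ico 0 t,
      HasDerivWithinAt (fun σ => S' (t - σ) (S σ u)) 0 (Ici σ) σ := by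
    intro σ hσ
    have hw := h.apply_mem huv hσ.1
    set w := S σ u with hwdef
    have h1 := ((h.generator _ _).1 hw).sub ((h'.generator _ _).1 hw)
    rw [sub_self] at h1
    have h2 : Tendsto (fun k : ℝ => M * ‖k⁻¹ • (S k w - w) - k⁻¹ • (S' k w - w)‖) (𝓝[>] 0)
        (𝓝 0) := by simpa using h1.norm.const_mul M
    have hsub : Tendsto (fun x : ℝ => x - σ) (𝓝[>] σ) (𝓝[>] 0) := by
      refine tendsto_nhdsWithin_iff.2 ⟨?_, ?_⟩
      · have : Tendsto (fun x : ℝ => x - σ) (𝓝 σ) (𝓝 (σ - σ)) := tendsto_id.sub_const σ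
        rw [sub_self] at this
        exact this.mono_left nhdsWithin_le_nhds
      · filter_upwards [self_mem_nhdsWithin] with x hx using sub_pos.2 (mem_Ioi.1 hx)
    rw [← hasDerivWithinAt_Ioi_iff_Ici, hasDerivWithinAt_iff_tendsto_slope' self_notMem_Ioi]
    refine squeeze_zero_norm' ?_ (h2.comp hsub)
    filter_upwards [Ioc_mem_nhdsGT hσ.2] with x hx
    have hk : 0 ≤ x - σ := by linarith [hx.1]
    have htx : 0 ≤ t - x := by linarith [hx.2]
    have e : slope (fun σ => S' (t - σ) (S σ u)) σ x =
        S' (t - x) ((x - σ)⁻¹ • (S (x - σ) w - w) - (x - σ)⁻¹ • (S' (x - σ) w - w)) := by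
      rw [slope_def_module, ← smul_sub, map_smul, sub_sub_sub_cancel_right, map_sub,
        ← h'.add_apply htx hk, hwdef, ← h.add_apply hk hσ.1]
      congr 4 <;> ring_nf
    rw [e]
    exact (S' (t - x)).le_of_opNorm_le (hM _ htx (by linarith [hσ.1, hx.1])) _
  have := constant_of_has_deriv_right_zero hcont hder t ⟨ht, le_rfl⟩
  simpa [h.zero, h'.zero] using this

end IsSemigroupWithGraph

end Uniqueness

/-! ### Resolvents of operators given by their graph -/

section GraphResolvent

variable {Z : Type*} [NormedAddCommGroup Z] [NormedSpace ℂ Z]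

/-- `P = (z - A)⁻¹` for the operator `A` with graph `G`. -/
structure IsResolvent (G : Submodule ℂ (Z × Z)) (z : ℂ) (P : Z →L[ℂ] Z) : Prop where
  mem : ∀ w, (P w, z • P w - w) ∈ G
  apply : ∀ u v, (u, v) ∈ G → P (z • u - v) = u

/-- The resolvent of the operator with graph `G` exists at `z` and is bounded by `K`. -/
def HasResolvent (G : Submodule ℂ (Z × Z)) (z : ℂ) (K : ℝ) : Prop :=
  ∃ P : Z →L[ℂ] Z, IsResolvent G z P ∧ ‖P‖ ≤ K

theorem HasResolvent.mono {G : Submodule ℂ (Z × Z)} {z : ℂ} {K K' : ℝ} (h : HasResolvent G z K)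
    (hK : K ≤ K') : HasResolvent G z K' :=
  let ⟨P, hP, hPK⟩ := h
  ⟨P, hP, hPK.trans hK⟩

theorem HasResolvent.nonneg {G : Submodule ℂ (Z × Z)} {z : ℂ} {K : ℝ} (h : HasResolvent G z K) :
    0 ≤ K :=
  let ⟨_, _, hPK⟩ := h
  (norm_nonneg _).trans hPK

theorem hasResolvent_of_bijective {G : Submodule ℂ (Z × Z)} {z : ℂ} {K : ℝ}
    (hs : ∀ w, ∃ u, (u, z • u - w) ∈ G) (hb : ∀ u v, (u, v) ∈ G → ‖u‖ ≤ K * ‖z • u - v‖) :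
    HasResolvent G z (max K 0) := by
  have hb' : ∀ u w, (u, z • u - w) ∈ G → ‖u‖ ≤ K * ‖w‖ := fun u w h => by
    simpa using hb u _ h
  have huniq : ∀ u u' w, (u, z • u - w) ∈ G → (u', z • u' - w) ∈ G → u = u' := by
    intro u u' w h h'
    have h1 := G.sub_mem h h'
    rw [Prod.mk_sub_mk, sub_sub_sub_cancel_right, ← smul_sub] at h1
    have := hb' (u - u') 0 (by rwa [sub_zero])
    rw [norm_zero, mul_zero, norm_le_zero_iff, sub_eq_zero] at this
    exact this
  choose g hg using hs
  let L : Z →ₗ[ℂ] Z :=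
    { toFun := g
      map_add' := fun x y => huniq _ _ (x + y) (hg _) (by
        have := G.add_mem (hg x) (hg y)
        rwa [Prod.mk_add_mk, sub_add_sub_comm, ← smul_add] at this)
      map_smul' := fun c x => huniq _ _ (c • x) (hg _) (by
        have := G.smul_mem c (hg x)
        rwa [Prod.smul_mk, smul_sub, smul_comm] at this) }
  have hL : ∀ w, ‖L w‖ ≤ max K 0 * ‖w‖ := fun w =>
    (hb' _ _ (hg w)).trans (mul_le_mul_of_nonneg_right (le_max_left _ _) (norm_nonneg _))
  refine ⟨L.mkContinuous _ hL, ⟨hg, fun u v huv => ?_⟩,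
    L.mkContinuous_norm_le (le_max_right _ _) hL⟩
  exact huniq _ _ (z • u - v) (hg _) (by rwa [sub_sub_cancel])

variable {G : Submodule ℂ (Z × Z)}

/-- The resolvent identity. -/
theorem IsResolvent.sub_eq {z w : ℂ} {P Q : Z →L[ℂ] Z} (hP : IsResolvent G z P)
    (hQ : IsResolvent G w Q) : P - Q = (w - z) • (P * Q) := by
  ext x
  have h1 := hP.apply _ _ (hQ.mem x)
  rw [map_sub, map_sub, map_smul, map_smul] at h1
  simp only [sub_apply, smul_apply, mul_apply_eq_comp, sub_smul]
  calc P x - Q x = P x - (z • P (Q x) - (w • P (Q x) - P x)) := by rw [h1]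
    _ = _ := by abel

theorem IsResolvent.unique {z : ℂ} {P Q : Z →L[ℂ] Z} (hP : IsResolvent G z P)
    (hQ : IsResolvent G z Q) : P = Q := by
  have := hP.sub_eq hQ
  rwa [sub_self, zero_smul, sub_eq_zero] at this

/-- Perturbation of the spectral parameter, by the Neumann series. -/
theorem HasResolvent.of_near [CompleteSpace Z] {z w : ℂ} {K : ℝ} (h : HasResolvent G z K)
    (hw : ‖w - z‖ * K ≤ 1 / 2) : HasResolvent G w (2 * K) := by
  have hK0 := h.nonneg
  obtain ⟨P, hP, hPK⟩ := h
  set N : Z →L[ℂ] Z := (z - w) • P with hN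
  have hN2 : ‖N‖ ≤ 1 / 2 := by
    rw [hN, norm_smul, norm_sub_rev]
    exact (mul_le_mul_of_nonneg_left hPK (norm_nonneg _)).trans hw
  set U : (Z →L[ℂ] Z)ˣ := Units.oneSub N (by linarith) with hU
  have hUv : (U : Z →L[ℂ] Z) = 1 - N := rfl
  set V : Z →L[ℂ] Z := ↑U⁻¹ with hV
  have hUV : ∀ x, V x + (w - z) • P (V x) = x := fun x => by
    have h1 : (U : Z →L[ℂ] Z) * V = 1 := U.mul_inv
    have h2 := congrArg (fun T => T x) h1
    simp only [hUv, mul_apply_eq_comp, sub_apply, hN, smul_apply, one_apply_eq_self] at h2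
    rw [← neg_sub z w, neg_smul, ← sub_eq_add_neg, h2]
  have hVU : ∀ y, V (y + (w - z) • P y) = y := fun y => by
    have h1 : V * (U : Z →L[ℂ] Z) = 1 := U.inv_mul
    have h2 := congrArg (fun T => T y) h1
    simp only [hUv, mul_apply_eq_comp, sub_apply, hN, smul_apply, one_apply_eq_self] at h2
    rw [← neg_sub z w, neg_smul, ← sub_eq_add_neg, h2]
  refine ⟨P * V, ⟨fun x => ?_, fun u v huv => ?_⟩, ?_⟩
  · have h1 := hP.mem (V x)
    rw [mul_apply_eq_comp]
    convert h1 using 2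
    nth_rw 2 [← hUV x]
    rw [sub_smul]
    abel
  · have h1 := hP.apply u v huv
    have h2 := hVU (z • u - v)
    rw [h1] at h2
    rw [mul_apply_eq_comp]
    have e : w • u - v = z • u - v + (w - z) • u := by rw [sub_smul]; abel
    rw [e, h2, h1]
  · refine ContinuousLinearMap.opNorm_le_bound _ (by positivity) fun x => ?_
    have h1 : ‖V x‖ ≤ 2 * ‖x‖ := by
      have e : V x = x + N (V x) := by
        nth_rw 2 [← hUV x]
        rw [hN, smul_apply, ← neg_sub w z, neg_smul]
        abel
      have h2 : ‖V x‖ ≤ ‖x‖ + 1 / 2 * ‖V x‖ := by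
        calc ‖V x‖ = ‖x + N (V x)‖ := by rw [← e]
          _ ≤ ‖x‖ + ‖N (V x)‖ := norm_add_le _ _
          _ ≤ _ := by gcongr; exact N.le_of_opNorm_le hN2 _
      linarith
    calc ‖P (V x)‖ ≤ K * ‖V x‖ := P.le_of_opNorm_le hPK _
      _ ≤ K * (2 * ‖x‖) := by gcongr
      _ = _ := by ring

open Classical in
/-- The resolvent `(z - A)⁻¹` of the operator `A` with graph `G`, or `0` if it does not exist. -/
def graphRes (G : Submodule ℂ (Z × Z)) (z : ℂ) : Z →L[ℂ] Z :=
  if h : ∃ P, IsResolvent G z P then h.choose else 0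

theorem HasResolvent.isResolvent {z : ℂ} {K : ℝ} (h : HasResolvent G z K) :
    IsResolvent G z (graphRes G z) ∧ ‖graphRes G z‖ ≤ K := by
  obtain ⟨P, hP, hPK⟩ := h
  have hex : ∃ P, IsResolvent G z P := ⟨P, hP⟩
  have h1 : IsResolvent G z (graphRes G z) := by
    rw [graphRes, dif_pos hex]
    exact hex.choose_spec
  exact ⟨h1, by rwa [h1.unique hP]⟩

theorem HasResolvent.hasDerivAt [CompleteSpace Z] {z : ℂ} {K : ℝ} (h : HasResolvent G z K) :
    HasDerivAt (graphRes G) (-(graphRes G z * graphRes G z)) z := by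
  have hK0 := h.nonneg
  have hnear : ∀ᶠ w in 𝓝 z, HasResolvent G w (2 * K) := by
    have : Tendsto (fun w : ℂ => ‖w - z‖ * K) (𝓝 z) (𝓝 0) := by
      have hc : Continuous fun w : ℂ => ‖w - z‖ * K := by fun_prop
      simpa using hc.tendsto z
    filter_upwards [this.eventually (ge_mem_nhds (by norm_num : (0 : ℝ) < 1 / 2))] with w hw
    exact h.of_near hw
  have hcont : Tendsto (graphRes G) (𝓝 z) (𝓝 (graphRes G z)) := by
    rw [tendsto_iff_norm_sub_tendsto_zero]
    have : Tendsto (fun w : ℂ => ‖z - w‖ * (2 * K * K)) (𝓝 z) (𝓝 0) := by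
      have hc : Continuous fun w : ℂ => ‖z - w‖ * (2 * K * K) := by fun_prop
      simpa using hc.tendsto z
    refine squeeze_zero' (Eventually.of_forall fun _ => norm_nonneg _) ?_ this
    filter_upwards [hnear] with w hw
    rw [hw.isResolvent.1.sub_eq h.isResolvent.1, norm_smul]
    gcongr
    refine (norm_mul_le _ _).trans ?_
    gcongr
    exacts [hw.isResolvent.2, h.isResolvent.2]
  rw [hasDerivAt_iff_tendsto_slope]
  have h2 : Tendsto (fun w => -(graphRes G w * graphRes G z)) (𝓝[≠] z)
      (𝓝 (-(graphRes G z * graphRes G z))) :=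
    ((hcont.mono_left nhdsWithin_le_nhds).mul_const _).neg
  refine h2.congr' ?_
  filter_upwards [nhdsWithin_le_nhds hnear, self_mem_nhdsWithin] with w hw hne
  have hne' : w - z ≠ 0 := sub_ne_zero.2 hne
  rw [slope_def_module, hw.isResolvent.1.sub_eq h.isResolvent.1, smul_smul, ← neg_sub w z, mul_neg,
    inv_mul_cancel₀ hne', neg_one_smul]

/-- If `(z - A)⁻¹` exists for `Re z ≤ 0` and is `O(1 / |z - b|)` outside of an acute sector with
vertex `b`, then `(A - δ + λ)⁻¹` is sectorial for some `δ > 0`. -/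
theorem exists_sectorialResolvent [CompleteSpace Z] {φ M b : ℝ} (hφ0 : 0 < φ)
    (hφ : φ < Real.pi / 2) (hM : 1 ≤ M)
    (hsec : ∀ z : ℂ, z ≠ (b : ℂ) → φ ≤ |Complex.arg (z - (b : ℂ))| →
      HasResolvent G z (M / ‖z - (b : ℂ)‖))
    (hhalf : ∀ z : ℂ, z.re ≤ 0 → ∃ K, HasResolvent G z K) :
    ∃ δ θ C : ℝ, 0 < δ ∧ SectorialResolvent (fun l => -graphRes G (δ - l)) θ C ∧
      ∀ u v, (u, v) ∈ G ↔ (-graphRes G (δ - 1)) (v - (δ : ℂ) • u + u) = u := by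
  have hcosφ : 0 < Real.cos φ := Real.cos_pos_of_mem_Ioo ⟨by linarith, hφ⟩
  have hcos1 := Real.cos_le_one φ
  set c := Real.cos φ / 2 with hc
  have hc0 : 0 < c := by positivity
  set ρ := 4 * |b| / Real.cos φ + 1 with hρ
  have hρ1 : 1 ≤ ρ := le_add_of_nonneg_left (by positivity)
  -- large `z`
  have hlarge : ∀ z : ℂ, ρ ≤ ‖z‖ → z.re ≤ c * ‖z‖ → HasResolvent G z (2 * M / ‖z‖) := by
    intro z hz hre
    have hb4 : 4 * |b| ≤ Real.cos φ * ‖z‖ := by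
      have : 4 * |b| / Real.cos φ ≤ ‖z‖ := by linarith
      rw [div_le_iff₀ hcosφ] at this
      linarith
    have hz0 : 0 < ‖z‖ := by linarith
    have hb4' : 4 * |b| ≤ ‖z‖ := hb4.trans (mul_le_of_le_one_left hz0.le hcos1)
    have hnb : ‖(b : ℂ)‖ = |b| := Complex.norm_real b
    have hsub : ‖z‖ - |b| ≤ ‖z - b‖ := by
      rw [← hnb]; exact norm_sub_norm_le z b
    have hpos : 0 < ‖z - b‖ := by linarith [abs_nonneg b]
    refine (hsec z (sub_ne_zero.1 (norm_pos_iff.1 hpos)) ?_).mono ?_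
    · by_contra! hlt
      have h1 : Real.cos φ < Real.cos |Complex.arg (z - b)| :=
        Real.cos_lt_cos_of_nonneg_of_le_pi (abs_nonneg _) (by linarith [Real.pi_pos]) hlt
      rw [Real.cos_abs, Complex.cos_arg (norm_pos_iff.1 hpos), lt_div_iff₀ hpos, Complex.sub_re,
        Complex.ofReal_re] at h1
      have h2 : Real.cos φ * (‖z‖ - |b|) ≤ Real.cos φ * ‖z - b‖ := by gcongr
      have h3 : Real.cos φ * |b| ≤ |b| := mul_le_of_le_one_left (abs_nonneg b) hcos1
      have h4 := neg_abs_le b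
      rw [hc] at hre
      linarith
    · rw [div_le_div_iff₀ hpos hz0]
      nlinarith [abs_nonneg b]
  -- small `z`, by compactness of the half disc
  obtain ⟨K, hK0, hK⟩ : ∃ K, 0 < K ∧ ∀ z : ℂ, z.re ≤ 0 → ‖z‖ ≤ ρ → HasResolvent G z K := by
    have hcomp : IsCompact {z : ℂ | z.re ≤ 0 ∧ ‖z‖ ≤ ρ} := by
      refine (isCompact_closedBall (0 : ℂ) ρ).of_isClosed_subset ?_ ?_
      · exact (isClosed_le Complex.continuous_re continuous_const).inter
          (isClosed_le continuous_norm continuous_const)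
      · intro z hz
        rw [mem_closedBall_zero_iff]
        exact hz.2
    have := hcomp.induction_on
      (p := fun s => ∃ K, 0 < K ∧ ∀ z ∈ s, HasResolvent G z K)
      ⟨1, one_pos, fun _ h => h.elim⟩
      (fun s t hst ⟨K, h0, hK⟩ => ⟨K, h0, fun z hz => hK z (hst hz)⟩)
      (fun s t ⟨K, h0, hK⟩ ⟨K', _, hK'⟩ => ⟨max K K', lt_max_of_lt_left h0, fun z hz =>
        hz.elim (fun h => (hK z h).mono (le_max_left _ _))
          fun h => (hK' z h).mono (le_max_right _ _)⟩)
      (fun z hz => by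
        obtain ⟨K, hK⟩ := hhalf z hz.1
        have hK0 := hK.nonneg
        have ht : Tendsto (fun w : ℂ => ‖w - z‖ * K) (𝓝 z) (𝓝 0) := by
          have hc : Continuous fun w : ℂ => ‖w - z‖ * K := by fun_prop
          simpa using hc.tendsto z
        refine ⟨{w | ‖w - z‖ * K ≤ 1 / 2}, nhdsWithin_le_nhds
          (ht.eventually (ge_mem_nhds (by norm_num : (0 : ℝ) < 1 / 2))), 2 * K + 1, by linarith,
          fun w hw => (hK.of_near hw).mono (by linarith)⟩)
    obtain ⟨K, h0, hK⟩ := this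
    exact ⟨K, h0, fun z h1 h2 => hK z ⟨h1, h2⟩⟩
  set d := 1 / (2 * K) with hd
  have hd0 : 0 < d := by positivity
  have hsmall : ∀ z : ℂ, z.re ≤ d → ‖z‖ ≤ ρ → HasResolvent G z (2 * K) := by
    intro z hre hz
    rcases le_or_gt z.re 0 with h0 | h0
    · exact (hK z h0 hz).mono (by linarith)
    · refine (hK (z.im * Complex.I) (by simp) ?_).of_near ?_
      · rw [norm_mul, Complex.norm_I, mul_one, Complex.norm_real]
        exact (Complex.abs_im_le_norm z).trans hz
      · have e : z - z.im * Complex.I = z.re := by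
          nth_rw 1 [← Complex.re_add_im z]; ring
        rw [e, Complex.norm_real, Real.norm_of_nonneg h0.le]
        calc z.re * K ≤ d * K := by gcongr
          _ = 1 / 2 := by rw [hd]; field_simp
  set ε := min (d / (2 * (ρ + 1))) (min (c / 4) (1 / 2)) with hε
  set δ := min (d / 2) (min (c / 4) 1) with hδ
  have hε0 : 0 < ε := by positivity
  have hδ0 : 0 < δ := by positivity
  have hε1 : ε * (2 * (ρ + 1)) ≤ d := by
    rw [← le_div_iff₀ (by positivity)]; exact min_le_left _ _
  have hε2 : ε ≤ c / 4 := (min_le_right _ _).trans (min_le_left _ _)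
  have hε3 : ε ≤ 1 / 2 := (min_le_right _ _).trans (min_le_right _ _)
  have hδ1 : δ ≤ d / 2 := min_le_left _ _
  have hδ2 : δ ≤ c / 4 := (min_le_right _ _).trans (min_le_left _ _)
  have hδ3 : δ ≤ 1 := (min_le_right _ _).trans (min_le_right _ _)
  set θ := Real.arccos (-ε) with hθ
  have hcosθ : Real.cos θ = -ε := Real.cos_arccos (by linarith) (by linarith)
  have hθ1 : Real.pi / 2 < θ := by
    by_contra! h
    have := Real.cos_nonneg_of_neg_pi_div_two_le_of_le
      (by linarith [Real.arccos_nonneg (-ε), Real.pi_pos]) h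
    linarith
  have hθ2 : θ < Real.pi := by
    refine lt_of_le_of_ne (Real.arccos_le_pi _) fun h => ?_
    rw [h, Real.cos_pi] at hcosθ
    linarith
  have hres : ∀ l, InSector θ l →
      HasResolvent G (δ - l) ((2 * K * (2 + ρ) + 6 * M) * (1 + ‖l‖)⁻¹) := by
    intro l hl
    have hlre := hl.cos_mul_norm_le_re hθ2.le
    rw [hcosθ] at hlre
    set z : ℂ := δ - l with hz
    have hnδ : ‖(δ : ℂ)‖ = δ := by rw [Complex.norm_real, Real.norm_of_nonneg hδ0.le]
    have hlz : ‖l‖ ≤ ‖z‖ + δ := by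
      have e : l = δ - z := by rw [hz]; ring
      have h1 := norm_sub_le (δ : ℂ) z
      rw [hnδ] at h1
      rw [e]
      linarith
    have hzre : z.re ≤ δ + ε * (‖z‖ + δ) := by
      have h1 : z.re = δ - l.re := by rw [hz]; simp
      have h2 : ε * ‖l‖ ≤ ε * (‖z‖ + δ) := by gcongr
      linarith
    rw [← div_eq_mul_inv]
    have hl1 : 0 < 1 + ‖l‖ := by positivity
    rcases le_total ‖z‖ ρ with h | h
    · refine (hsmall z ?_ h).mono ?_
      · have : ε * (‖z‖ + δ) ≤ ε * (ρ + 1) := by gcongr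
        linarith
      · rw [le_div_iff₀ hl1]
        have h1 : 1 + ‖l‖ ≤ 2 + ρ := by linarith
        have h2 : 2 * K * (1 + ‖l‖) ≤ 2 * K * (2 + ρ) := by gcongr
        linarith
    · have hz1 : 1 ≤ ‖z‖ := hρ1.trans h
      refine (hlarge z h ?_).mono ?_
      · have h1 : ε * (‖z‖ + δ) ≤ c / 4 * (‖z‖ + ‖z‖) := by gcongr; linarith
        have h2 : c / 4 * 1 ≤ c / 4 * ‖z‖ := by gcongr
        have h3 : 0 ≤ c * ‖z‖ := by positivity
        linarith
      · rw [div_le_div_iff₀ (by linarith) hl1]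
        have h1 : 2 * M * (1 + ‖l‖) ≤ 2 * M * (3 * ‖z‖) := by gcongr; linarith
        have h2 : 0 ≤ 2 * K * (2 + ρ) * ‖z‖ := by positivity
        linarith
  refine ⟨δ, θ, 2 * K * (2 + ρ) + 6 * M, hδ0, ⟨hθ1, hθ2, by positivity, fun l hl => ?_,
    fun l hl => ?_, fun l m hl hm => ?_⟩, fun u v => ?_⟩
  · rw [norm_neg]; exact (hres l hl).isResolvent.2
  · have h1 := (hres l hl).hasDerivAt
    exact (h1.differentiableAt.comp l (by fun_prop : DifferentiableAt ℂ (fun l : ℂ => δ - l) l)).neg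
  · have h1 := (hres l hl).isResolvent.1.sub_eq (hres m hm).isResolvent.1
    rw [neg_mul_neg, ← neg_sub', h1, ← neg_smul]
    congr 1; ring
  · have hP := (hres 1 (inSector_one (by linarith [Real.pi_pos]))).isResolvent.1
    set P := graphRes G (δ - 1)
    have e : ∀ x : Z, (-P) x = P (-x) := fun x => by rw [neg_apply, map_neg]
    have e2 : -(v - (δ : ℂ) • u + u) = ((δ : ℂ) - 1) • u - v := by rw [sub_smul, one_smul]; abel
    rw [e, e2]
    refine ⟨hP.apply u v, fun h => ?_⟩
    have := hP.mem (((δ : ℂ) - 1) • u - v)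
    rwa [h, sub_sub_cancel] at this

end GraphResolvent

/-! ### Complexification, and generation of a decaying semigroup on a real Hilbert space -/

section RealSemigroup

variable {Z : Type*} [NormedAddCommGroup Z] [NormedSpace ℂ Z] [CompleteSpace Z]

theorem tendsto_exp_neg_mul_nhdsGT_zero (δ : ℝ) :
    Tendsto (fun t : ℝ => Real.exp (-(δ * t))) (𝓝[>] 0) (𝓝 1) := by
  have hc : Continuous fun t : ℝ => Real.exp (-(δ * t)) := by fun_prop
  have := hc.tendsto 0
  simp only [mul_zero, neg_zero, Real.exp_zero] at this
  exact this.mono_left nhdsWithin_le_nhds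

theorem tendsto_inv_mul_exp_neg_mul_sub_one (δ : ℝ) :
    Tendsto (fun t : ℝ => t⁻¹ * (Real.exp (-(δ * t)) - 1)) (𝓝[>] 0) (𝓝 (-δ)) := by
  have h1 : HasDerivAt (fun t : ℝ => Real.exp (-(δ * t))) (-δ) 0 := by
    have := ((hasDerivAt_id (0 : ℝ)).const_mul δ).neg.exp
    simpa using this
  have := h1.tendsto_slope_zero_right
  simpa using this

/-- Shifting the generator by `δ` multiplies the semigroup by `e^{-δt}`. -/
theorem SectorialResolvent.exists_isSemigroupWithGraph {R : ℂ → Z →L[ℂ] Z} {θ C δ : ℝ}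
    (h : SectorialResolvent R θ C) {G : Set (Z × Z)}
    (hG : ∀ u v, (u, v) ∈ G ↔ R 1 (v - (δ : ℂ) • u + u) = u)
    (hd : Dense {u | ∃ v, (u, v) ∈ G}) :
    ∃ (S : ℝ → Z →L[ℝ] Z) (M : ℝ), IsSemigroupWithGraph G S ∧ ContinuousOn S (Ioi 0) ∧
      ∀ t, 0 < t → ‖S t‖ ≤ M * Real.exp (-(δ * t)) := by
  have hdr : DenseRange (R 1) := hd.mono (by
    rintro u ⟨v, huv⟩
    exact ⟨_, (hG u v).1 huv⟩)
  obtain ⟨M, hM⟩ := h.exists_bound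
  set T : ℝ → Z →L[ℝ] Z := fun t => (holSemigroup R θ t).restrictScalars ℝ with hT
  set S : ℝ → Z →L[ℝ] Z := fun t => if t ≤ 0 then 1 else Real.exp (-(δ * t)) • T t with hS
  have hSt : ∀ t, 0 < t → S t = Real.exp (-(δ * t)) • T t := fun t ht => if_neg ht.not_ge
  have hS0 : S 0 = 1 := if_pos le_rfl
  have hTadd : ∀ s t, 0 < s → 0 < t → T (s + t) = T s * T t := fun s t hs ht => by
    simp only [hT]
    rw [h.semigroup_add hdr hs ht]
    rfl
  have hTl : ∀ u, Tendsto (fun t => T t u) (𝓝[>] 0) (𝓝 u) := h.tendsto_semigroup hdr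
  refine ⟨S, M, ⟨hS0, fun s t hs ht => ?_, fun u => ?_, fun u v => ?_⟩, ?_, fun t ht => ?_⟩
  · rcases hs.eq_or_lt with rfl | hs
    · rw [zero_add, hS0, one_mul]
    rcases ht.eq_or_lt with rfl | ht
    · rw [add_zero, hS0, mul_one]
    rw [hSt _ (add_pos hs ht), hSt _ hs, hSt _ ht, hTadd s t hs ht, smul_mul_smul_comm,
      ← Real.exp_add]
    congr 2; ring
  · have := (tendsto_exp_neg_mul_nhdsGT_zero δ).smul (hTl u)
    rw [one_smul] at this
    refine this.congr' ?_
    filter_upwards [self_mem_nhdsWithin] with t ht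
    rw [hSt t ht]; rfl
  · have hdecomp : ∀ t : ℝ, 0 < t → t⁻¹ • (S t u - u) = Real.exp (-(δ * t)) •
        (t⁻¹ • (T t u - u)) + (t⁻¹ * (Real.exp (-(δ * t)) - 1)) • u := fun t ht => by
      rw [hSt t ht, smul_apply]
      module
    have ha := (tendsto_inv_mul_exp_neg_mul_sub_one δ).smul_const u
    rw [hG, h.tendsto_diff_quotient_iff hdr]
    have hδ : (δ : ℂ) • u = δ • u := Complex.coe_smul δ u
    rw [hδ]
    constructor
    · intro hl
      have h1 := ((tendsto_exp_neg_mul_nhdsGT_zero δ).smul hl).add ha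
      have e : (1 : ℝ) • -(v - δ • u) + -δ • u = -v := by module
      rw [e] at h1
      refine h1.congr' ?_
      filter_upwards [self_mem_nhdsWithin] with t ht
      exact (hdecomp t ht).symm
    · intro hl
      have h1 := (tendsto_exp_neg_mul_nhdsGT_zero (-δ)).smul (hl.sub ha)
      have e : (1 : ℝ) • (-v - -δ • u) = -(v - δ • u) := by module
      rw [e] at h1
      refine h1.congr' ?_
      filter_upwards [self_mem_nhdsWithin] with t ht
      rw [hdecomp t ht, add_sub_cancel_right, smul_smul, ← Real.exp_add]
      simp [hT]
  · have h1 : ContinuousOn (fun t => Real.exp (-(δ * t)) • T t) (Ioi 0) := by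
      have h3 : Continuous fun t : ℝ => Real.exp (-(δ * t)) := by fun_prop
      refine h3.continuousOn.smul fun t ht => ?_
      have h2 := (h.hasDerivAt ht).continuousAt
      exact ((ContinuousLinearMap.restrictScalarsL ℂ Z Z ℝ ℝ).continuous.continuousAt.comp
        h2).continuousWithinAt
    exact h1.congr fun t ht => hSt t ht
  · rw [hSt t ht, norm_smul, Real.norm_of_nonneg (Real.exp_pos _).le, mul_comm]
    refine mul_le_mul_of_nonneg_right ?_ (Real.exp_pos _).le
    rw [hT, ContinuousLinearMap.norm_restrictScalars]
    exact hM t ht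

end RealSemigroup

section Complexification

/-- The complexification of a real Hilbert space `X`, i.e. `X × X` with its Hilbert norm, the pair
`(x, y)` standing for `x + i y`. -/
def Cplx (X : Type*) : Type _ := WithLp 2 (X × X)

namespace Cplx

variable {X : Type*}

/-- `x + i y`. -/
def mk (x y : X) : Cplx X := WithLp.toLp 2 (x, y)

/-- The real part. -/
def re (w : Cplx X) : X := WithLp.fst w

/-- The imaginary part. -/
def im (w : Cplx X) : X := WithLp.snd w

@[simp] theorem re_mk (x y : X) : (mk x y).re = x := rfl
@[simp] theorem im_mk (x y : X) : (mk x y).im = y := rfl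
theorem ext' {u w : Cplx X} (h1 : u.re = w.re) (h2 : u.im = w.im) : u = w :=
  WithLp.ofLp_injective 2 (Prod.ext h1 h2)

variable [NormedAddCommGroup X]

instance : NormedAddCommGroup (Cplx X) := inferInstanceAs (NormedAddCommGroup (WithLp 2 (X × X)))

instance [CompleteSpace X] : CompleteSpace (Cplx X) :=
  inferInstanceAs (CompleteSpace (WithLp 2 (X × X)))

@[simp] theorem re_add (u w : Cplx X) : (u + w).re = u.re + w.re := rfl
@[simp] theorem im_add (u w : Cplx X) : (u + w).im = u.im + w.im := rfl
@[simp] theorem re_sub (u w : Cplx X) : (u - w).re = u.re - w.re := rfl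
@[simp] theorem im_sub (u w : Cplx X) : (u - w).im = u.im - w.im := rfl
@[simp] theorem re_neg (w : Cplx X) : (-w).re = -w.re := rfl
@[simp] theorem im_neg (w : Cplx X) : (-w).im = -w.im := rfl
@[simp] theorem re_zero : (0 : Cplx X).re = 0 := rfl
@[simp] theorem im_zero : (0 : Cplx X).im = 0 := rfl

theorem norm_eq (w : Cplx X) : ‖w‖ = complexNorm (w.re, w.im) :=
  WithLp.prod_norm_eq_of_L2 w

theorem norm_re_le (w : Cplx X) : ‖w.re‖ ≤ ‖w‖ := by
  rw [norm_eq, complexNorm]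
  exact Real.le_sqrt_of_sq_le (by simp)

theorem norm_mk_zero (x : X) : ‖mk x 0‖ = ‖x‖ := by
  rw [norm_eq, complexNorm]
  simp

variable [InnerProductSpace ℝ X]

instance : SMul ℂ (Cplx X) :=
  ⟨fun z w => mk (z.re • w.re - z.im • w.im) (z.im • w.re + z.re • w.im)⟩

@[simp] theorem re_smul (z : ℂ) (w : Cplx X) : (z • w).re = z.re • w.re - z.im • w.im := rfl
@[simp] theorem im_smul (z : ℂ) (w : Cplx X) : (z • w).im = z.im • w.re + z.re • w.im := rfl

instance : Module ℂ (Cplx X) where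
  one_smul w := ext' (by simp) (by simp)
  mul_smul z z' w := ext' (by simp; module) (by simp; module)
  smul_zero z := ext' (by simp) (by simp)
  smul_add z u w := ext' (by simp; module) (by simp; module)
  add_smul z z' w := ext' (by simp; module) (by simp; module)
  zero_smul w := ext' (by simp) (by simp)

theorem norm_smul_eq (z : ℂ) (w : Cplx X) : ‖z • w‖ = ‖z‖ * ‖w‖ := by
  rw [norm_eq, norm_eq, complexNorm, complexNorm, Complex.norm_def,
    ← Real.sqrt_mul (Complex.normSq_nonneg z)]
  congr 1
  simp only [re_smul, im_smul]
  rw [norm_sub_sq_real, norm_add_sq_real, norm_smul, norm_smul, norm_smul, norm_smul,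
    inner_smul_left, inner_smul_right, inner_smul_left, inner_smul_right, Complex.normSq_apply]
  simp only [Real.norm_eq_abs, mul_pow, sq_abs, conj_trivial]
  ring

instance : NormedSpace ℂ (Cplx X) where
  norm_smul_le z w := (norm_smul_eq z w).le

@[simp] theorem re_real_smul (r : ℝ) (w : Cplx X) : (r • w).re = r • w.re := by
  rw [← Complex.coe_smul, re_smul]; simp

@[simp] theorem im_real_smul (r : ℝ) (w : Cplx X) : (r • w).im = r • w.im := by
  rw [← Complex.coe_smul, im_smul]; simp

/-- The real part as a continuous linear map. -/
def reL : Cplx X →L[ℝ] X :=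
  LinearMap.mkContinuous ⟨⟨re, re_add⟩, re_real_smul⟩ 1 fun w => by
    rw [one_mul]; exact norm_re_le w

/-- The inclusion of `X` as a continuous linear map. -/
def inclL : X →L[ℝ] Cplx X :=
  LinearMap.mkContinuous ⟨⟨fun x => mk x 0, fun _ _ => ext' (by simp) (by simp)⟩,
    fun _ _ => ext' (by simp) (by simp)⟩ 1 fun x => by
      rw [one_mul]; exact (norm_mk_zero x).le

/-- Complex conjugation. -/
def conjL : Cplx X →L[ℝ] Cplx X :=
  LinearMap.mkContinuous ⟨⟨fun w => mk w.re (-w.im), fun _ _ => ext' (by simp) (by simp; abel)⟩,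
    fun _ _ => ext' (by simp) (by simp)⟩ 1 fun w => by
      rw [one_mul, norm_eq, norm_eq, complexNorm, complexNorm]
      simp

@[simp] theorem reL_apply (w : Cplx X) : reL w = w.re := rfl
@[simp] theorem inclL_apply (x : X) : inclL x = mk x 0 := rfl
@[simp] theorem re_conjL (w : Cplx X) : (conjL w).re = w.re := rfl
@[simp] theorem im_conjL (w : Cplx X) : (conjL w).im = -w.im := rfl

theorem conjL_conjL (w : Cplx X) : conjL (conjL w) = w := ext' (by simp) (by simp)

theorem conjL_mul_self : (conjL : Cplx X →L[ℝ] Cplx X) * conjL = 1 :=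
  ContinuousLinearMap.ext conjL_conjL

theorem inclL_re_of_conjL_eq {w : Cplx X} (h : conjL w = w) : inclL w.re = w := by
  refine ext' rfl ?_
  have h1 := congrArg im h
  rw [im_conjL, neg_eq_iff_add_eq_zero, ← two_smul ℝ, smul_eq_zero] at h1
  exact (h1.resolve_left two_ne_zero).symm

/-- The graph of the complexification of `A`. -/
def graph (A : X →ₗ.[ℝ] X) : Submodule ℂ (Cplx X × Cplx X) where
  carrier := {p | (p.1.re, p.2.re) ∈ A.graph ∧ (p.1.im, p.2.im) ∈ A.graph}
  add_mem' h h' := ⟨A.graph.add_mem h.1 h'.1, A.graph.add_mem h.2 h'.2⟩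
  zero_mem' := ⟨A.graph.zero_mem, A.graph.zero_mem⟩
  smul_mem' z _ h := ⟨A.graph.sub_mem (A.graph.smul_mem z.re h.1) (A.graph.smul_mem z.im h.2),
    A.graph.add_mem (A.graph.smul_mem z.im h.1) (A.graph.smul_mem z.re h.2)⟩

theorem mem_graph {A : X →ₗ.[ℝ] X} {u v : Cplx X} : (u, v) ∈ graph A ↔
    (u.re, v.re) ∈ A.graph ∧ (u.im, v.im) ∈ A.graph := Iff.rfl

theorem hasResolvent_of_resolventBound {A : X →ₗ.[ℝ] X} {z : ℂ} {K : ℝ}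
    (h : ResolventBound A z K) : HasResolvent (graph A) z (max K 0) := by
  refine hasResolvent_of_bijective (fun w => ?_) fun u v huv => ?_
  · obtain ⟨d, hd⟩ := h.1.2 (w.re, w.im)
    have h1 := congrArg Prod.fst hd
    have h2 := congrArg Prod.snd hd
    simp only [complexShift] at h1 h2
    refine ⟨mk d.1 d.2, ?_⟩
    rw [mem_graph]
    simp only [re_mk, im_mk, re_sub, im_sub, re_smul, im_smul]
    rw [← h1, ← h2, sub_sub_cancel, sub_sub_cancel]
    exact ⟨A.mem_graph d.1, A.mem_graph d.2⟩
  · obtain ⟨hre, him⟩ := mem_graph.1 huv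
    obtain ⟨x, hx1, hx2⟩ := (LinearPMap.mem_graph_iff A).1 hre
    obtain ⟨y, hy1, hy2⟩ := (LinearPMap.mem_graph_iff A).1 him
    have := h.2 (x, y)
    simp only [complexShift] at hx1 hx2 hy1 hy2 this
    rw [hx1, hy1, hx2, hy2] at this
    rw [norm_eq, norm_eq]
    exact this

theorem dense_graph_domain {A : X →ₗ.[ℝ] X} (hA : Dense (A.domain : Set X)) :
    Dense {u | ∃ v, (u, v) ∈ graph A} := by
  have hc : Continuous fun p : X × X => mk p.1 p.2 := by
    have : (fun p : X × X => mk p.1 p.2) =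
        fun p : X × X => inclL p.1 + Complex.I • inclL p.2 := by
      funext p
      exact ext' (by simp) (by simp)
    rw [this]
    exact (inclL.continuous.comp continuous_fst).add
      ((inclL.continuous.comp continuous_snd).const_smul Complex.I)
  have hs : Function.Surjective fun p : X × X => mk p.1 p.2 := fun w => ⟨(w.re, w.im), rfl⟩
  refine (hs.denseRange.dense_image hc (hA.prod hA)).mono ?_
  rintro _ ⟨⟨x, y⟩, ⟨hx, hy⟩, rfl⟩
  exact ⟨mk (A ⟨x, hx⟩) (A ⟨y, hy⟩), A.mem_graph ⟨x, hx⟩, A.mem_graph ⟨y, hy⟩⟩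

/-- A semigroup generated by the complexification of an operator on `X` commutes with conjugation:
conjugating it gives a semigroup with the same generator. -/
theorem conjL_mul_semigroup [CompleteSpace X] {A : X →ₗ.[ℝ] X} (hA : Dense (A.domain : Set X))
    {S : ℝ → Cplx X →L[ℝ] Cplx X}
    (h : IsSemigroupWithGraph (graph A : Set (Cplx X × Cplx X)) S) {t : ℝ} (ht : 0 ≤ t) :
    conjL * S t = S t * conjL := by
  have h' : IsSemigroupWithGraph (graph A : Set (Cplx X × Cplx X))
      fun t => conjL * S t * conjL := by
    refine ⟨by rw [h.zero, mul_one, conjL_mul_self], fun s t hs ht => ?_, fun u => ?_,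
      fun u v => ?_⟩
    · rw [h.add s t hs ht]
      calc conjL * (S s * S t) * conjL = conjL * S s * 1 * S t * conjL := by
            rw [mul_one]; simp only [mul_assoc]
        _ = _ := by rw [← conjL_mul_self]; simp only [mul_assoc]
    · have := (conjL.continuous.tendsto _).comp (h.tendsto (conjL u))
      rw [conjL_conjL] at this
      exact this
    · have h1 : (u, v) ∈ (graph A : Set (Cplx X × Cplx X)) ↔
          (conjL u, conjL v) ∈ (graph A : Set (Cplx X × Cplx X)) := by
        simp only [SetLike.mem_coe, mem_graph, re_conjL, im_conjL]
        rw [← Prod.neg_mk, neg_mem_iff]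
      rw [h1, h.generator]
      constructor
      · intro hl
        have := (conjL.continuous.tendsto _).comp hl
        rw [map_neg, conjL_conjL] at this
        refine this.congr fun t => ?_
        simp [conjL_conjL]
      · intro hl
        have := (conjL.continuous.tendsto _).comp hl
        rw [map_neg] at this
        refine this.congr fun t => ?_
        simp [conjL_conjL]
  have h1 := h.eq_of_graph h' (dense_graph_domain hA) ht
  calc conjL * S t = conjL * S t * (conjL * conjL) := by rw [conjL_mul_self, mul_one]
    _ = (conjL * S t * conjL) * conjL := by simp only [mul_assoc]
    _ = _ := by rw [← h1]

end Cplx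

end Complexification

section Generation

variable {X : Type*} [NormedAddCommGroup X] [InnerProductSpace ℝ X] [CompleteSpace X]

open Cplx in
/-- The negative of a sectorial operator with spectrum in `Re z > 0` generates a strongly continuous
semigroup that is norm continuous on `t > 0` and decays exponentially. -/
theorem IsSectorial.exists_isSemigroupOf {A : X →ₗ.[ℝ] X} (hA : IsSectorial A)
    (hspec : ∀ z ∈ spectrumC A, 0 < z.re) :
    ∃ (S : ℝ → X →L[ℝ] X) (M δ : ℝ), 0 < δ ∧ IsSemigroupOf A S ∧ ContinuousOn S (Ioi 0) ∧
      ∀ t, 0 < t → ‖S t‖ ≤ M * Real.exp (-(δ * t)) := by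
  obtain ⟨-, hdense, φ, M, b, hφ0, hφ, hM, hsec⟩ := hA
  obtain ⟨δ, θ, C, hδ, hR, hRG⟩ := exists_sectorialResolvent (G := graph A) hφ0 hφ hM
    (fun z hz hz' => by
      have := hasResolvent_of_resolventBound (hsec z hz hz')
      rwa [max_eq_left (by positivity)] at this)
    (fun z hz => by
      by_contra hcon
      refine (hspec z fun ⟨K, hK⟩ => hcon ⟨_, hasResolvent_of_resolventBound hK⟩).not_ge hz)
  obtain ⟨S, M', hS, hc, hb⟩ := hR.exists_isSemigroupWithGraph
    (G := (graph A : Set (Cplx X × Cplx X))) hRG (dense_graph_domain hdense)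
  have hreal : ∀ t, 0 ≤ t → ∀ x, inclL (S t (inclL x)).re = S t (inclL x) := fun t ht x => by
    refine inclL_re_of_conjL_eq ?_
    have h1 := congrArg (fun P => P (inclL x)) (conjL_mul_semigroup hdense hS ht)
    simp only [mul_apply_eq_comp] at h1
    rw [h1]
    congr 1
    exact ext' (by simp) (by simp)
  refine ⟨fun t => reL.comp ((S t).comp inclL), M', δ, hδ, ⟨?_, fun s t hs ht => ?_, fun u => ?_,
    fun u v => ?_⟩, ?_, fun t ht => ?_⟩
  · ext x
    rw [hS.zero]
    rfl
  · ext x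
    simp only [ContinuousLinearMap.comp_apply, reL_apply]
    rw [hreal t ht, hS.add_apply hs ht]
  · exact (reL.continuous.tendsto _).comp (hS.tendsto (inclL u))
  · have h1 : (u, v) ∈ A.graph ↔ (inclL u, inclL v) ∈ (graph A : Set (Cplx X × Cplx X)) := by
      simp only [SetLike.mem_coe, mem_graph, inclL_apply, re_mk, im_mk]
      exact ⟨fun h => ⟨h, A.graph.zero_mem⟩, fun h => h.1⟩
    rw [h1, hS.generator]
    constructor
    · intro hl
      have := (reL.continuous.tendsto _).comp hl
      rw [map_neg] at this
      refine this.congr fun t => ?_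
      simp
    · intro hl
      have := (inclL.continuous.tendsto _).comp hl
      rw [map_neg] at this
      refine this.congr' ?_
      filter_upwards [self_mem_nhdsWithin] with t ht
      have h2 := hreal t (le_of_lt ht) u
      simp only [Function.comp, ContinuousLinearMap.comp_apply, map_smul, map_sub]
      rw [reL_apply, h2]
  · exact (continuousOn_const.clm_comp (hc.clm_comp continuousOn_const))
  · refine ContinuousLinearMap.opNorm_le_bound _ ((norm_nonneg _).trans (hb t ht)) fun x => ?_
    refine (norm_re_le _).trans ?_
    have := (S t).le_of_opNorm_le (hb t ht) (inclL x)
    rwa [inclL_apply, norm_mk_zero] at this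

/-- The semigroup `e^{-At}` decays exponentially. -/
theorem IsSectorial.exists_isDecayingSemigroup {A : X →ₗ.[ℝ] X} (hA : IsSectorial A)
    (hspec : ∀ z ∈ spectrumC A, 0 < z.re) :
    ∃ M δ, IsDecayingSemigroup (semigroupOf A) M δ := by
  obtain ⟨S, M, δ, hδ, hS, hc, hb⟩ := hA.exists_isSemigroupOf hspec
  have hex : ∃ S : ℝ → X →L[ℝ] X, IsSemigroupOf A S := ⟨S, hS⟩
  have hsg : IsSemigroupOf A (semigroupOf A) := by
    rw [semigroupOf, dif_pos hex]
    exact hex.choose_spec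
  have hd : Dense {u | ∃ v, (u, v) ∈ (A.graph : Set (X × X))} := by
    refine hA.2.1.mono fun u hu => ⟨A ⟨u, hu⟩, A.mem_graph ⟨u, hu⟩⟩
  have heq : ∀ t, 0 ≤ t → semigroupOf A t = S t := fun t ht =>
    hsg.isSemigroupWithGraph.eq_of_graph hS.isSemigroupWithGraph hd ht
  refine ⟨M, δ, ?_, fun s t hs ht => hsg.add s t hs.le ht.le, hδ, fun t ht => ?_⟩
  · refine (hc.aestronglyMeasurable measurableSet_Ioi).congr ?_
    filter_upwards [ae_restrict_mem measurableSet_Ioi] with t ht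
    exact (heq t (le_of_lt ht)).symm
  · rw [heq t ht.le]
    exact hb t ht

end Generation

/-! ### Embeddings of the fractional power spaces into weighted Lebesgue spaces -/

section WeightedEmbedding

variable {α : Type*} [MeasurableSpace α] {μ : Measure α}

/-- The graph of multiplication by `m`, as an operator from `L²` to `L^p` on its natural
domain. -/
def mulGraph (μ : Measure α) (m : α → ℝ) (p : ℝ≥0∞) [Fact (1 ≤ p)] :
    Submodule ℝ (Lp ℝ 2 μ × Lp ℝ p μ) where
  carrier := {z | z.2 =ᵐ[μ] fun x => m x * z.1 x}
  add_mem' {y z} hy hz := by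
    simp only [mem_ofPred_eq, Prod.snd_add, Prod.fst_add] at *
    filter_upwards [hy, hz, Lp.coeFn_add y.1 z.1, Lp.coeFn_add y.2 z.2] with x h1 h2 h3 h4
    rw [h3, h4, Pi.add_apply, Pi.add_apply, h1, h2, mul_add]
  zero_mem' := by
    simp only [mem_ofPred_eq, Prod.snd_zero, Prod.fst_zero]
    filter_upwards [Lp.coeFn_zero ℝ 2 μ, Lp.coeFn_zero ℝ p μ] with x h1 h2
    rw [h1, h2]; simp
  smul_mem' c z hz := by
    simp only [mem_ofPred_eq, Prod.smul_snd, Prod.smul_fst] at *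
    filter_upwards [hz, Lp.coeFn_smul c z.1, Lp.coeFn_smul c z.2] with x h1 h2 h3
    rw [h2, h3, Pi.smul_apply, Pi.smul_apply, h1, smul_eq_mul, smul_eq_mul, mul_left_comm]

theorem Lp_exists_subseq_tendsto_ae {E : Type*} [NormedAddCommGroup E] {p : ℝ≥0∞} [Fact (1 ≤ p)]
    {f : ℕ → Lp E p μ} {g : Lp E p μ} (h : Tendsto f atTop (𝓝 g)) :
    ∃ ns : ℕ → ℕ, StrictMono ns ∧ ∀ᵐ x ∂μ, Tendsto (fun i => f (ns i) x) atTop (𝓝 (g x)) :=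
  (tendstoInMeasure_of_tendsto_Lp h).exists_seq_tendsto_ae

theorem isClosed_mulGraph (m : α → ℝ) (p : ℝ≥0∞) [Fact (1 ≤ p)] :
    IsClosed (mulGraph μ m p : Set (Lp ℝ 2 μ × Lp ℝ p μ)) := by
  refine IsSeqClosed.isClosed fun z w hz hw => ?_
  obtain ⟨ns, hns, h1⟩ := Lp_exists_subseq_tendsto_ae ((continuous_fst.tendsto w).comp hw)
  obtain ⟨ms, hms, h2⟩ := Lp_exists_subseq_tendsto_ae
    (((continuous_snd.tendsto w).comp hw).comp hns.tendsto_atTop)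
  have h3 : ∀ᵐ x ∂μ, ∀ n, (z n).2 x = m x * (z n).1 x := ae_all_iff.2 hz
  change w.2 =ᵐ[μ] fun x => m x * w.1 x
  filter_upwards [h1, h2, h3] with x h1 h2 h3
  refine tendsto_nhds_unique h2 ?_
  have := ((h1.comp hms.tendsto_atTop).const_mul (m x))
  refine this.congr fun n => ?_
  exact (h3 _).symm

/-- If multiplication by `m` maps the range of `A^{-1/2}` to `L^p` with an interpolation
inequality of exponent `θ`, then it maps the range of `A^{-α}` to `L^p`, boundedly,
as soon as `θ / 2 < α`. -/
theorem IsDecayingSemigroup.exists_mul_fracPow_bound {S : ℝ → Lp ℝ 2 μ →L[ℝ] Lp ℝ 2 μ} {M δ : ℝ}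
    (h : IsDecayingSemigroup S M δ) {m : α → ℝ} (hm : AEStronglyMeasurable m μ) {p : ℝ≥0∞}
    [Fact (1 ≤ p)] {C θ β : ℝ} (hθ : 0 ≤ θ) (hθ1 : θ < 1) (hC : 0 ≤ C) {C' : ℝ} (hC' : 0 ≤ C')
    (hle : ∀ y, ‖fracPow S (1 / 2) y‖ ≤ C' * ‖y‖)
    (hb : ∀ y, eLpNorm (fun x => m x * fracPow S (1 / 2) y x) p μ ≤
      ENNReal.ofReal (C * ‖fracPow S (1 / 2) y‖ ^ (1 - θ) * ‖y‖ ^ θ))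
    (hβ : θ / 2 < β) (hβ1 : β < 1 / 2) :
    ∃ K : ℝ, 0 ≤ K ∧ ∀ y, eLpNorm (fun x => m x * fracPow S β y x) p μ ≤
      ENNReal.ofReal (K * ‖y‖) := by
  set H := fracPow S (1 / 2) with hH
  have hmem : ∀ y, MemLp (fun x => m x * H y x) p μ := fun y =>
    ⟨hm.mul (Lp.aestronglyMeasurable _), (hb y).trans_lt ENNReal.ofReal_lt_top⟩
  have : CompleteSpace (mulGraph μ m p) := (isClosed_mulGraph m p).completeSpace_coe
  let J : mulGraph μ m p →L[ℝ] Lp ℝ 2 μ :=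
    (ContinuousLinearMap.fst ℝ _ _).comp (mulGraph μ m p).subtypeL
  let G0 : Lp ℝ 2 μ → mulGraph μ m p := fun y => ⟨(H y, (hmem y).toLp), (hmem y).coeFn_toLp⟩
  have hinj : ∀ z w : mulGraph μ m p, z.1.1 = w.1.1 → z = w := by
    rintro ⟨⟨z1, z2⟩, hz⟩ ⟨⟨w1, w2⟩, hw⟩ (rfl : z1 = w1)
    refine Subtype.ext (Prod.ext rfl (Lp.ext ?_))
    exact EventuallyEq.trans hz (EventuallyEq.symm hw)
  let G1 : Lp ℝ 2 μ →ₗ[ℝ] mulGraph μ m p :=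
    { toFun := G0
      map_add' := fun x y => hinj _ _ (by simp [G0])
      map_smul' := fun c x => hinj _ _ (by simp [G0]) }
  have hbound : ∀ y, ‖G1 y‖ ≤ (C + C' ^ θ) * ‖H y‖ ^ (1 - θ) * ‖y‖ ^ θ := by
    intro y
    change max ‖H y‖ ‖(hmem y).toLp‖ ≤ _
    have h0 : 0 ≤ ‖H y‖ ^ (1 - θ) * ‖y‖ ^ θ := by positivity
    have h2 : 0 ≤ C' ^ θ := by positivity
    refine max_le ?_ ?_
    · calc ‖H y‖ ≤ C' ^ θ * ‖H y‖ ^ (1 - θ) * ‖y‖ ^ θ := by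
            rcases (norm_nonneg (H y)).eq_or_lt with h0 | h0
            · rw [← h0]; positivity
            calc ‖H y‖ = ‖H y‖ ^ (1 - θ) * ‖H y‖ ^ θ := by rw [← Real.rpow_add h0]; simp
              _ ≤ ‖H y‖ ^ (1 - θ) * (C' * ‖y‖) ^ θ := by gcongr; exact hle y
              _ = _ := by rw [Real.mul_rpow hC' (norm_nonneg _)]; ring
        _ ≤ _ := by nlinarith
    · rw [Lp.norm_toLp]
      calc _ ≤ C * ‖H y‖ ^ (1 - θ) * ‖y‖ ^ θ := ENNReal.toReal_le_of_le_ofReal (by positivity) (hb y)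
        _ ≤ _ := by nlinarith
  let G : Lp ℝ 2 μ →L[ℝ] mulGraph μ m p := G1.mkContinuous ((C + C' ^ θ) * C' ^ (1 - θ)) (by
    intro y
    refine (hbound y).trans ?_
    have hy : ‖y‖ = ‖y‖ ^ (1 - θ) * ‖y‖ ^ θ := by
      rcases (norm_nonneg y).eq_or_lt with h0 | h0
      · rw [← h0, Real.zero_rpow (x := 1 - θ) (by linarith), zero_mul]
      · rw [← Real.rpow_add h0]; simp
    calc (C + C' ^ θ) * ‖H y‖ ^ (1 - θ) * ‖y‖ ^ θ
        ≤ (C + C' ^ θ) * (C' * ‖y‖) ^ (1 - θ) * ‖y‖ ^ θ := by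
          gcongr
          exact hle y
      _ = (C + C' ^ θ) * C' ^ (1 - θ) * (‖y‖ ^ (1 - θ) * ‖y‖ ^ θ) := by
          rw [Real.mul_rpow hC' (norm_nonneg _)]; ring
      _ = _ := by rw [← hy])
  obtain ⟨L, hL⟩ := h.exists_lift_fracPow J G (by ext1 y; rfl) hθ hθ1 hbound hβ hβ1
  refine ⟨‖L‖, norm_nonneg _, fun y => ?_⟩
  have h1 : (L y).1.1 = fracPow S β y := by rw [← hL]; rfl
  have h2 : (fun x => m x * fracPow S β y x) =ᵐ[μ] (L y).1.2 := by
    rw [← h1]; exact EventuallyEq.symm (L y).2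
  rw [eLpNorm_congr_ae h2, ← ENNReal.ofReal_toReal (Lp.eLpNorm_ne_top (L y).1.2), ← Lp.norm_def]
  exact ENNReal.ofReal_le_ofReal ((le_max_right _ _).trans (L.le_opNorm y))

end WeightedEmbedding

section Lebesgue

variable {α : Type*} [MeasurableSpace α] {μ : Measure α}

/-- Interpolation between `L²` and `L⁶`. -/
theorem eLpNorm_le_interpolate_two_six {u : α → ℝ} (hu : AEStronglyMeasurable u μ) {p : ℝ}
    (hp : 2 ≤ p) (hp6 : p ≤ 6) :
    eLpNorm u (ENNReal.ofReal p) μ ≤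
      eLpNorm u 2 μ ^ ((6 - p) / (2 * p)) * eLpNorm u 6 μ ^ (1 - (6 - p) / (2 * p)) := by
  have hp0 : 0 < p := by linarith
  have e1 : ∀ r : ℝ, 0 < r →
      eLpNorm u (ENNReal.ofReal r) μ = (∫⁻ x, ‖u x‖ₑ ^ r ∂μ) ^ (1 / r) := fun r hr => by
    rw [eLpNorm_eq_lintegral_rpow_enorm_toReal (by simpa using hr) ENNReal.ofReal_ne_top,
      ENNReal.toReal_ofReal hr.le]
  have e2 : eLpNorm u 2 μ = (∫⁻ x, ‖u x‖ₑ ^ (2 : ℝ) ∂μ) ^ (1 / (2 : ℝ)) := by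
    rw [← e1 2 (by norm_num)]; simp
  have e6 : eLpNorm u 6 μ = (∫⁻ x, ‖u x‖ₑ ^ (6 : ℝ) ∂μ) ^ (1 / (6 : ℝ)) := by
    rw [← e1 6 (by norm_num)]; simp
  have hm : ∀ r : ℝ, AEMeasurable (fun x => ‖u x‖ₑ ^ r) μ := fun r => hu.enorm.pow_const _
  have key : ∫⁻ x, ‖u x‖ₑ ^ p ∂μ ≤
      (∫⁻ x, ‖u x‖ₑ ^ (2 : ℝ) ∂μ) ^ ((6 - p) / 4) * (∫⁻ x, ‖u x‖ₑ ^ (6 : ℝ) ∂μ) ^ ((p - 2) / 4) := by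
    refine le_of_eq_of_le ?_ (ENNReal.lintegral_mul_norm_pow_le (hm 2) (hm 6) (by linarith)
      (by linarith) (by ring))
    refine lintegral_congr fun x => ?_
    rw [← ENNReal.rpow_mul, ← ENNReal.rpow_mul, ← ENNReal.rpow_add_of_nonneg _ _ (by linarith)
      (by linarith)]
    congr 1; ring
  rw [e1 p hp0, e2, e6, ← ENNReal.rpow_mul, ← ENNReal.rpow_mul]
  refine (ENNReal.rpow_le_rpow key (by positivity)).trans_eq ?_
  rw [ENNReal.mul_rpow_of_nonneg _ _ (by positivity), ← ENNReal.rpow_mul, ← ENNReal.rpow_mul]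
  congr 2
  · field_simp; ring
  · field_simp; ring

end Lebesgue

section Sobolev

variable {Ω : Set E3}

theorem norm_fst_le_of_L2Pair {Ω : Set E3} (w : L2Pair Ω) : ‖w.fst‖ ≤ ‖w‖ := by
  rw [WithLp.prod_norm_eq_of_L2]
  refine Real.le_sqrt_of_sq_le ?_
  nlinarith [sq_nonneg ‖w.snd‖]

theorem norm_snd_le_of_L2Pair {Ω : Set E3} (w : L2Pair Ω) : ‖w.snd‖ ≤ ‖w‖ := by
  rw [WithLp.prod_norm_eq_of_L2]
  refine Real.le_sqrt_of_sq_le ?_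
  nlinarith [sq_nonneg ‖w.fst‖]

/-- Sobolev's inequality for a test function on `Ω`, with both norms taken over `Ω`. -/
theorem eLpNorm_six_le_gradient {φ : E3 → ℝ} (hφ : ContDiff ℝ ∞ φ) (hcs : HasCompactSupport φ)
    (hts : tsupport φ ⊆ Ω) :
    eLpNorm φ 6 (volOn Ω) ≤ SNormLESNormFDerivOfEqConst ℝ (volume : Measure E3) 2 *
      eLpNorm (fun x => gradient φ x) 2 (volOn Ω) := by
  have hsob :=
    eLpNorm_le_eLpNorm_fderiv_of_eq (volume : Measure E3) (u := φ) (p := 2) (p' := 6)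
      (hφ.of_le (by exact_mod_cast le_top)) hcs (by norm_num) (by simp) (by simp; norm_num)
  rw [ENNReal.coe_ofNat, ENNReal.coe_ofNat, NNReal.coe_ofNat] at hsob
  have hsupp : Function.support (fun x => gradient φ x) ⊆ Ω := fun x hx => by
    refine hts (support_fderiv_subset ℝ fun h0 => hx ?_)
    simp only [gradient, h0, map_zero]
  have h1 : eLpNorm (fderiv ℝ φ) 2 volume = eLpNorm (fun x => gradient φ x) 2 volume :=
    eLpNorm_congr_norm_ae (Eventually.of_forall fun x => by rw [gradient]; simp)
  rw [h1, ← eLpNorm_restrict_eq_of_support_subset hsupp] at hsob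
  exact (eLpNorm_mono_measure _ Measure.restrict_le_self).trans hsob

/-- **Sobolev's inequality** `H¹₀(Ω) ⊂ L⁶(Ω)`. -/
theorem exists_sobolev_H10 (Ω : Set E3) :
    ∃ C : ℝ, 0 ≤ C ∧ ∀ w ∈ H10 Ω, eLpNorm w.fst 6 (volOn Ω) ≤ ENNReal.ofReal (C * ‖w‖) := by
  set C : ℝ≥0 := SNormLESNormFDerivOfEqConst ℝ (volume : Measure E3) 2 with hCdef
  have htest : ∀ (w : L2Pair Ω) (φ : E3 → ℝ), ContDiff ℝ ∞ φ → HasCompactSupport φ →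
      tsupport φ ⊆ Ω → w.fst =ᵐ[volOn Ω] φ → (w.snd =ᵐ[volOn Ω] fun x => gradient φ x) →
      eLpNorm w.fst 6 (volOn Ω) ≤ ENNReal.ofReal (C * ‖w‖) := by
    intro w φ hφ hcs hts h1 h2
    rw [eLpNorm_congr_ae h1]
    refine (eLpNorm_six_le_gradient hφ hcs hts).trans ?_
    rw [← eLpNorm_congr_ae h2, ← hCdef]
    have h3 : eLpNorm w.snd 2 (volOn Ω) = ENNReal.ofReal ‖w.snd‖ := by
      rw [Lp.norm_def, ENNReal.ofReal_toReal (Lp.eLpNorm_ne_top _)]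
    rw [h3, ENNReal.ofReal_mul C.coe_nonneg, ENNReal.ofReal_coe_nnreal]
    gcongr
    exact norm_snd_le_of_L2Pair w
  refine ⟨C, C.2, fun w hw => ?_⟩
  obtain ⟨z, hz, hzw⟩ := mem_closure_iff_seq_limit.1 hw
  have hfst : Tendsto (fun n => (z n).fst) atTop (𝓝 w.fst) :=
    ((WithLp.prod_continuous_ofLp 2 _ _).fst.tendsto w).comp hzw
  obtain ⟨ns, hns, hae⟩ := Lp_exists_subseq_tendsto_ae hfst
  have hn : Tendsto (fun i => ENNReal.ofReal (C * ‖z (ns i)‖)) atTop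
      (𝓝 (ENNReal.ofReal (C * ‖w‖))) :=
    ENNReal.tendsto_ofReal ((hzw.comp hns.tendsto_atTop).norm.const_mul _)
  calc eLpNorm w.fst 6 (volOn Ω)
      ≤ liminf (fun i => eLpNorm (z (ns i)).fst 6 (volOn Ω)) atTop :=
        Lp.eLpNorm_lim_le_liminf_eLpNorm (fun i => Lp.aestronglyMeasurable _) _ hae
    _ ≤ liminf (fun i => ENNReal.ofReal (C * ‖z (ns i)‖)) atTop := by
        refine liminf_le_liminf (Eventually.of_forall fun i => ?_)
        obtain ⟨φ, h1, h2, h3, h4, h5⟩ := hz (ns i)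
        exact htest _ φ h1 h2 h3 h4 h5
    _ = _ := hn.liminf_eq

/-- The parameter `ε` in the definition of `𝓔_γ`, optimised. -/
theorem EClass.exists_interpolation {γ : ℝ} {a : E3 → ℝ} (ha : EClass Ω γ a) (hγ1 : γ < 1) :
    ∃ C : ℝ, 0 ≤ C ∧ ∀ w ∈ H10 Ω, eLpNorm (fun x => Real.sqrt |a x| * w.fst x) 2 (volOn Ω) ≤
      ENNReal.ofReal (C * ‖w.fst‖ ^ (1 - γ) * ‖w‖ ^ γ) := by
  obtain ⟨-, ⟨hγ, -, C, hC, h⟩ | ⟨h1, -⟩⟩ := ha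
  swap
  · exact absurd h1 hγ1.ne
  refine ⟨C, hC.le, fun w hw => ?_⟩
  rcases (norm_nonneg w.fst).eq_or_lt with h0 | h0
  · have : w.fst = 0 := norm_eq_zero.1 h0.symm
    have h2 : eLpNorm (fun x => Real.sqrt |a x| * w.fst x) 2 (volOn Ω) = 0 := by
      rw [eLpNorm_congr_ae (g := fun _ => (0 : ℝ)), eLpNorm_zero']
      rw [this]
      filter_upwards [Lp.coeFn_zero ℝ 2 (volOn Ω)] with x hx
      rw [hx]; simp
    rw [h2]; exact zero_le
  have hw0 : 0 < ‖w‖ := h0.trans_le (norm_fst_le_of_L2Pair w)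
  set r := ‖w.fst‖
  set R := ‖w‖
  refine (h ((r / R) ^ (1 - γ)) (by positivity) w hw).trans_eq ?_
  congr 1
  have h1γ : 1 - γ ≠ 0 := by linarith
  have e1 : (r / R) ^ (1 - γ) * R = r ^ (1 - γ) * R ^ γ := by
    rw [Real.div_rpow h0.le hw0.le, Real.rpow_sub hw0, Real.rpow_one]
    field_simp
  have e2 : ((r / R) ^ (1 - γ)) ^ (-γ / (1 - γ)) * r = r ^ (1 - γ) * R ^ γ := by
    rw [← Real.rpow_mul (by positivity), mul_div_cancel₀ _ h1γ, Real.div_rpow h0.le hw0.le,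
      Real.rpow_neg h0.le, Real.rpow_neg hw0.le, Real.rpow_sub h0, Real.rpow_one]
    field_simp
  calc C * (γ * (r / R) ^ (1 - γ) * R + (1 - γ) * ((r / R) ^ (1 - γ)) ^ (-γ / (1 - γ)) * r)
      = C * (γ * ((r / R) ^ (1 - γ) * R) +
          (1 - γ) * (((r / R) ^ (1 - γ)) ^ (-γ / (1 - γ)) * r)) := by ring
    _ = _ := by rw [e1, e2]; ring

end Sobolev

/-! ### Carathéodory functions, growth conditions and Hölder's inequality -/

section Caratheodory

variable {α : Type*} [MeasurableSpace α] {μ : Measure α} {f : α → ℝ → ℝ}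

/-- A Carathéodory function agrees, off a null set of `x`, with a jointly measurable function. -/
theorem exists_jointly_measurable_modification (hfm : ∀ s, AEMeasurable (fun x => f x s) μ)
    (hfc : ∀ᵐ x ∂μ, Continuous (f x)) :
    ∃ g : α → ℝ → ℝ, Measurable (Function.uncurry g) ∧ ∀ᵐ x ∂μ, g x = f x := by
  have hgood : ∀ᵐ x ∂μ, Continuous (f x) ∧ ∀ q : ℚ, f x q = (hfm q).mk _ x :=
    hfc.and (ae_all_iff.2 fun q => (hfm q).ae_eq_mk)
  obtain ⟨N, hN, hNm, hNs⟩ := hgood.exists_measurable_mem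
  classical
  let g : α → ℝ → ℝ := fun x s => if x ∈ N then f x s else 0
  have hgc : ∀ x, Continuous (g x) := fun x => by
    by_cases hx : x ∈ N
    · simpa only [g, hx, if_true] using (hNs x hx).1
    · simpa only [g, hx, if_false] using continuous_const
  have hgq : ∀ q : ℚ, Measurable fun x => g x q := fun q => by
    have : (fun x => g x q) = N.indicator ((hfm q).mk _) := by
      ext x
      by_cases hx : x ∈ N
      · simp only [g, hx, if_true, indicator_of_mem, (hNs x hx).2 q]
      · simp only [g, hx, if_false, indicator_of_notMem, not_false_eq_true]
    rw [this]
    exact (hfm q).measurable_mk.indicator hNm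
  have hgs : ∀ s : ℝ, Measurable fun x => g x s := fun s => by
    obtain ⟨q, hq⟩ : ∃ q : ℕ → ℚ, Tendsto (fun n => (q n : ℝ)) atTop (𝓝 s) := by
      obtain ⟨y, hy, hys⟩ := mem_closure_iff_seq_limit.1 (Rat.denseRange_cast (𝕜 := ℝ) s)
      choose q hq using hy
      exact ⟨q, by simpa only [hq] using hys⟩
    refine measurable_of_tendsto_metrizable (fun n => hgq (q n)) (tendsto_pi_nhds.2 fun x => ?_)
    exact ((hgc x).tendsto s).comp hq
  refine ⟨g, ?_, ?_⟩
  · have := measurable_uncurry_of_continuous_of_measurable (u := fun s x => g x s) hgc hgs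
    exact this.comp measurable_swap
  · filter_upwards [hN] with x hx
    ext s
    simp only [g, if_pos hx]

theorem aestronglyMeasurable_comp_caratheodory (hfm : ∀ s, AEMeasurable (fun x => f x s) μ)
    (hfc : ∀ᵐ x ∂μ, Continuous (f x)) {u : α → ℝ} (hu : AEMeasurable u μ) :
    AEStronglyMeasurable (fun x => f x (u x)) μ := by
  obtain ⟨g, hg, hgf⟩ := exists_jointly_measurable_modification hfm hfc
  have h1 : AEMeasurable (fun x => g x (u x)) μ :=
    hg.comp_aemeasurable (aemeasurable_id.prodMk hu)
  refine h1.aestronglyMeasurable.congr ?_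
  filter_upwards [hgf] with x hx
  rw [hx]

theorem aestronglyMeasurable_primitive_caratheodory (hfm : ∀ s, AEMeasurable (fun x => f x s) μ)
    (hfc : ∀ᵐ x ∂μ, Continuous (f x)) {u : α → ℝ} (hu : AEMeasurable u μ) :
    AEStronglyMeasurable (fun x => ∫ r in (0 : ℝ)..u x, f x r) μ := by
  obtain ⟨g, hg, hgf⟩ := exists_jointly_measurable_modification hfm hfc
  have h1 : StronglyMeasurable (fun z : α × ℝ => g z.1 (z.2 * hu.mk u z.1)) := by
    have h2 : Measurable (fun z : α × ℝ => (z.1, z.2 * hu.mk u z.1)) :=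
      measurable_fst.prodMk (measurable_snd.mul (hu.measurable_mk.comp measurable_fst))
    exact (hg.comp h2).stronglyMeasurable
  have h2 : StronglyMeasurable
      (fun x => ∫ r in Ioc (0 : ℝ) 1, g x (r * hu.mk u x)) :=
    h1.integral_prod_right'
  have h3 : AEStronglyMeasurable
      (fun x => hu.mk u x * ∫ r in Ioc (0 : ℝ) 1, g x (r * hu.mk u x)) μ :=
    (hu.measurable_mk.stronglyMeasurable.mul h2).aestronglyMeasurable
  refine h3.congr ?_
  filter_upwards [hgf, hu.ae_eq_mk] with x hx hux
  rw [hx, ← hux, ← intervalIntegral.integral_of_le zero_le_one]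
  simp

end Caratheodory

section Growth

/-- If `|φ'| ≤ C (a + |·|^ρ)`, then `φ` is Lipschitz between `s` and `t` with constant
`C (|a| + |s|^ρ + |t|^ρ)`. -/
theorem abs_sub_le_of_growth {φ : ℝ → ℝ} (hφ : Differentiable ℝ φ) {C a ρ : ℝ} (hC : 0 ≤ C)
    (hρ : 0 ≤ ρ) (h : ∀ s, |deriv φ s| ≤ C * (a + |s| ^ ρ)) {s t r : ℝ} (hr : r ∈ uIcc s t) :
    |φ r - φ s| ≤ C * (|a| + |s| ^ ρ + |t| ^ ρ) * |r - s| := by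
  refine (convex_uIcc s t).norm_image_sub_le_of_norm_deriv_le (fun x _ => hφ x)
    (fun x hx => (h x).trans ?_) left_mem_uIcc hr
  have h1 : |x| ≤ max |s| |t| := by
    rcases mem_uIcc.1 hx with ⟨h1, h2⟩ | ⟨h1, h2⟩
    · exact abs_le_max_abs_abs h1 h2
    · rw [max_comm]; exact abs_le_max_abs_abs h1 h2
  have h2 : |x| ^ ρ ≤ |s| ^ ρ + |t| ^ ρ := by
    have hs : 0 ≤ |s| ^ ρ := by positivity
    have ht : 0 ≤ |t| ^ ρ := by positivity
    rcases le_max_iff.1 h1 with h1 | h1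
    · exact (Real.rpow_le_rpow (abs_nonneg _) h1 hρ).trans (by linarith)
    · exact (Real.rpow_le_rpow (abs_nonneg _) h1 hρ).trans (by linarith)
  refine mul_le_mul_of_nonneg_left ?_ hC
  linarith [le_abs_self a]

/-- The first order Taylor remainder of the primitive of `φ`. -/
theorem abs_primitive_remainder_le {φ : ℝ → ℝ} (hφ : Differentiable ℝ φ) {C a ρ : ℝ} (hC : 0 ≤ C)
    (hρ : 0 ≤ ρ) (h : ∀ s, |deriv φ s| ≤ C * (a + |s| ^ ρ)) (s k : ℝ) :
    |(∫ r in (0 : ℝ)..(s + k), φ r) - (∫ r in (0 : ℝ)..s, φ r) - φ s * k| ≤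
      C * (|a| + |s| ^ ρ + |s + k| ^ ρ) * (|k| * |k|) := by
  have hi : ∀ x y, IntervalIntegrable φ volume x y := fun x y =>
    hφ.continuous.intervalIntegrable x y
  have e : (∫ r in (0 : ℝ)..(s + k), φ r) - (∫ r in (0 : ℝ)..s, φ r) - φ s * k =
      ∫ r in s..(s + k), (φ r - φ s) := by
    rw [intervalIntegral.integral_interval_sub_left (hi _ _) (hi _ _),
      intervalIntegral.integral_sub (hi _ _) intervalIntegrable_const,
      intervalIntegral.integral_const, smul_eq_mul]
    ring
  rw [e, ← mul_assoc]
  have hP : 0 ≤ |a| + |s| ^ ρ + |s + k| ^ ρ := by positivity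
  have := intervalIntegral.norm_integral_le_of_norm_le_const (a := s) (b := s + k)
    (f := fun r => φ r - φ s) (C := C * (|a| + |s| ^ ρ + |s + k| ^ ρ) * |k|) (fun r hr => by
      refine (abs_sub_le_of_growth hφ hC hρ h (uIoc_subset_uIcc hr)).trans ?_
      refine mul_le_mul_of_nonneg_left ?_ (mul_nonneg hC hP)
      have := abs_sub_left_of_mem_uIcc (uIoc_subset_uIcc hr)
      simpa using this)
  simpa using this

end Growth

section Hoelder

variable {α : Type*} [MeasurableSpace α] {μ : Measure α}

theorem qExp_pos {ρ : ℝ} (hρ : 2 ≤ ρ) : 0 < qExp ρ := by unfold qExp; positivity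

theorem pExp_eq {ρ : ℝ} (hρ : 2 ≤ ρ) : pExp ρ = 6 / (5 - ρ) := by
  have : ρ + 1 ≠ 0 := by linarith
  unfold pExp qExp
  rw [div_sub_one this, div_div_div_cancel_right₀ this]
  congr 1; ring

theorem two_le_pExp {ρ : ℝ} (hρ : 2 ≤ ρ) (hρ4 : ρ < 4) : 2 ≤ pExp ρ := by
  rw [pExp_eq hρ, le_div_iff₀ (by linarith)]; linarith

theorem pExp_lt_six {ρ : ℝ} (hρ : 2 ≤ ρ) (hρ4 : ρ < 4) : pExp ρ < 6 := by
  rw [pExp_eq hρ, div_lt_iff₀ (by linarith)]; linarith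

theorem holderTriple_six {ρ : ℝ} (hρ : 2 ≤ ρ) :
    ENNReal.HolderTriple (ENNReal.ofReal (6 / ρ)) 6 (ENNReal.ofReal (qExp ρ)) := by
  constructor
  have h6 : (6 : ℝ≥0∞) = ENNReal.ofReal 6 := by simp
  rw [h6, ← ENNReal.ofReal_inv_of_pos (by positivity), ← ENNReal.ofReal_inv_of_pos (by norm_num),
    ← ENNReal.ofReal_inv_of_pos (qExp_pos hρ), ← ENNReal.ofReal_add (by positivity) (by norm_num)]
  congr 1
  unfold qExp
  field_simp

theorem holderTriple_qExp_pExp {ρ : ℝ} (hρ : 2 ≤ ρ) (hρ4 : ρ < 4) :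
    ENNReal.HolderTriple (ENNReal.ofReal (qExp ρ)) (ENNReal.ofReal (pExp ρ)) 1 := by
  constructor
  have hp : 0 < pExp ρ := by linarith [two_le_pExp hρ hρ4]
  rw [← ENNReal.ofReal_inv_of_pos (qExp_pos hρ), ← ENNReal.ofReal_inv_of_pos hp,
    ← ENNReal.ofReal_add (inv_nonneg.2 (qExp_pos hρ).le) (inv_nonneg.2 hp.le), inv_one,
    ENNReal.ofReal_eq_one]
  rw [pExp_eq hρ, qExp, inv_div, inv_div]
  ring

theorem eLpNorm_rpow_mul_le {ρ : ℝ} (hρ : 2 ≤ ρ) {u g : α → ℝ}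
    (hu : AEStronglyMeasurable u μ) (hg : AEStronglyMeasurable g μ) :
    eLpNorm (fun x => |u x| ^ ρ * g x) (ENNReal.ofReal (qExp ρ)) μ ≤
      eLpNorm u 6 μ ^ ρ * eLpNorm g 6 μ := by
  have := holderTriple_six hρ
  have h1 : eLpNorm (fun x => |u x| ^ ρ) (ENNReal.ofReal (6 / ρ)) μ = eLpNorm u 6 μ ^ ρ := by
    have := eLpNorm_norm_rpow (μ := μ) (p := ENNReal.ofReal (6 / ρ)) u (q := ρ) (by linarith)
    simp only [Real.norm_eq_abs] at this
    rw [this, ← ENNReal.ofReal_mul (by positivity), div_mul_cancel₀ _ (by linarith)]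
    simp
  have h2 : AEStronglyMeasurable (fun x => |u x| ^ ρ) μ :=
    (hu.aemeasurable.abs.pow_const ρ).aestronglyMeasurable
  have := eLpNorm_smul_le_mul_eLpNorm (p := ENNReal.ofReal (6 / ρ)) (q := 6)
    (r := ENNReal.ofReal (qExp ρ)) hg h2
  rwa [h1] at this

/-- Hölder's inequality for the growth bound of the nonlinearity. -/
theorem eLpNorm_growth_mul_le {ρ : ℝ} (hρ : 2 ≤ ρ) (hρ4 : ρ < 4) {a u v g k : α → ℝ}
    (ha : AEMeasurable a μ) (hu : AEStronglyMeasurable u μ) (hv : AEStronglyMeasurable v μ)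
    (hg : AEStronglyMeasurable g μ) (hk : AEStronglyMeasurable k μ) :
    eLpNorm (fun x => (|a x| + |u x| ^ ρ + |v x| ^ ρ) * (|g x| * |k x|)) 1 μ ≤
      eLpNorm (fun x => Real.sqrt |a x| * g x) 2 μ * eLpNorm (fun x => Real.sqrt |a x| * k x) 2 μ +
      (eLpNorm u 6 μ ^ ρ + eLpNorm v 6 μ ^ ρ) * eLpNorm g 6 μ *
        eLpNorm k (ENNReal.ofReal (pExp ρ)) μ := by
  have hsq : AEStronglyMeasurable (fun x => Real.sqrt |a x|) μ :=
    (Real.continuous_sqrt.measurable.comp_aemeasurable ha.abs).aestronglyMeasurable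
  have hpow : ∀ w : α → ℝ, AEStronglyMeasurable w μ → AEStronglyMeasurable (fun x => |w x| ^ ρ) μ :=
    fun w hw => (hw.aemeasurable.abs.pow_const ρ).aestronglyMeasurable
  have h0 : eLpNorm (fun x => |a x| * (|g x| * |k x|)) 1 μ ≤
      eLpNorm (fun x => Real.sqrt |a x| * g x) 2 μ * eLpNorm (fun x => Real.sqrt |a x| * k x) 2 μ := by
    refine le_of_eq_of_le ?_ (eLpNorm_smul_le_mul_eLpNorm (p := 2) (q := 2) (r := 1)
      (hsq.mul hk) (hsq.mul hg))
    refine eLpNorm_congr_norm_ae (Eventually.of_forall fun x => ?_)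
    simp only [Pi.smul_apply', Pi.mul_apply, smul_eq_mul, norm_mul, Real.norm_eq_abs, abs_abs,
      abs_of_nonneg (Real.sqrt_nonneg _)]
    have := Real.mul_self_sqrt (abs_nonneg (a x))
    calc |a x| * (|g x| * |k x|) = (√|a x| * √|a x|) * (|g x| * |k x|) := by rw [this]
      _ = _ := by ring
  have h1 : ∀ w : α → ℝ, AEStronglyMeasurable w μ →
      eLpNorm (fun x => |w x| ^ ρ * (|g x| * |k x|)) 1 μ ≤
        eLpNorm w 6 μ ^ ρ * eLpNorm g 6 μ * eLpNorm k (ENNReal.ofReal (pExp ρ)) μ := by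
    intro w hw
    have := holderTriple_qExp_pExp hρ hρ4
    refine le_trans (le_of_eq_of_le ?_ (eLpNorm_smul_le_mul_eLpNorm (p := ENNReal.ofReal (qExp ρ))
      (q := ENNReal.ofReal (pExp ρ)) (r := 1) hk ((hpow w hw).mul hg))) ?_
    · refine eLpNorm_congr_norm_ae (Eventually.of_forall fun x => ?_)
      simp only [Pi.smul_apply', Pi.mul_apply, smul_eq_mul, norm_mul, Real.norm_eq_abs, abs_abs]
      ring
    · gcongr
      exact eLpNorm_rpow_mul_le hρ hw hg
  have hgk : AEStronglyMeasurable (fun x => |g x| * |k x|) μ := hg.norm.mul hk.norm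
  have haa : AEStronglyMeasurable (fun x => |a x|) μ := ha.abs.aestronglyMeasurable
  have e : (fun x => (|a x| + |u x| ^ ρ + |v x| ^ ρ) * (|g x| * |k x|)) =
      (fun x => |a x| * (|g x| * |k x|)) + ((fun x => |u x| ^ ρ * (|g x| * |k x|)) +
        (fun x => |v x| ^ ρ * (|g x| * |k x|))) := by
    ext x; simp only [Pi.add_apply]; ring
  rw [e]
  refine (eLpNorm_add_le (haa.mul hgk) (((hpow u hu).mul hgk).add ((hpow v hv).mul hgk)) le_rfl).trans
    (add_le_add h0 ((eLpNorm_add_le ((hpow u hu).mul hgk) ((hpow v hv).mul hgk) le_rfl).trans ?_))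
  rw [add_mul, add_mul]
  exact add_le_add (h1 u hu) (h1 v hv)

end Hoelder

/-! ### The Nemytskii operator and its primitive -/

section Multiplication

variable {α : Type*} [MeasurableSpace α] {μ : Measure α}
  {V : Type*} [NormedAddCommGroup V] [NormedSpace ℝ V]

/-- A multiplication `v ↦ m v` that satisfies a norm bound is a bounded operator into `L^p`. -/
theorem exists_mul_clm (i : V →ₗ[ℝ] Lp ℝ 2 μ) {m : α → ℝ} (hm : AEStronglyMeasurable m μ)
    {p : ℝ≥0∞} [Fact (1 ≤ p)] {C : ℝ} (hC : 0 ≤ C)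
    (hb : ∀ v, eLpNorm (fun x => m x * i v x) p μ ≤ ENNReal.ofReal (C * ‖v‖)) :
    ∃ T : V →L[ℝ] Lp ℝ p μ, ∀ v, T v =ᵐ[μ] fun x => m x * i v x := by
  have hmem : ∀ v, MemLp (fun x => m x * i v x) p μ := fun v =>
    ⟨hm.mul (Lp.aestronglyMeasurable _), (hb v).trans_lt ENNReal.ofReal_lt_top⟩
  let T : V →ₗ[ℝ] Lp ℝ p μ :=
    { toFun := fun v => (hmem v).toLp
      map_add' := fun v w => by
        have hi : i (v + w) =ᵐ[μ] i v + i w := by rw [map_add]; exact Lp.coeFn_add _ _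
        refine Lp.ext ?_
        filter_upwards [(hmem (v + w)).coeFn_toLp, (hmem v).coeFn_toLp, (hmem w).coeFn_toLp,
          Lp.coeFn_add (hmem v).toLp (hmem w).toLp, hi] with x h1 h2 h3 h4 h5
        rw [h4, Pi.add_apply, h1, h2, h3, h5, Pi.add_apply, mul_add]
      map_smul' := fun c v => by
        have hi : i (c • v) =ᵐ[μ] c • i v := by rw [map_smul]; exact Lp.coeFn_smul _ _
        refine Lp.ext ?_
        filter_upwards [(hmem (c • v)).coeFn_toLp, (hmem v).coeFn_toLp,
          Lp.coeFn_smul c (hmem v).toLp, hi] with x h1 h2 h3 h4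
        rw [RingHom.id_apply, h3, Pi.smul_apply, h1, h2, h4, Pi.smul_apply, smul_eq_mul,
          smul_eq_mul, mul_left_comm] }
  refine ⟨T.mkContinuous C fun v => ?_, fun v => (hmem v).coeFn_toLp⟩
  change ‖(hmem v).toLp‖ ≤ _
  rw [Lp.norm_toLp]
  exact ENNReal.toReal_le_of_le_ofReal (by positivity) (hb v)

theorem Lp.eLpNorm_eq_ofReal_norm {p : ℝ≥0∞} (f : Lp ℝ p μ) :
    eLpNorm f p μ = ENNReal.ofReal ‖f‖ := by
  rw [Lp.norm_def, ENNReal.ofReal_toReal (Lp.eLpNorm_ne_top _)]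

/-- `V` is continuously included in `L²`, in `L^p` and in the space of all `v` with
`|a|^{1/2} v ∈ L²`, with constant `K`. -/
structure TestSpaceBound (a : α → ℝ) (p K : ℝ) (i : V →ₗ[ℝ] Lp ℝ 2 μ) : Prop where
  nonneg : 0 ≤ K
  two : ∀ v, ‖i v‖ ≤ K * ‖v‖
  weight : ∀ v, eLpNorm (fun x => Real.sqrt |a x| * i v x) 2 μ ≤ ENNReal.ofReal (K * ‖v‖)
  lp : ∀ v, eLpNorm (i v) (ENNReal.ofReal p) μ ≤ ENNReal.ofReal (K * ‖v‖)

theorem TestSpaceBound.mono {a : α → ℝ} {p K K' : ℝ} {i : V →ₗ[ℝ] Lp ℝ 2 μ}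
    (h : TestSpaceBound a p K i) (hK : K ≤ K') : TestSpaceBound a p K' i where
  nonneg := h.nonneg.trans hK
  two v := (h.two v).trans (by gcongr)
  weight v := (h.weight v).trans (by gcongr)
  lp v := (h.lp v).trans (by gcongr)

end Multiplication

/-- A map that satisfies a local Lipschitz estimate with constants that grow like a power of the
norms is Lipschitzian on bounded sets. -/
theorem lipschitzOnWith_of_growth {V Y : Type*} [NormedAddCommGroup V] [NormedAddCommGroup Y]
    (N : V → Y) {B K ρ : ℝ} (hB : 0 ≤ B) (hK : 0 ≤ K) (hρ : 0 ≤ ρ)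
    (hN : ∀ u v, ‖N v - N u‖ ≤ B * (1 + (K * ‖u‖) ^ ρ + (K * ‖v‖) ^ ρ) * ‖v - u‖)
    (s : Set V) (hs : Bornology.IsBounded s) : ∃ L : ℝ≥0, LipschitzOnWith L N s := by
  obtain ⟨R, hR0, hR⟩ := hs.exists_pos_norm_le
  refine ⟨(B * (1 + (K * R) ^ ρ + (K * R) ^ ρ)).toNNReal, LipschitzOnWith.of_dist_le_mul ?_⟩
  intro v hv u hu
  rw [dist_eq_norm, dist_eq_norm, Real.coe_toNNReal _ (by positivity)]
  refine (hN u v).trans ?_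
  gcongr
  · exact hR u hu
  · exact hR v hv

/-- The part of the hypothesis on the nonlinearity that the estimates use, on a measure space. -/
structure GrowthHyp {α : Type*} [MeasurableSpace α] (μ : Measure α) (C ρ : ℝ) (a : α → ℝ)
    (f : α → ℝ → ℝ) : Prop where
  C_nonneg : 0 ≤ C
  two_le : 2 ≤ ρ
  lt_four : ρ < 4
  a_meas : AEMeasurable a μ
  meas : ∀ s, AEMeasurable (fun x => f x s) μ
  diff : ∀ᵐ x ∂μ, Differentiable ℝ (f x)
  growth : ∀ᵐ x ∂μ, ∀ s, |deriv (f x) s| ≤ C * (a x + |s| ^ ρ)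
  zero : MemLp (fun x => f x 0) 2 μ

namespace GrowthHyp

variable {α : Type*} [MeasurableSpace α] {μ : Measure α} {C ρ K : ℝ} {a : α → ℝ}
  {f : α → ℝ → ℝ}
  {V : Type*} [NormedAddCommGroup V] [NormedSpace ℝ V] {i : V →ₗ[ℝ] Lp ℝ 2 μ}
  {W : Type*} [NormedAddCommGroup W] [NormedSpace ℝ W] {j : W →ₗ[ℝ] Lp ℝ 2 μ}

theorem aesm_nemytskii (h : GrowthHyp μ C ρ a f) {u : α → ℝ} (hu : AEStronglyMeasurable u μ) :
    AEStronglyMeasurable (fun x => f x (u x)) μ :=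
  aestronglyMeasurable_comp_caratheodory h.meas (h.diff.mono fun _ hx => hx.continuous)
    hu.aemeasurable

/-- The growth bound, tested with `g ∈ V` and `k ∈ W`, in terms of the norms of `V` and `W`. -/
theorem eLpNorm_growth_le (h : GrowthHyp μ C ρ a f)
    (hV : TestSpaceBound a (pExp ρ) K i) (hV6 : ∀ v, eLpNorm (i v) 6 μ ≤ ENNReal.ofReal (K * ‖v‖))
    (hW : TestSpaceBound a (pExp ρ) K j) (u v g : V) (k : W) :
    eLpNorm (fun x => (|a x| + |i u x| ^ ρ + |i v x| ^ ρ) * (|i g x| * |j k x|)) 1 μ ≤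
      ENNReal.ofReal (K * K * (1 + (K * ‖u‖) ^ ρ + (K * ‖v‖) ^ ρ) * ‖g‖ * ‖k‖) := by
  have hK := hV.nonneg
  have hρ0 : 0 ≤ ρ := by linarith [h.two_le]
  refine (eLpNorm_growth_mul_le h.two_le h.lt_four h.a_meas (Lp.aestronglyMeasurable _)
    (Lp.aestronglyMeasurable _) (Lp.aestronglyMeasurable _) (Lp.aestronglyMeasurable _)).trans ?_
  calc _ ≤ ENNReal.ofReal (K * ‖g‖) * ENNReal.ofReal (K * ‖k‖) +
        (ENNReal.ofReal (K * ‖u‖) ^ ρ + ENNReal.ofReal (K * ‖v‖) ^ ρ) * ENNReal.ofReal (K * ‖g‖) *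
          ENNReal.ofReal (K * ‖k‖) := by
        gcongr
        · exact hV.weight g
        · exact hW.weight k
        · exact hV6 u
        · exact hV6 v
        · exact hV6 g
        · exact hW.lp k
    _ = ENNReal.ofReal ((K * ‖g‖) * (K * ‖k‖) +
          ((K * ‖u‖) ^ ρ + (K * ‖v‖) ^ ρ) * (K * ‖g‖) * (K * ‖k‖)) := by
        rw [ENNReal.ofReal_rpow_of_nonneg (by positivity) hρ0,
          ENNReal.ofReal_rpow_of_nonneg (by positivity) hρ0,
          ← ENNReal.ofReal_add (by positivity) (by positivity),
          ← ENNReal.ofReal_mul (by positivity), ← ENNReal.ofReal_mul (by positivity),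
          ← ENNReal.ofReal_mul (by positivity),
          ← ENNReal.ofReal_add (by positivity) (by positivity)]
    _ = _ := by congr 1; ring

theorem eLpNorm_le_of_growth {F G : α → ℝ} (hC : 0 ≤ C)
    (hle : ∀ᵐ x ∂μ, |F x| ≤ C * G x) {B : ℝ} {p : ℝ≥0∞}
    (hG : eLpNorm G p μ ≤ ENNReal.ofReal B) : eLpNorm F p μ ≤ ENNReal.ofReal (C * B) := by
  refine (eLpNorm_mono_ae_real (g := fun x => C * G x) (hle.mono fun x hx => by simpa using hx)).trans ?_
  have := eLpNorm_const_smul (μ := μ) (p := p) C G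
  simp only [Pi.smul_def, smul_eq_mul] at this
  rw [this, ENNReal.ofReal_mul hC, Real.enorm_eq_ofReal hC]
  gcongr

/-- The Lipschitz estimate for `u ↦ f̂(u)`, tested with `k`. -/
theorem eLpNorm_nemytskii_sub_mul_le (h : GrowthHyp μ C ρ a f)
    (hV : TestSpaceBound a (pExp ρ) K i) (hV6 : ∀ v, eLpNorm (i v) 6 μ ≤ ENNReal.ofReal (K * ‖v‖))
    (hW : TestSpaceBound a (pExp ρ) K j) (u v : V) (k : W) :
    eLpNorm (fun x => (f x (i v x) - f x (i u x)) * j k x) 1 μ ≤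
      ENNReal.ofReal (C * (K * K * (1 + (K * ‖u‖) ^ ρ + (K * ‖v‖) ^ ρ) * ‖v - u‖ * ‖k‖)) := by
  refine eLpNorm_le_of_growth h.C_nonneg ?_ (h.eLpNorm_growth_le hV hV6 hW u v (v - u) k)
  have hsub : i (v - u) =ᵐ[μ] i v - i u := by rw [map_sub]; exact Lp.coeFn_sub _ _
  filter_upwards [h.diff, h.growth, hsub] with x hd hg hs
  rw [hs, Pi.sub_apply, abs_mul, ← mul_assoc, ← mul_assoc]
  exact mul_le_mul_of_nonneg_right
    (abs_sub_le_of_growth hd h.C_nonneg (by linarith [h.two_le]) hg right_mem_uIcc) (abs_nonneg _)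

theorem eLpNorm_zero_mul_le (h : GrowthHyp μ C ρ a f) (hW : TestSpaceBound a (pExp ρ) K j) (k : W) :
    eLpNorm (fun x => f x 0 * j k x) 1 μ ≤
      ENNReal.ofReal ((eLpNorm (fun x => f x 0) 2 μ).toReal * K * ‖k‖) := by
  have := eLpNorm_smul_le_mul_eLpNorm (p := 2) (q := 2) (r := 1)
    (Lp.aestronglyMeasurable (j k)) h.zero.1
  refine this.trans ?_
  rw [mul_assoc, ENNReal.ofReal_mul ENNReal.toReal_nonneg, ENNReal.ofReal_toReal h.zero.2.ne,
    Lp.eLpNorm_eq_ofReal_norm]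
  gcongr
  exact hW.two k

/-- The constant in the bound for `k ↦ f̂(u) k`. -/
theorem exists_eLpNorm_nemytskii_mul_le (h : GrowthHyp μ C ρ a f)
    (hV : TestSpaceBound a (pExp ρ) K i) (hV6 : ∀ v, eLpNorm (i v) 6 μ ≤ ENNReal.ofReal (K * ‖v‖))
    (hW : TestSpaceBound a (pExp ρ) K j) (u : V) :
    ∃ D : ℝ, 0 ≤ D ∧ ∀ k, eLpNorm (fun x => f x (i u x) * j k x) 1 μ ≤ ENNReal.ofReal (D * ‖k‖) := by
  have hK := hV.nonneg
  have hC := h.C_nonneg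
  refine ⟨C * (K * K * (1 + (K * ‖(0 : V)‖) ^ ρ + (K * ‖u‖) ^ ρ) * ‖u - 0‖) +
    (eLpNorm (fun x => f x 0) 2 μ).toReal * K, by positivity, fun k => ?_⟩
  have e : (fun x => f x (i u x) * j k x) =ᵐ[μ]
      (fun x => (f x (i u x) - f x (i (0 : V) x)) * j k x) + (fun x => f x 0 * j k x) := by
    have h0 : i (0 : V) =ᵐ[μ] 0 := by rw [map_zero]; exact Lp.coeFn_zero _ _ _
    filter_upwards [h0] with x hx
    rw [Pi.add_apply, hx, Pi.zero_apply]
    ring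
  have hmu := h.aesm_nemytskii (Lp.aestronglyMeasurable (i u))
  have hm0 := h.aesm_nemytskii (Lp.aestronglyMeasurable (i (0 : V)))
  have hk := Lp.aestronglyMeasurable (j k)
  rw [eLpNorm_congr_ae e]
  refine (eLpNorm_add_le ((hmu.sub hm0).mul hk) (h.zero.1.mul hk) le_rfl).trans ?_
  refine (add_le_add (h.eLpNorm_nemytskii_sub_mul_le hV hV6 hW 0 u k)
    (h.eLpNorm_zero_mul_le hW k)).trans_eq ?_
  rw [← ENNReal.ofReal_add (by positivity) (by positivity)]
  congr 1; ring

/-- `k ↦ f̂(u) k` is bounded into `L¹`. -/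
theorem exists_nemytskii_mul_clm (h : GrowthHyp μ C ρ a f)
    (hV : TestSpaceBound a (pExp ρ) K i) (hV6 : ∀ v, eLpNorm (i v) 6 μ ≤ ENNReal.ofReal (K * ‖v‖))
    (hW : TestSpaceBound a (pExp ρ) K j) (u : V) :
    ∃ D : W →L[ℝ] Lp ℝ 1 μ, ∀ k, D k =ᵐ[μ] fun x => f x (i u x) * j k x := by
  obtain ⟨D, hD, hb⟩ := h.exists_eLpNorm_nemytskii_mul_le hV hV6 hW u
  exact exists_mul_clm j (h.aesm_nemytskii (Lp.aestronglyMeasurable _)) hD hb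

/-- The functional `k ↦ ∫ f̂(u) k`, and its dependence on `u`. -/
theorem exists_dual_nemytskii (h : GrowthHyp μ C ρ a f)
    (hV : TestSpaceBound a (pExp ρ) K i) (hV6 : ∀ v, eLpNorm (i v) 6 μ ≤ ENNReal.ofReal (K * ‖v‖))
    (hW : TestSpaceBound a (pExp ρ) K j) :
    (∀ u k, Integrable (fun x => f x (i u x) * j k x) μ) ∧
    ∃ N : V → StrongDual ℝ W, (∀ u k, N u k = ∫ x, f x (i u x) * j k x ∂μ) ∧
      ∀ s : Set V, Bornology.IsBounded s → ∃ L : ℝ≥0, LipschitzOnWith L N s := by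
  have hK := hV.nonneg
  have hC := h.C_nonneg
  choose D hD using h.exists_nemytskii_mul_clm hV hV6 hW
  have hint : ∀ u k, Integrable (fun x => f x (i u x) * j k x) μ := fun u k =>
    (L1.integrable_coeFn (D u k)).congr (hD u k)
  refine ⟨hint, fun u => (L1.integralCLM (E := ℝ) (μ := μ)).comp (D u), fun u k => ?_, ?_⟩
  · rw [ContinuousLinearMap.comp_apply, ← L1.integral_eq, L1.integral_eq_integral,
      integral_congr_ae (hD u k)]
  refine lipschitzOnWith_of_growth _ (B := C * (K * K)) (K := K) (ρ := ρ) (by positivity) hK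
    (by linarith [h.two_le]) fun u v => ?_
  rw [← ContinuousLinearMap.comp_sub]
  refine ContinuousLinearMap.opNorm_le_bound _ (by positivity) fun k => ?_
  have h1 : ‖(D v - D u) k‖ ≤
      C * (K * K * (1 + (K * ‖u‖) ^ ρ + (K * ‖v‖) ^ ρ) * ‖v - u‖ * ‖k‖) := by
    rw [Lp.norm_def]
    refine ENNReal.toReal_le_of_le_ofReal (by positivity) ?_
    refine le_of_eq_of_le (eLpNorm_congr_ae ?_) (h.eLpNorm_nemytskii_sub_mul_le hV hV6 hW u v k)
    filter_upwards [hD u k, hD v k, Lp.coeFn_sub (D v k) (D u k)] with x h1 h2 h3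
    change (D v k - D u k : Lp ℝ 1 μ) x = _
    rw [h3, Pi.sub_apply, h1, h2, sub_mul]
  rw [ContinuousLinearMap.comp_apply, ← L1.integral_eq]
  calc ‖L1.integral ((D v - D u) k)‖ ≤ ‖(D v - D u) k‖ := L1.norm_integral_le _
    _ ≤ _ := h1.trans_eq (by ring)

/-- In `L²`: the Lipschitz estimate when `ρ = 2` and multiplication by `a` is bounded. -/
theorem exists_L2_nemytskii (h : GrowthHyp μ C 2 a f) (hK : 0 ≤ K)
    (hV6 : ∀ v, eLpNorm (i v) 6 μ ≤ ENNReal.ofReal (K * ‖v‖))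
    (hVa : ∀ v, eLpNorm (fun x => |a x| * i v x) 2 μ ≤ ENNReal.ofReal (K * ‖v‖)) :
    ∃ N : V → Lp ℝ 2 μ, (∀ u, N u =ᵐ[μ] fun x => f x (i u x)) ∧
      ∀ s : Set V, Bornology.IsBounded s → ∃ L : ℝ≥0, LipschitzOnWith L N s := by
  have hC := h.C_nonneg
  have key : ∀ u v : V, eLpNorm (fun x => f x (i v x) - f x (i u x)) 2 μ ≤
      ENNReal.ofReal (C * (K * (1 + (K * ‖u‖) ^ (2 : ℝ) + (K * ‖v‖) ^ (2 : ℝ)) * ‖v - u‖)) := by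
    intro u v
    refine eLpNorm_le_of_growth (G := fun x => (|a x| + |i u x| ^ (2 : ℝ) + |i v x| ^ (2 : ℝ)) *
      |i (v - u) x|) hC ?_ ?_
    · have hsub : i (v - u) =ᵐ[μ] i v - i u := by rw [map_sub]; exact Lp.coeFn_sub _ _
      filter_upwards [h.diff, h.growth, hsub] with x hd hg hs
      rw [hs, Pi.sub_apply, ← mul_assoc]
      exact abs_sub_le_of_growth hd hC zero_le_two hg right_mem_uIcc
    have hm : ∀ w : V, AEStronglyMeasurable (i w) μ := fun w => Lp.aestronglyMeasurable _
    have hpow : ∀ w : V, AEStronglyMeasurable (fun x => |i w x| ^ (2 : ℝ) * |i (v - u) x|) μ :=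
      fun w => ((hm w).aemeasurable.abs.pow_const _).aestronglyMeasurable.mul (hm _).norm
    have haa : AEStronglyMeasurable (fun x => |a x| * |i (v - u) x|) μ :=
      h.a_meas.abs.aestronglyMeasurable.mul (hm _).norm
    have h1 : ∀ w : V, eLpNorm (fun x => |i w x| ^ (2 : ℝ) * |i (v - u) x|) 2 μ ≤
        ENNReal.ofReal ((K * ‖w‖) ^ (2 : ℝ) * (K * ‖v - u‖)) := by
      intro w
      have := eLpNorm_rpow_mul_le (μ := μ) (le_refl (2 : ℝ)) (hm w) (hm (v - u)).norm
      have hq : ENNReal.ofReal (qExp 2) = 2 := by unfold qExp; norm_num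
      rw [hq, eLpNorm_norm] at this
      refine this.trans ?_
      rw [ENNReal.ofReal_mul (by positivity),
        ← ENNReal.ofReal_rpow_of_nonneg (by positivity) zero_le_two]
      gcongr
      · exact hV6 w
      · exact hV6 _
    have h2 : eLpNorm (fun x => |a x| * |i (v - u) x|) 2 μ ≤ ENNReal.ofReal (K * ‖v - u‖) := by
      refine le_of_eq_of_le (eLpNorm_congr_norm_ae (Eventually.of_forall fun x => ?_)) (hVa (v - u))
      simp
    have e : (fun x => (|a x| + |i u x| ^ (2 : ℝ) + |i v x| ^ (2 : ℝ)) * |i (v - u) x|) =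
        (fun x => |a x| * |i (v - u) x|) + ((fun x => |i u x| ^ (2 : ℝ) * |i (v - u) x|) +
          (fun x => |i v x| ^ (2 : ℝ) * |i (v - u) x|)) := by
      ext x; simp only [Pi.add_apply]; ring
    rw [e]
    refine (eLpNorm_add_le haa ((hpow u).add (hpow v)) one_le_two).trans ?_
    refine (add_le_add h2 ((eLpNorm_add_le (hpow u) (hpow v) one_le_two).trans
      (add_le_add (h1 u) (h1 v)))).trans_eq ?_
    rw [← ENNReal.ofReal_add (by positivity) (by positivity),
      ← ENNReal.ofReal_add (by positivity) (by positivity)]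
    congr 1; ring
  have hmem : ∀ u, MemLp (fun x => f x (i u x)) 2 μ := fun u => by
    have h1 : MemLp (fun x => f x (i u x) - f x (i (0 : V) x)) 2 μ :=
      ⟨(h.aesm_nemytskii (Lp.aestronglyMeasurable _)).sub
        (h.aesm_nemytskii (Lp.aestronglyMeasurable _)),
        (key 0 u).trans_lt ENNReal.ofReal_lt_top⟩
    refine (h1.add h.zero).ae_eq ?_
    have h0 : i (0 : V) =ᵐ[μ] 0 := by rw [map_zero]; exact Lp.coeFn_zero _ _ _
    filter_upwards [h0] with x hx
    rw [Pi.add_apply, hx, Pi.zero_apply]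
    ring
  refine ⟨fun u => (hmem u).toLp, fun u => (hmem u).coeFn_toLp, ?_⟩
  refine lipschitzOnWith_of_growth _ (B := C * K) (K := K) (ρ := 2) (by positivity) hK
    zero_le_two fun u v => ?_
  rw [← MemLp.toLp_sub, Lp.norm_toLp]
  refine ENNReal.toReal_le_of_le_ofReal (by positivity) ((key u v).trans_eq ?_)
  congr 1; ring

/-- The primitive of the nonlinearity is Fréchet differentiable into `L¹`. -/
theorem exists_hasFDerivAt_primitive (h : GrowthHyp μ C ρ a f)
    (hV : TestSpaceBound a (pExp ρ) K i)
    (hV6 : ∀ v, eLpNorm (i v) 6 μ ≤ ENNReal.ofReal (K * ‖v‖)) :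
    ∃ Φ : V → Lp ℝ 1 μ, (∀ u, Φ u =ᵐ[μ] fun x => ∫ r in (0 : ℝ)..i u x, f x r) ∧
      ∀ u, ∃ D : V →L[ℝ] Lp ℝ 1 μ, (∀ k, D k =ᵐ[μ] fun x => f x (i u x) * i k x) ∧
        HasFDerivAt Φ D u := by
  have hK := hV.nonneg
  have hC := h.C_nonneg
  have hρ0 : 0 ≤ ρ := by linarith [h.two_le]
  choose D hD using h.exists_nemytskii_mul_clm hV hV6 hV
  have hrem : ∀ u k : V, eLpNorm (fun x => (∫ r in (0 : ℝ)..i (u + k) x, f x r) -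
      (∫ r in (0 : ℝ)..i u x, f x r) - f x (i u x) * i k x) 1 μ ≤
      ENNReal.ofReal (C * (K * K * (1 + (K * ‖u‖) ^ ρ + (K * ‖u + k‖) ^ ρ) * ‖k‖ * ‖k‖)) := by
    intro u k
    refine eLpNorm_le_of_growth hC ?_ (h.eLpNorm_growth_le hV hV6 hV u (u + k) k k)
    have hadd : i (u + k) =ᵐ[μ] i u + i k := by rw [map_add]; exact Lp.coeFn_add _ _
    filter_upwards [h.diff, h.growth, hadd] with x hd hg hs
    rw [hs, Pi.add_apply, ← mul_assoc]
    exact abs_primitive_remainder_le hd hC hρ0 hg _ _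
  have hm : ∀ u, AEStronglyMeasurable (fun x => ∫ r in (0 : ℝ)..i u x, f x r) μ := fun u =>
    aestronglyMeasurable_primitive_caratheodory h.meas (h.diff.mono fun _ hx => hx.continuous)
      (Lp.aestronglyMeasurable _).aemeasurable
  have hmem : ∀ u, MemLp (fun x => ∫ r in (0 : ℝ)..i u x, f x r) 1 μ := fun u => by
    have h1 : MemLp (fun x => (∫ r in (0 : ℝ)..i (0 + u) x, f x r) -
        (∫ r in (0 : ℝ)..i (0 : V) x, f x r) - f x (i (0 : V) x) * i u x) 1 μ :=
      ⟨((hm _).sub (hm _)).sub ((Lp.aestronglyMeasurable (D 0 u)).congr (hD 0 u)),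
        (hrem 0 u).trans_lt ENNReal.ofReal_lt_top⟩
    refine (h1.add ((Lp.memLp (D 0 u)).ae_eq (hD 0 u))).ae_eq ?_
    have h0 : i (0 : V) =ᵐ[μ] 0 := by rw [map_zero]; exact Lp.coeFn_zero _ _ _
    filter_upwards [h0] with x hx
    rw [Pi.add_apply, hx, Pi.zero_apply, zero_add, intervalIntegral.integral_same]
    ring
  refine ⟨fun u => (hmem u).toLp, fun u => (hmem u).coeFn_toLp, fun u => ⟨D u, hD u, ?_⟩⟩
  have hbound : ∀ k : V, ‖(hmem (u + k)).toLp - (hmem u).toLp - D u k‖ ≤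
      C * (K * K * (1 + (K * ‖u‖) ^ ρ + (K * ‖u + k‖) ^ ρ) * ‖k‖ * ‖k‖) := by
    intro k
    rw [Lp.norm_def]
    refine ENNReal.toReal_le_of_le_ofReal (by positivity) (le_of_eq_of_le (eLpNorm_congr_ae ?_)
      (hrem u k))
    filter_upwards [hD u k, (hmem (u + k)).coeFn_toLp, (hmem u).coeFn_toLp,
      Lp.coeFn_sub (hmem (u + k)).toLp (hmem u).toLp,
      Lp.coeFn_sub ((hmem (u + k)).toLp - (hmem u).toLp) (D u k)] with x h1 h2 h3 h4 h5
    rw [h5, Pi.sub_apply, h4, Pi.sub_apply, h1, h2, h3]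
  rw [hasFDerivAt_iff_isLittleO_nhds_zero]
  have hO : (fun k => (hmem (u + k)).toLp - (hmem u).toLp - D u k) =O[𝓝 0]
      fun k : V => ‖k‖ ^ 2 := by
    refine Asymptotics.IsBigO.of_bound
      (C * (K * K * (1 + (K * ‖u‖) ^ ρ + (K * (‖u‖ + 1)) ^ ρ))) ?_
    filter_upwards [Metric.ball_mem_nhds (0 : V) one_pos] with k hk
    rw [mem_ball_zero_iff] at hk
    refine (hbound k).trans ?_
    rw [norm_pow, norm_norm]
    calc _ ≤ C * (K * K * (1 + (K * ‖u‖) ^ ρ + (K * (‖u‖ + 1)) ^ ρ) * ‖k‖ * ‖k‖) := by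
          gcongr
          exact (norm_add_le _ _).trans (by linarith)
      _ = _ := by ring
  exact hO.trans_isLittleO (Asymptotics.isLittleO_norm_pow_id one_lt_two)

end GrowthHyp

/-! ### The fractional power spaces over `Ω` -/

section FracSpaceNorm

variable {X : Type*} [NormedAddCommGroup X] [NormedSpace ℝ X] {A : X →ₗ.[ℝ] X} {α : ℝ}

theorem negPow_eq_fracPow (A : X →ₗ.[ℝ] X) (hα : α ≠ 0) :
    negPow A α = fracPow (semigroupOf A) α := by
  rw [negPow, if_neg hα, fracPow]

/-- Every element of `X^α` is `A^{-α} x` for some `x` of comparable norm. -/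
theorem FracSpace.exists_negPow_eq (v : FracSpace A α) :
    ∃ x : X, negPow A α x = FracSpace.incl A α v ∧ ‖x‖ ≤ 2 * ‖v‖ := by
  rcases eq_or_ne v 0 with rfl | hv
  · exact ⟨0, by simp, by simp⟩
  obtain ⟨x, hx, hx'⟩ := Submodule.Quotient.norm_mk_lt (FracSpace.posPow A α v) (norm_pos_iff.2 hv)
  refine ⟨x, ?_, hx'.le.trans_eq (two_mul _).symm⟩
  have := congrArg (FracSpace.posPow A α).symm hx
  rw [LinearEquiv.symm_apply_apply] at this
  exact congrArg Subtype.val this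

theorem FracSpace.exists_incl_eq (A : X →ₗ.[ℝ] X) (α : ℝ) (x : X) :
    ∃ v : FracSpace A α, FracSpace.incl A α v = negPow A α x ∧ ‖v‖ ≤ ‖x‖ := by
  refine ⟨(FracSpace.posPow A α).symm (Submodule.Quotient.mk x), rfl, ?_⟩
  change ‖FracSpace.posPow A α ((FracSpace.posPow A α).symm (Submodule.Quotient.mk x))‖ ≤ _
  rw [LinearEquiv.apply_symm_apply]
  exact Submodule.Quotient.norm_mk_le _ x

end FracSpaceNorm

section Embeddings

variable {Ω : Set E3}

/-- The exponent `θ` of the interpolation `|u|_{L^p} ≤ |u|_{L²}^{1-θ} |u|_{L⁶}^θ`. -/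
def thetaExp (ρ : ℝ) : ℝ := 1 - (6 - pExp ρ) / (2 * pExp ρ)

theorem thetaExp_nonneg {ρ : ℝ} (hρ : 2 ≤ ρ) (hρ4 : ρ < 4) : 0 ≤ thetaExp ρ := by
  have := two_le_pExp hρ hρ4
  rw [thetaExp, sub_nonneg, div_le_one (by linarith)]; linarith

theorem thetaExp_lt_one {ρ : ℝ} (hρ : 2 ≤ ρ) (hρ4 : ρ < 4) : thetaExp ρ < 1 := by
  have := two_le_pExp hρ hρ4
  have h6 := pExp_lt_six hρ hρ4
  rw [thetaExp, sub_lt_self_iff]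
  exact div_pos (by linarith) (by linarith)

/-- `H¹₀(Ω) ⊂ L^p(Ω)` with the interpolation inequality. -/
theorem H10.exists_lp_interpolation (Ω : Set E3) {ρ : ℝ} (hρ : 2 ≤ ρ) (hρ4 : ρ < 4) :
    ∃ C : ℝ, 0 ≤ C ∧ ∀ w ∈ H10 Ω, eLpNorm w.fst (ENNReal.ofReal (pExp ρ)) (volOn Ω) ≤
      ENNReal.ofReal (C * ‖w.fst‖ ^ (1 - thetaExp ρ) * ‖w‖ ^ thetaExp ρ) := by
  obtain ⟨C, hC, h⟩ := exists_sobolev_H10 Ω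
  have h0 := thetaExp_nonneg hρ hρ4
  have h1 := thetaExp_lt_one hρ hρ4
  refine ⟨C ^ thetaExp ρ, by positivity, fun w hw => ?_⟩
  refine (eLpNorm_le_interpolate_two_six (Lp.aestronglyMeasurable w.fst) (two_le_pExp hρ hρ4)
    (pExp_lt_six hρ hρ4).le).trans ?_
  have e : (6 - pExp ρ) / (2 * pExp ρ) = 1 - thetaExp ρ := by rw [thetaExp]; ring
  rw [← thetaExp, e, Lp.eLpNorm_eq_ofReal_norm]
  calc _ ≤ ENNReal.ofReal ‖w.fst‖ ^ (1 - thetaExp ρ) * ENNReal.ofReal (C * ‖w‖) ^ thetaExp ρ := by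
        gcongr
        exact h w hw
    _ = _ := by
        rw [ENNReal.ofReal_rpow_of_nonneg (norm_nonneg _) (by linarith),
          ENNReal.ofReal_rpow_of_nonneg (by positivity) h0, ← ENNReal.ofReal_mul (by positivity),
          Real.mul_rpow hC (norm_nonneg _)]
        congr 1; ring

theorem rpow_interpolate_le {r R t : ℝ} (hr : 0 ≤ r) (hrR : r ≤ R) (ht : t < 1) :
    r ^ (1 - t) * R ^ t ≤ R := by
  have hR : 0 ≤ R := hr.trans hrR
  calc r ^ (1 - t) * R ^ t ≤ R ^ (1 - t) * R ^ t := by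
        gcongr
    _ = R := by
        rw [← Real.rpow_add' hR (by simp)]; simp

variable {A : L2 Ω →ₗ.[ℝ] L2 Ω} {ρ γ : ℝ} {a : E3 → ℝ}

/-- The bounds on `X^{1/2}`, from those on `H¹₀(Ω)`. -/
theorem exists_testSpaceBound_half (hρ : 2 ≤ ρ) (hρ4 : ρ < 4) (hγ : 0 < γ) (hγ1 : γ < 1)
    (ha : EClass Ω γ a)
    (hX : ∃ K : ℝ, ∀ u : FracSpace A (1 / 2),
      ∃ w ∈ H10 Ω, w.fst = FracSpace.incl A (1 / 2) u ∧ ‖w‖ ≤ K * ‖u‖) :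
    ∃ K, TestSpaceBound a (pExp ρ) K (FracSpace.incl A (1 / 2)) ∧
      ∀ v, eLpNorm (FracSpace.incl A (1 / 2) v) 6 (volOn Ω) ≤ ENNReal.ofReal (K * ‖v‖) := by
  obtain ⟨K, hK⟩ := hX
  obtain ⟨C1, hC1, h1⟩ := exists_sobolev_H10 Ω
  obtain ⟨C2, hC2, h2⟩ := ha.exists_interpolation hγ1
  obtain ⟨C3, hC3, h3⟩ := H10.exists_lp_interpolation Ω hρ hρ4
  set D := (1 + C1 + C2 + C3) * |K| with hD
  have hD0 : 0 ≤ D := by positivity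
  have key : ∀ (C r R s : ℝ), 0 ≤ C → C ≤ 1 + C1 + C2 + C3 → 0 ≤ s → 0 ≤ R →
      r ≤ C * R → R ≤ K * s → r ≤ D * s := by
    intro C r R s hC hCs hs hR hr hRs
    calc r ≤ C * R := hr
      _ ≤ (1 + C1 + C2 + C3) * (|K| * s) := by
          gcongr
          exact hRs.trans (by gcongr; exact le_abs_self K)
      _ = D * s := by rw [hD]; ring
  refine ⟨D, ⟨hD0, fun v => ?_, fun v => ?_, fun v => ?_⟩, fun v => ?_⟩ <;>
    obtain ⟨w, hw, hwv, hwn⟩ := hK v <;> rw [← hwv]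
  · exact key 1 _ _ _ zero_le_one (by linarith) (norm_nonneg v) (norm_nonneg w)
      ((norm_fst_le_of_L2Pair w).trans_eq (one_mul _).symm) hwn
  · refine (h2 w hw).trans (ENNReal.ofReal_le_ofReal (key C2 _ _ _ hC2 (by linarith)
      (norm_nonneg v) (norm_nonneg w) ?_ hwn))
    rw [mul_assoc]
    gcongr
    exact rpow_interpolate_le (norm_nonneg _) (norm_fst_le_of_L2Pair w) hγ1
  · refine (h3 w hw).trans (ENNReal.ofReal_le_ofReal (key C3 _ _ _ hC3 (by linarith)
      (norm_nonneg v) (norm_nonneg w) ?_ hwn))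
    rw [mul_assoc]
    gcongr
    exact rpow_interpolate_le (norm_nonneg _) (norm_fst_le_of_L2Pair w) (thetaExp_lt_one hρ hρ4)
  · exact (h1 w hw).trans (ENNReal.ofReal_le_ofReal (key C1 _ _ _ hC1 (by linarith)
      (norm_nonneg v) (norm_nonneg w) le_rfl hwn))

/-- A weighted estimate on `H¹₀(Ω)` with interpolation exponent `θ` carries over to `X^α`,
`θ / 2 < α < 1 / 2`. -/
theorem exists_weighted_bound_fracSpace {M δ : ℝ} (hS : IsDecayingSemigroup (semigroupOf A) M δ)
    (hX : ∃ K : ℝ, ∀ u : FracSpace A (1 / 2),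
      ∃ w ∈ H10 Ω, w.fst = FracSpace.incl A (1 / 2) u ∧ ‖w‖ ≤ K * ‖u‖)
    {m : E3 → ℝ} (hm : AEStronglyMeasurable m (volOn Ω)) {p : ℝ≥0∞} [Fact (1 ≤ p)] {C θ α : ℝ}
    (hθ : 0 ≤ θ) (hθ1 : θ < 1) (hC : 0 ≤ C)
    (hb : ∀ w ∈ H10 Ω, eLpNorm (fun x => m x * w.fst x) p (volOn Ω) ≤
      ENNReal.ofReal (C * ‖w.fst‖ ^ (1 - θ) * ‖w‖ ^ θ))
    (hα : θ / 2 < α) (hα1 : α < 1 / 2) :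
    ∃ K : ℝ, 0 ≤ K ∧ ∀ v : FracSpace A α,
      eLpNorm (fun x => m x * FracSpace.incl A α v x) p (volOn Ω) ≤ ENNReal.ofReal (K * ‖v‖) := by
  obtain ⟨K, hK⟩ := hX
  have hH : ∀ y : L2 Ω, ∃ w ∈ H10 Ω, w.fst = fracPow (semigroupOf A) (1 / 2) y ∧
      ‖w‖ ≤ |K| * ‖y‖ := by
    intro y
    obtain ⟨v, hv, hvn⟩ := FracSpace.exists_incl_eq A (1 / 2) y
    obtain ⟨w, hw, hwv, hwn⟩ := hK v
    refine ⟨w, hw, ?_, hwn.trans ?_⟩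
    · rw [hwv, hv, negPow_eq_fracPow A (by norm_num)]
    · calc K * ‖v‖ ≤ |K| * ‖v‖ := by gcongr; exact le_abs_self K
        _ ≤ _ := by gcongr
  obtain ⟨L, hL, hLb⟩ := hS.exists_mul_fracPow_bound hm (p := p) (C := C * |K| ^ θ) (θ := θ)
    (β := α) (C' := |K|) hθ hθ1 (by positivity) (abs_nonneg _)
    (fun y => by
      obtain ⟨w, -, hwy, hwn⟩ := hH y
      rw [← hwy]
      exact (norm_fst_le_of_L2Pair w).trans hwn)
    (fun y => by
      obtain ⟨w, hw, hwy, hwn⟩ := hH y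
      rw [← hwy]
      refine (hb w hw).trans (ENNReal.ofReal_le_ofReal ?_)
      calc C * ‖w.fst‖ ^ (1 - θ) * ‖w‖ ^ θ ≤ C * ‖w.fst‖ ^ (1 - θ) * (|K| * ‖y‖) ^ θ := by gcongr
        _ = _ := by rw [Real.mul_rpow (abs_nonneg _) (norm_nonneg _)]; ring) hα hα1
  refine ⟨L * 2, by positivity, fun v => ?_⟩
  obtain ⟨x, hx, hxn⟩ := FracSpace.exists_negPow_eq v
  rw [← hx, negPow_eq_fracPow A (by linarith)]
  refine (hLb x).trans (ENNReal.ofReal_le_ofReal ?_)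
  rw [mul_assoc]
  gcongr

theorem aestronglyMeasurable_sqrt_abs (ha : AEMeasurable a (volOn Ω)) :
    AEStronglyMeasurable (fun x => Real.sqrt |a x|) (volOn Ω) :=
  (Real.continuous_sqrt.measurable.comp_aemeasurable ha.abs).aestronglyMeasurable

/-- The bounds on `X^α`. -/
theorem exists_testSpaceBound {M δ α : ℝ} (hS : IsDecayingSemigroup (semigroupOf A) M δ)
    (hρ : 2 ≤ ρ) (hρ4 : ρ < 4) (hγ : 0 < γ) (hγ1 : γ < 1) (ha : EClass Ω γ a)
    (hX : ∃ K : ℝ, ∀ u : FracSpace A (1 / 2),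
      ∃ w ∈ H10 Ω, w.fst = FracSpace.incl A (1 / 2) u ∧ ‖w‖ ≤ K * ‖u‖)
    (hα1 : α < 1 / 2) (hγα : γ / 2 < α) (hθα : thetaExp ρ / 2 < α) :
    ∃ K, TestSpaceBound a (pExp ρ) K (FracSpace.incl A α) := by
  have hp1 : (1 : ℝ≥0∞) ≤ ENNReal.ofReal (pExp ρ) := by
    rw [ENNReal.one_le_ofReal]; linarith [two_le_pExp hρ hρ4]
  have : Fact ((1 : ℝ≥0∞) ≤ ENNReal.ofReal (pExp ρ)) := ⟨hp1⟩
  obtain ⟨C2, hC2, h2⟩ := ha.exists_interpolation hγ1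
  obtain ⟨C3, hC3, h3⟩ := H10.exists_lp_interpolation Ω hρ hρ4
  obtain ⟨K2, hK2, hb2⟩ := exists_weighted_bound_fracSpace hS hX
    (aestronglyMeasurable_sqrt_abs ha.1) hγ.le hγ1 hC2 h2 hγα hα1
  obtain ⟨K3, hK3, hb3⟩ := exists_weighted_bound_fracSpace hS hX (m := fun _ => 1)
    (p := ENNReal.ofReal (pExp ρ)) aestronglyMeasurable_const (thetaExp_nonneg hρ hρ4)
    (thetaExp_lt_one hρ hρ4) hC3 (by simpa only [one_mul] using h3) hθα hα1
  simp only [one_mul] at hb3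
  set K1 := ‖negPow A α‖ * 2 with hK1
  have hK10 : 0 ≤ K1 := by positivity
  refine ⟨K1 + K2 + K3, by positivity, fun v => ?_, fun v => (hb2 v).trans ?_,
    fun v => (hb3 v).trans ?_⟩
  · obtain ⟨x, hx, hxn⟩ := FracSpace.exists_negPow_eq v
    rw [← hx]
    calc ‖negPow A α x‖ ≤ ‖negPow A α‖ * (2 * ‖v‖) :=
          (ContinuousLinearMap.le_opNorm _ _).trans (by gcongr)
      _ = K1 * ‖v‖ := by rw [hK1]; ring
      _ ≤ _ := by gcongr; linarith
  · gcongr; linarith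
  · gcongr; linarith

end Embeddings

theorem NonlinearityHyp.growthHyp {Ω : Set E3} {Cbar ρ γ : ℝ} {c a : E3 → ℝ} {f : E3 → ℝ → ℝ}
    (hf : NonlinearityHyp Ω Cbar ρ γ c a f) : GrowthHyp (volOn Ω) Cbar ρ a f where
  C_nonneg := hf.Cbar_nonneg
  two_le := hf.two_le_rho
  lt_four := hf.rho_lt_four
  a_meas := hf.a_mem.1
  meas := hf.f_measurable
  diff := hf.f_contDiff.mono fun _ hx => hx.differentiable one_ne_zero
  growth := hf.f_growth
  zero := hf.f_zero

end

theorem proposition5p3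
    (Ω : Set E3) (hΩ : IsOpen Ω)
    (Cbar ρ γ : ℝ) (c a : E3 → ℝ) (f : E3 → ℝ → ℝ)
    (hf : NonlinearityHyp Ω Cbar ρ γ c a f)
    (A : L2 Ω →ₗ.[ℝ] L2 Ω) (hA : IsSectorial A) (hspec : ∀ z ∈ spectrumC A, 0 < z.re)
    -- the space `X^{1/2}` is continuously included in `H¹₀(Ω)`
    (hX : ∃ K : ℝ, ∀ u : FracSpace A (1 / 2),
      ∃ w ∈ H10 Ω, w.fst = FracSpace.incl A (1 / 2) u ∧ ‖w‖ ≤ K * ‖u‖) :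
    -- `F̂` maps `X^{1/2}` into `L¹(Ω)` and is Fréchet differentiable with `DF̂(u)h = f̂(u)h`
    (∃ Fhat : FracSpace A (1 / 2) → Lp ℝ 1 (volOn Ω),
      (∀ u, Fhat u =ᵐ[volOn Ω] nemytskii (primitiveF f) (FracSpace.incl A (1 / 2) u)) ∧
      ∀ u, ∃ D : FracSpace A (1 / 2) →L[ℝ] Lp ℝ 1 (volOn Ω),
        (∀ h, D h =ᵐ[volOn Ω] fun x =>
          nemytskii f (FracSpace.incl A (1 / 2) u) x * FracSpace.incl A (1 / 2) h x) ∧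
        HasFDerivAt Fhat D u) ∧
    -- an admissible order exists
    (∃ α, AdmissibleOrder Ω ρ γ a α) ∧
    ∀ α, AdmissibleOrder Ω ρ γ a α →
      (¬ RegularCase Ω ρ a →
        -- the space `X^α` is continuously included in `L^p(Ω)`
        (∃ K : ℝ, ∀ v : FracSpace A α,
          MemLp (FracSpace.incl A α v) (ENNReal.ofReal (pExp ρ)) (volOn Ω) ∧
          eLpNorm (FracSpace.incl A α v) (ENNReal.ofReal (pExp ρ)) (volOn Ω) ≤
            ENNReal.ofReal (K * ‖v‖)) ∧
        -- multiplication by `|a|^{1/2}` is bounded from `X^α` to `X = L²(Ω)`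
        (∃ T : FracSpace A α →L[ℝ] L2 Ω, ∀ v,
          T v =ᵐ[volOn Ω] fun x => Real.sqrt |a x| * FracSpace.incl A α v x) ∧
        -- the functional `v ↦ ∫ f(x, u(x)) v(x) dx` is defined, linear and bounded on `X^α`, and
        -- as a map into the dual space of `X^α` it is Lipschitzian on bounded sets
        (∀ (u : FracSpace A (1 / 2)) (v : FracSpace A α),
          Integrable (fun x =>
            nemytskii f (FracSpace.incl A (1 / 2) u) x * FracSpace.incl A α v x) (volOn Ω)) ∧
        ∃ N : FracSpace A (1 / 2) → StrongDual ℝ (FracSpace A α),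
          (∀ u v, N u v =
            ∫ x, nemytskii f (FracSpace.incl A (1 / 2) u) x * FracSpace.incl A α v x
              ∂(volOn Ω)) ∧
          ∀ B : Set (FracSpace A (1 / 2)), Bornology.IsBounded B →
            ∃ K : ℝ≥0, LipschitzOnWith K N B) ∧
      (RegularCase Ω ρ a →
        -- the map `u ↦ f̂(u)` goes into `X = L²(Ω)` and is Lipschitzian on bounded sets
        ∃ N : FracSpace A (1 / 2) → L2 Ω,
          (∀ u, N u =ᵐ[volOn Ω] nemytskii f (FracSpace.incl A (1 / 2) u)) ∧
          ∀ B : Set (FracSpace A (1 / 2)), Bornology.IsBounded B →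
            ∃ K : ℝ≥0, LipschitzOnWith K N B) := by
  have hG := hf.growthHyp
  have hρ := hf.two_le_rho
  have hρ4 := hf.rho_lt_four
  obtain ⟨M, δ, hS⟩ := hA.exists_isDecayingSemigroup hspec
  obtain ⟨K, hV, hV6⟩ := exists_testSpaceBound_half hρ hρ4 hf.gamma_pos hf.gamma_lt_one hf.a_mem hX
  refine ⟨?_, ?_, fun α hα => ⟨fun hreg => ?_, fun hreg => ?_⟩⟩
  · obtain ⟨Φ, hΦ, hD⟩ := hG.exists_hasFDerivAt_primitive hV hV6
    refine ⟨Φ, fun u => (hΦ u).trans ?_, hD⟩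
    filter_upwards [hf.f_contDiff] with x hx
    rw [nemytskii, primitiveF, if_pos hx.continuous]
  · by_cases hreg : RegularCase Ω ρ a
    · exact ⟨0, fun _ => rfl, fun h => absurd hreg h⟩
    · have h1 : max (γ / 2) ((1 - (6 - pExp ρ) / (2 * pExp ρ)) / 2) < 1 / 2 := by
        have := thetaExp_lt_one hρ hρ4
        rw [thetaExp] at this
        exact max_lt (by linarith [hf.gamma_lt_one]) (by linarith)
      obtain ⟨α, hα, hα'⟩ := exists_between h1
      refine ⟨α, fun h => absurd h hreg, fun _ => ⟨?_, hα', hα⟩⟩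
      exact lt_trans (by linarith [hf.gamma_pos]) ((le_max_left _ _).trans_lt hα)
  · obtain ⟨-, hα1, hα2⟩ := hα.2 hreg
    obtain ⟨K', hW⟩ := exists_testSpaceBound hS hρ hρ4 hf.gamma_pos hf.gamma_lt_one hf.a_mem hX hα1
      ((le_max_left _ _).trans_lt hα2) ((le_max_right _ _).trans_lt hα2)
    have hV' := hV.mono (le_max_left K K')
    have hV6' : ∀ v, eLpNorm (FracSpace.incl A (1 / 2) v) 6 (volOn Ω) ≤
        ENNReal.ofReal (max K K' * ‖v‖) := fun v => (hV6 v).trans (by gcongr; exact le_max_left _ _)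
    have hW' := hW.mono (le_max_right K K')
    obtain ⟨hint, hN⟩ := hG.exists_dual_nemytskii hV' hV6' hW'
    exact ⟨⟨K', fun v => ⟨⟨Lp.aestronglyMeasurable _, (hW.lp v).trans_lt ENNReal.ofReal_lt_top⟩,
      hW.lp v⟩⟩, exists_mul_clm _ (aestronglyMeasurable_sqrt_abs hf.a_mem.1) hW.nonneg hW.weight,
      hint, hN⟩
  · obtain ⟨rfl, ha⟩ := hreg
    obtain ⟨C, hC, hb⟩ : ∃ C : ℝ, 0 < C ∧ ∀ u ∈ H10 Ω,
        eLpNorm (fun x => Real.sqrt |a x ^ 2| * u.fst x) 2 (volOn Ω) ≤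
          ENNReal.ofReal (C * ‖u‖) := by
      rcases ha.2 with ⟨-, h, -⟩ | ⟨-, h⟩
      · exact absurd h (lt_irrefl 1)
      · exact h
    obtain ⟨K0, hK0⟩ := hX
    have hK := hV.nonneg
    refine hG.exists_L2_nemytskii (K := K + C * |K0|) (by positivity)
      (fun v => (hV6 v).trans ?_) fun v => ?_
    · gcongr
      have : 0 ≤ C * |K0| := by positivity
      linarith
    · obtain ⟨w, hw, hwv, hwn⟩ := hK0 v
      have h1 := hb w hw
      simp only [abs_pow, Real.sqrt_sq (abs_nonneg _)] at h1
      rw [← hwv]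
      refine h1.trans (ENNReal.ofReal_le_ofReal ?_)
      calc C * ‖w‖ ≤ C * (|K0| * ‖v‖) := by
            gcongr
            exact hwn.trans (by gcongr; exact le_abs_self K0)
        _ = C * |K0| * ‖v‖ := by ring
        _ ≤ _ := by gcongr; linarith
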